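/- Notation. For $\theta\in\mathbb R$ let $\mathbb C_\theta=\{s\in\mathbb C:\operatorname{Re}s>\theta\}$. Let $\mathcal H$ be the Hilbert space of Dirichlet series $f(s)=\sum_{n\ge1}a_nn^{-s}$ with $\|f\|=(\sum_n|a_n|^2)^{1/2}<\infty$; its elements are analytic on $\mathbb C_{1/2}$. The Gordon–Hedenmalm class $\mathcal G$ consists of the maps $\varphi(s)=c_0s+\psi(s)$, where $c_0\ge0$ is an integer (the characteristic of $\varphi$) and $\psi(s)=\sum_{n\ge1}c_nn^{-s}$ converges uniformly in $\mathbb C_\varepsilon$ for every $\varepsilon>0$, such that $\psi(\mathbb C_0)\subseteq\mathbb C_{1/2}$ if $c_0=0$, and, if $c_0\ge1$, either $\psi\equiv c_1$ with $\operatorname{Re}c_1\ge0$ or $\psi(\mathbb C_0)\subseteq\mathbb C_0$. By the Gordon–Hedenmalm theorem each $\varphi\in\mathcal G$ induces a bounded composition operator $C_\varphi f=f\circ\varphi$ on $\mathcal H$. Let $\mathcal C(\mathcal H)=\{C_\varphi:\varphi\in\mathcal G\}$, with the operator norm topology, and let $\|T\|_e$ be the essential norm of $T$, i.e. the distance of $T$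 to the compact operators on $\mathcal H$ in operator norm. For a finite set $\mathcal Q$ of primes let $\varphi_{\mathcal Q}(s)=c_0s+\sum_nc_nn^{-s}$ for $s\in\mathbb C_0$, the sum being over the integers $n\ge1$ (including $n=1$) all of whose prime factors belong to $\mathcal Q$. Put $\theta=0$ if $c_0\ge1$ and $\theta=1/2$ if $c_0=0$. For $\alpha\in\mathbb R$, $\varphi_{\mathcal Q}$ admits a finite angular derivative at $i\alpha$ if $\liminf_{s\to i\alpha,\,s\in\mathbb C_0}(\operatorname{Re}\varphi_{\mathcal Q}(s)-\theta)/\operatorname{Re}s<\infty$; then $\varphi_{\mathcal Q}$ and its derivative have nontangential limits at $i\alpha$, denoted $\varphi_{\mathcal Q}(i\alpha)$ and $\varphi_{\mathcal Q}'(i\alpha)$, and $\varphi_{\mathcal Q}'(i\alpha)\in(0,\infty)$. Theorem. 1. Let $\varphi_0,\varphi_1\in\mathcal G$ have positive characteristic, let $\mathcal Q$ be a finite set of $d$ primes, let $\alpha\in\mathbb R$, and assume that $\varphi_{0,\mathcal Q}$ admits a finite angular derivative at $i\alpha$. Then either $\varphi_{1,\mathcal Q}$ admits a finite angular derivative at $i\alpha$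 with $\varphi_{1,\mathcal Q}(i\alpha)=\varphi_{0,\mathcal Q}(i\alpha)$ and $\varphi_{1,\mathcal Q}'(i\alpha)=\varphi_{0,\mathcal Q}'(i\alpha)$, or $$\|C_{\varphi_0}-C_{\varphi_1}\|_e\ \ge\ \frac1{\varphi_{0,\mathcal Q}'(i\alpha)^{d/2}}.$$ 2. Let $\varphi_0,\varphi_1\in\mathcal G$ have the same positive characteristic, and assume that $C_{\varphi_0}$ and $C_{\varphi_1}$ belong to the same connected component of $\mathcal C(\mathcal H)$. Then for every finite set $\mathcal Q$ of primes and every $\alpha\in\mathbb R$ such that $\varphi_{0,\mathcal Q}$ admits a finite angular derivative at $i\alpha$, $\varphi_{1,\mathcal Q}$ admits a finite angular derivative at $i\alpha$ with $\varphi_{1,\mathcal Q}(i\alpha)=\varphi_{0,\mathcal Q}(i\alpha)$ and $\varphi_{1,\mathcal Q}'(i\alpha)=\varphi_{0,\mathcal Q}'(i\alpha)$. 3. For every prime $p$ there is a constant $C_p>0$, depending only on $p$, such that the following holds with $\mathcal Q=\{p\}$. Let $\varphi_0,\varphi_1\in\mathcal G$ have zero characteristic, let $\alpha\in\mathbb R$,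 and assume that $\varphi_{0,\mathcal Q}$ admits a finite angular derivative at $i\alpha$. Then either $\varphi_{1,\mathcal Q}$ admits a finite angular derivative at $i\alpha$ with the same value $\varphi_{1,\mathcal Q}(i\alpha)=\varphi_{0,\mathcal Q}(i\alpha)$ and $\varphi_{1,\mathcal Q}'(i\alpha)=\varphi_{0,\mathcal Q}'(i\alpha)$, or $$\|C_{\varphi_0}-C_{\varphi_1}\|_e\ \ge\ \frac{C_p}{\varphi_{0,\mathcal Q}'(i\alpha)^{1/2}}.$$ 4. If $\varphi_0,\varphi_1\in\mathcal G$ have zero characteristic and $C_{\varphi_0}$, $C_{\varphi_1}$ belong to the same connected component of $\mathcal C(\mathcal H)$, then the conclusion of 2 holds for every $\mathcal Q=\{p\}$, $p$ prime. -/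

import Mathlib

open Filter Topology

noncomputable section

namespace DirichletComposition

/-- The Hardy-Hilbert space of Dirichlet series with square summable coefficients. An element is
identified with its coefficient sequence `(a_n)`, `n ≥ 1`; the norm is the `ℓ²` norm. -/
abbrev Hardy : Type := lp (fun _ : ℕ+ => ℂ) 2

/-- The value at `s` of the Dirichlet series `∑ a_n n^{-s}` with coefficients `f`; the series
converges absolutely for `Re s > 1/2`. -/
def Hardy.eval (f : Hardy) (s : ℂ) : ℂ := ∑' n : ℕ+, f n * ((n : ℕ) : ℂ) ^ (-s)

/-- The `N`-th partial sum of `∑_{n ≥ 1} c_n n^{-s}`. -/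
def partialSum (c : ℕ → ℂ) (N : ℕ) (s : ℂ) : ℂ := ∑ n ∈ Finset.Icc 1 N, c n * (n : ℂ) ^ (-s)

/-- The sum of the (possibly only conditionally convergent) Dirichlet series
`∑_{n ≥ 1} c_n n^{-s}`, as the limit of its partial sums. -/
def dirichletSum (c : ℕ → ℂ) (s : ℂ) : ℂ := limUnder atTop (fun N => partialSum c N s)

/-- The Gordon-Hedenmalm class: the maps `φ(s) = c₀ s + ψ(s)`, `ψ(s) = ∑_{n ≥ 1} c_n n^{-s}`. The
coefficient `coeff 0` plays no role. -/
structure Symbol where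
  /-- the characteristic `c₀` -/
  char : ℕ
  /-- the coefficients `c_n`, `n ≥ 1`, of `ψ` -/
  coeff : ℕ → ℂ
  /-- the series `ψ` converges uniformly in every half-plane `Re s > ε`, `ε > 0` -/
  uniform : ∀ ε : ℝ, 0 < ε →
    TendstoUniformlyOn (partialSum coeff) (dirichletSum coeff) atTop {s : ℂ | ε < s.re}
  maps_zero : char = 0 → ∀ s : ℂ, 0 < s.re → 1 / 2 < (dirichletSum coeff s).re
  maps_pos : 1 ≤ char →
    (0 ≤ (coeff 1).re ∧ ∀ s : ℂ, 0 < s.re → dirichletSum coeff s = coeff 1) ∨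
      ∀ s : ℂ, 0 < s.re → 0 < (dirichletSum coeff s).re

/-- The map `φ(s) = c₀ s + ψ(s)` on the right half-plane. -/
def Symbol.toFun (φ : Symbol) (s : ℂ) : ℂ := φ.char * s + dirichletSum φ.coeff s

/-- A symbol is a self-map of the half-plane `Re s > 1/2`. -/
theorem Symbol.half_lt_re (φ : Symbol) {s : ℂ} (hs : 1 / 2 < s.re) : 1 / 2 < (φ.toFun s).re := by
  have hs0 : 0 < s.re := by linarith
  rcases Nat.eq_zero_or_pos φ.char with h | h
  · simpa [Symbol.toFun, h] using φ.maps_zero h s hs0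
  · have h1 : (1 : ℝ) ≤ φ.char := by exact_mod_cast h
    have h2 : 0 ≤ (dirichletSum φ.coeff s).re := by
      rcases φ.maps_pos h with ⟨h3, h4⟩ | h3
      · rw [h4 s hs0]; exact h3
      · exact (h3 s hs0).le
    simp only [Symbol.toFun, Complex.add_re, Complex.mul_re, Complex.natCast_re,
      Complex.natCast_im, zero_mul, sub_zero]
    nlinarith

/-- For a finite set `Q` of primes, the map `φ_Q(s) = c₀ s + ∑ c_n n^{-s}` on the right half-plane,
where the sum is over the integers `n ≥ 1` all of whose prime factors are in `Q` (`n = 1`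
included). The series converges absolutely for `Re s > 0`, see `Symbol.summable_restrict`. -/
def Symbol.restrict (φ : Symbol) (Q : Finset ℕ) (s : ℂ) : ℂ :=
  φ.char * s + ∑' n : Nat.factoredNumbers Q, φ.coeff n * ((n : ℕ) : ℂ) ^ (-s)

theorem Symbol.summable_restrict (φ : Symbol) (Q : Finset ℕ) {s : ℂ} (hs : 0 < s.re) :
    Summable (fun n : Nat.factoredNumbers Q => ‖φ.coeff n * ((n : ℕ) : ℂ) ^ (-s)‖) := by
  have hu := (φ.uniform (s.re / 4) (by linarith)).uniformCauchySeqOn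
  rw [Metric.uniformCauchySeqOn_iff] at hu
  obtain ⟨N, hN⟩ := hu 1 one_pos
  have hx : ((s.re / 2 : ℝ) : ℂ) ∈ {s' : ℂ | s.re / 4 < s'.re} := by
    simp only [Set.mem_ofPred_eq, Complex.ofReal_re]; linarith
  have hc : ∀ n : ℕ, N < n → ‖φ.coeff n * (n : ℂ) ^ (-((s.re / 2 : ℝ) : ℂ))‖ ≤ 1 := by
    intro n hn
    obtain ⟨m, rfl⟩ : ∃ m, n = m + 1 := ⟨n - 1, by omega⟩
    have h := hN (m + 1) hn.le m (by omega) _ hx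
    rw [dist_eq_norm, partialSum, partialSum, Finset.sum_Icc_succ_top (by omega),
      add_sub_cancel_left] at h
    exact h.le
  have hr : ((s.re / 2 : ℝ) : ℂ) ≠ 0 := by
    rw [Ne, Complex.ofReal_eq_zero]; linarith
  have hsum := (EulerProduct.summable_and_hasSum_factoredNumbers_prod_filter_prime_geometric
    (f := (riemannZetaSummandHom hr : ℕ →* ℂ)) (fun {p} hp => by
      change ‖(p : ℂ) ^ (-((s.re / 2 : ℝ) : ℂ))‖ < 1
      rw [Complex.norm_natCast_cpow_of_pos hp.pos]
      simp only [Complex.neg_re, Complex.ofReal_re]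
      exact Real.rpow_lt_one_of_one_lt_of_neg (by exact_mod_cast hp.one_lt) (by linarith)) Q).1
  have key : ∀ n : ℕ, n ≠ 0 → ‖φ.coeff n * (n : ℂ) ^ (-s)‖ =
      ‖φ.coeff n * (n : ℂ) ^ (-((s.re / 2 : ℝ) : ℂ))‖ *
        ‖(n : ℂ) ^ (-((s.re / 2 : ℝ) : ℂ))‖ := by
    intro n hn
    have hn' : 0 < n := Nat.pos_of_ne_zero hn
    rw [norm_mul, norm_mul, Complex.norm_natCast_cpow_of_pos hn',
      Complex.norm_natCast_cpow_of_pos hn', mul_assoc,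
      ← Real.rpow_add (by exact_mod_cast hn')]
    simp only [Complex.neg_re, Complex.ofReal_re]
    ring_nf
  refine Summable.of_norm_bounded_eventually hsum ?_
  have hfin : {n : Nat.factoredNumbers Q | (n : ℕ) ≤ N}.Finite :=
    (Set.finite_Iic N).preimage Subtype.val_injective.injOn
  filter_upwards [hfin.compl_mem_cofinite] with n hn
  have hn2 : N < (n : ℕ) := by simpa using hn
  rw [norm_norm, key n n.2.1]
  exact mul_le_of_le_one_left (norm_nonneg _) (hc n hn2)

/-- `T` is the composition operator `C_φ`, i.e. `T f = f ∘ φ` on `Re s > 1/2` for all `f`. Such a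
`T` is unique, since a Dirichlet series is determined by its values. -/
def IsCompositionOperator (φ : Symbol) (T : Hardy →L[ℂ] Hardy) : Prop :=
  ∀ (f : Hardy) (s : ℂ), 1 / 2 < s.re → (T f).eval s = f.eval (φ.toFun s)

/-- The set of all composition operators; as a subset of the space of bounded operators, it
carries the topology of the operator norm. -/
def compositionOperators : Set (Hardy →L[ℂ] Hardy) := {T | ∃ φ, IsCompositionOperator φ T}

/-- The essential norm: the distance to the compact operators in the operator norm. -/
def essentialNorm (T : Hardy →L[ℂ] Hardy) : ℝ :=
  ⨅ K : {K : Hardy →L[ℂ] Hardy // IsCompactOperator K}, ‖T - K‖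

/-- `g` has the nontangential limit `l` at the boundary point `iα` of the right half-plane: it
tends to `l` within every sector `|s - iα| ≤ M Re s`. -/
def NontangentialLimit (g : ℂ → ℂ) (α : ℝ) (l : ℂ) : Prop :=
  ∀ M : ℝ, Tendsto g
    (𝓝[{s : ℂ | 0 < s.re ∧ ‖s - α * Complex.I‖ ≤ M * s.re}] (α * Complex.I)) (𝓝 l)

/-- A map `g` from the right half-plane to the half-plane `Re > θ` has a finite angular derivative
at `iα`: the lower limit of `(Re g(s) - θ) / Re s`, as `s` tends to `iα` without restriction in
the right half-plane, is finite. -/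
def HasFiniteAngularDerivative (θ : ℝ) (g : ℂ → ℂ) (α : ℝ) : Prop :=
  liminf (fun s : ℂ => ((((g s).re - θ) / s.re : ℝ) : EReal))
    (𝓝[{s : ℂ | 0 < s.re}] (α * Complex.I)) < ⊤

/-- `g` has a finite angular derivative at `iα`, with boundary value `g(iα) = v` and angular
derivative `g'(iα) = δ`, these being the nontangential limits of `g` and of `g'`. -/
structure HasAngularData (θ : ℝ) (g : ℂ → ℂ) (α : ℝ) (v : ℂ) (δ : ℝ) : Prop where
  finite : HasFiniteAngularDerivative θ g α
  value : NontangentialLimit g α v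
  deriv : NontangentialLimit (deriv g) α (δ : ℂ)

end DirichletComposition

end

noncomputable section

namespace DirichletComposition

open ComplexConjugate LSeries

local notation "⟪" x ", " y "⟫" => inner ℂ x y

/-! Write `K_S(w) = ∑_{m ∈ S} m^{-w}`, and let `E` be the integers with all prime factors in `Q`, `d
= |Q|`. The operators are tested on normalised kernel vectors: `y` has entries `m^{-conj s}`, `m ∈
E`, and `f` has entries `m^{-conj a}`, `m ∈ S`. The part of `l^{-φ}` carried by `E` is computed from
the coefficients: the equation `F' = -log l · φ' F` gives a recursion over divisors, and it
restricts to divisor-closed sets. Hence `⟪y, C_φ f⟫ = K_S(conj a + φ_Q(s))`, with `S = E` for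
positive characteristic and `S` all positive integers for characteristic zero.

Take `a = φ_{0,Q}(s)` and let `s = iα + σ(1 + iM)`, `σ → 0+`. By the Julia-Caratheodory theorem
`φ_{0,Q}(s) = v + δσ(1 + iM) + o(σ)`. Near its pole, `K_S` behaves like `R` over the `d`-th power of
the distance, so the normalised entry of `C_{φ₀}` has modulus tending to `√(R/R_E) δ^{-d/2}`, with
`R_E` the constant of `K_E`. The entry of `C_{φ₁}` involves `K_S(conj φ_{0,Q}(s) + φ_{1,Q}(s))`. It
is negligible if `φ_{1,Q}` has no finite angular derivative or if the boundary values miss the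
poles; if the derivatives differ, it becomes negligible as the slope `M` grows. The vectors `y/‖y‖`
are weakly null, so compact perturbations do not affect these limits
(`le_essentialNorm_of_kernelVec`, `le_essentialNorm_sub`, `le_essentialNorm_sub_of_data`).

One obstruction is left for positive characteristic: `K_E` may have other poles of full order on the
imaginary axis, at common periods of `p^{-w}`, `p ∈ Q`. Shifting the supports of `y` and `f` by
`n^{c₀}` and `n` multiplies the entries by `n^{-ψ_Q(s)}`, and a suitable `n` separates distinct
boundary values, or distinct characteristics (`angular_alternative_nonempty`). For `Q = ∅` there is
no pole, and the monomials `n^{-s}` are the test vectors (`angular_alternative_empty`). For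
characteristic zero `K_S` is the zeta function. Its pole is simple, which matches `K_E` exactly when
`Q = {p}`, and the residues `1` and `1/log p` give `C_p = √(log p)`.

The statements on components follow because the bound depends on `φ₀` only through `δ`: operators
closer than this fixed distance share their angular data, so the data are constant on a connected
component. -/

/-! ### The Julia-Caratheodory theorem in the right half-plane. -/

theorem norm_add_conj_sq_sub_norm_sub_sq (a b : ℂ) :
    ‖a + conj b‖ ^ 2 - ‖a - b‖ ^ 2 = 4 * (a.re * b.re) := by
  rw [← Complex.normSq_eq_norm_sq, ← Complex.normSq_eq_norm_sq, Complex.normSq_apply,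
    Complex.normSq_apply]
  simp only [Complex.add_re, Complex.add_im, Complex.conj_re, Complex.conj_im, Complex.sub_re,
    Complex.sub_im]
  ring

theorem norm_sub_lt_norm_add_conj {a b : ℂ} (ha : 0 < a.re) (hb : 0 < b.re) :
    ‖a - b‖ < ‖a + conj b‖ := by
  have h := norm_add_conj_sq_sub_norm_sub_sq a b
  have h2 := mul_pos ha hb
  exact lt_of_pow_lt_pow_left₀ 2 (norm_nonneg _) (by linarith)

/-- The Schwarz-Pick inequality for self-maps of the right half-plane. -/
theorem schwarz_pick_dist {g : ℂ → ℂ} (hd : DifferentiableOn ℂ g {s | 0 < s.re})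
    (hg : ∀ s : ℂ, 0 < s.re → 0 < (g s).re) {s t : ℂ} (hs : 0 < s.re) (ht : 0 < t.re) :
    ‖g s - g t‖ * ‖s + conj t‖ ≤ ‖s - t‖ * ‖g s + conj (g t)‖ := by
  -- The Cayley map of the unit disc onto the half-plane with `0 ↦ t`; conjugating `g` by such maps
  -- reduces the claim to the Schwarz lemma.
  set m : ℂ → ℂ := fun z => (t + conj t * z) / (1 - z) with hm
  have hz1 : ∀ z : ℂ, ‖z‖ < 1 → (1 - z) ≠ 0 := by
    intro z hz h
    have : z = 1 := by linear_combination -h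
    rw [this] at hz; simp at hz
  have hmre : ∀ z : ℂ, ‖z‖ < 1 → 0 < (m z).re := by
    intro z hz
    have h1 : (m z).re = t.re * (1 - ‖z‖ ^ 2) / ‖1 - z‖ ^ 2 := by
      have e : m z = (t + conj t * z) * conj (1 - z) / ((‖1 - z‖ ^ 2 : ℝ) : ℂ) := by
        rw [hm]
        have := Complex.mul_conj (1 - z)
        rw [Complex.normSq_eq_norm_sq] at this
        rw [← this, mul_div_mul_right]
        intro h
        exact hz1 z hz ((map_eq_zero (starRingEnd ℂ)).1 h)
      rw [e, Complex.div_ofReal_re]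
      congr 1
      rw [← Complex.normSq_eq_norm_sq, Complex.normSq_apply]
      simp only [Complex.mul_re, Complex.add_re, Complex.mul_im, Complex.add_im, Complex.conj_re,
        Complex.conj_im, Complex.sub_re, Complex.sub_im, Complex.one_re, Complex.one_im, map_sub,
        map_one]
      ring
    rw [h1]
    have h2 : 0 < ‖1 - z‖ := norm_pos_iff.2 (hz1 z hz)
    have h3 : 0 < 1 - ‖z‖ ^ 2 := by nlinarith [norm_nonneg z]
    positivity
  set f : ℂ → ℂ := fun z => (g (m z) - g t) / (g (m z) + conj (g t)) with hf
  have hden : ∀ z : ℂ, ‖z‖ < 1 → g (m z) + conj (g t) ≠ 0 := by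
    intro z hz h
    have h1 := hg _ (hmre z hz)
    have h2 := hg t ht
    have := congrArg Complex.re h
    simp only [Complex.add_re, Complex.conj_re, Complex.zero_re] at this
    linarith
  have hdm : DifferentiableOn ℂ m (Metric.ball 0 1) := by
    intro z hz
    have hz' : ‖z‖ < 1 := by simpa using hz
    exact (((differentiableAt_const _).add ((differentiableAt_const _).mul differentiableAt_id)).div
      ((differentiableAt_const _).sub differentiableAt_id) (hz1 z hz')).differentiableWithinAt
  have hgm : DifferentiableOn ℂ (fun z => g (m z)) (Metric.ball 0 1) :=
    hd.comp hdm (fun z hz => hmre z (by simpa using hz))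
  have hdf : DifferentiableOn ℂ f (Metric.ball 0 1) :=
    (hgm.sub (differentiableOn_const _)).div (hgm.add (differentiableOn_const _))
      (fun z hz => hden z (by simpa using hz))
  have hmaps : Set.MapsTo f (Metric.ball 0 1) (Metric.ball 0 1) := by
    intro z hz
    have hz' : ‖z‖ < 1 := by simpa using hz
    rw [mem_ball_zero_iff, hf, norm_div, div_lt_one (norm_pos_iff.2 (hden z hz'))]
    exact norm_sub_lt_norm_add_conj (hg _ (hmre z hz')) (hg t ht)
  have hf0 : f 0 = 0 := by simp [hf, hm]
  have hst : s + conj t ≠ 0 := by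
    intro h
    have := congrArg Complex.re h
    simp only [Complex.add_re, Complex.conj_re, Complex.zero_re] at this
    linarith
  set z := (s - t) / (s + conj t) with hz
  have hzn : ‖z‖ < 1 := by
    rw [hz, norm_div, div_lt_one (norm_pos_iff.2 hst)]
    exact norm_sub_lt_norm_add_conj hs ht
  have hmz : m z = s := by
    have h0 := hz1 z hzn
    rw [hm]
    rw [div_eq_iff h0, hz]
    field_simp
    ring
  have key := Complex.norm_le_norm_of_mapsTo_ball hdf (hmaps.mono_right Metric.ball_subset_closedBall) hf0 hzn
  rw [hf, hz] at key
  simp only [← hz, hmz] at key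
  rw [hz, norm_div, norm_div, div_le_div_iff₀ (norm_pos_iff.2 (by simpa only [hmz] using hden z hzn))
    (norm_pos_iff.2 hst)] at key
  exact key

/-- Pick's inequality for two points, for maps into the closed right half-plane. -/
theorem pick_two_points {g : ℂ → ℂ} (hd : DifferentiableOn ℂ g {s | 0 < s.re})
    (hg : ∀ s : ℂ, 0 < s.re → 0 ≤ (g s).re) {s t : ℂ} (hs : 0 < s.re) (ht : 0 < t.re) :
    ‖g s + conj (g t)‖ ^ 2 * (s.re * t.re) ≤ (g s).re * (g t).re * ‖s + conj t‖ ^ 2 := by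
  -- Schwarz-Pick needs a strictly positive real part, so `g` is shifted by `ε`, which then tends to
  -- zero.
  have hpos : ∀ ε : ℝ, 0 < ε → ‖(g s + ε) + conj (g t + ε)‖ ^ 2 * (s.re * t.re) ≤
      (g s + ε).re * (g t + ε).re * ‖s + conj t‖ ^ 2 := by
    intro ε hε
    have h := schwarz_pick_dist (g := fun z => g z + ε) (hd.add (differentiableOn_const _))
      (fun z hz => by
        have := hg z hz
        simp only [Complex.add_re, Complex.ofReal_re]; linarith) hs ht
    have h1 := norm_add_conj_sq_sub_norm_sub_sq (g s + ε) (g t + ε)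
    have h2 := norm_add_conj_sq_sub_norm_sub_sq s t
    have h3 := pow_le_pow_left₀ (by positivity) h 2
    rw [mul_pow, mul_pow] at h3
    have h4 : ‖g s + ε - (g t + ε)‖ ^ 2 = ‖(g s + ε) + conj (g t + ε)‖ ^ 2 -
      4 * ((g s + ε).re * (g t + ε).re) := by linarith
    have h5 : ‖s - t‖ ^ 2 = ‖s + conj t‖ ^ 2 - 4 * (s.re * t.re) := by linarith
    rw [h4, h5] at h3
    nlinarith
  have h1 : Tendsto (fun ε : ℝ => ‖(g s + ε) + conj (g t + ε)‖ ^ 2 * (s.re * t.re)) (𝓝[>] 0)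
      (𝓝 (‖(g s + (0 : ℝ)) + conj (g t + (0 : ℝ))‖ ^ 2 * (s.re * t.re))) := by
    refine (Continuous.tendsto ?_ 0).mono_left nhdsWithin_le_nhds
    fun_prop
  have h2 : Tendsto (fun ε : ℝ => (g s + ε).re * (g t + ε).re * ‖s + conj t‖ ^ 2) (𝓝[>] 0)
      (𝓝 ((g s + (0 : ℝ)).re * (g t + (0 : ℝ)).re * ‖s + conj t‖ ^ 2)) := by
    refine (Continuous.tendsto ?_ 0).mono_left nhdsWithin_le_nhds
    fun_prop
  have := le_of_tendsto_of_tendsto h1 h2 (eventually_mem_nhdsWithin.mono fun ε hε => hpos ε hε)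
  simpa using this

/-- If the angular mass of `F` at the origin vanishes, then `s F(s)` tends to zero in sectors. -/
theorem tendsto_mul_zero_of_angular_mass_zero {F : ℂ → ℂ}
    (hd : DifferentiableOn ℂ F {s | 0 < s.re}) (hF : ∀ s : ℂ, 0 < s.re → 0 ≤ (F s).re)
    (h0 : ∀ ε : ℝ, 0 < ε → ∃ s : ℂ, 0 < s.re ∧ (F s).re * ‖s‖ ^ 2 < ε * s.re) (M : ℝ) :
    Tendsto (fun s => s * F s) (𝓝[{s : ℂ | 0 < s.re ∧ ‖s‖ ≤ M * s.re}] 0) (𝓝 0) := by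
  rcases lt_or_ge M 0 with hM | hM
  · have : {s : ℂ | 0 < s.re ∧ ‖s‖ ≤ M * s.re} = ∅ := by
      ext s
      simp only [Set.mem_ofPred_eq, Set.mem_empty_iff_false, iff_false, not_and, not_le]
      intro hs
      have := mul_neg_of_neg_of_pos hM hs
      linarith [norm_nonneg s]
    rw [this]; simp
  rw [Metric.tendsto_nhds]
  intro η hη
  set ε := η / (M + 3) with hε
  have hεpos : 0 < ε := by positivity
  obtain ⟨s₀, hs₀, hlt⟩ := h0 ε hεpos
  have e1 : ∀ᶠ s : ℂ in 𝓝 0, (F s₀).re * ‖s + conj s₀‖ ^ 2 < ε * s₀.re := by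
    have : Tendsto (fun s : ℂ => (F s₀).re * ‖s + conj s₀‖ ^ 2) (𝓝 0)
        (𝓝 ((F s₀).re * ‖0 + conj s₀‖ ^ 2)) := Continuous.tendsto (by fun_prop) 0
    rw [zero_add, RCLike.norm_conj] at this
    exact this.eventually_lt_const hlt
  have e2 : ∀ᶠ s : ℂ in 𝓝 0, ‖s‖ * ‖F s₀‖ < ε := by
    have : Tendsto (fun s : ℂ => ‖s‖ * ‖F s₀‖) (𝓝 0) (𝓝 (‖(0 : ℂ)‖ * ‖F s₀‖)) :=
      Continuous.tendsto (by fun_prop) 0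
    rw [norm_zero, zero_mul] at this
    exact this.eventually_lt_const hεpos
  filter_upwards [mem_nhdsWithin_of_mem_nhds e1, mem_nhdsWithin_of_mem_nhds e2,
    self_mem_nhdsWithin] with s h1 h2 hs
  obtain ⟨hs, hsM⟩ := hs
  rw [dist_zero_right]
  set X := ‖s * F s‖ with hX
  set Y := ‖s * F s + s * conj (F s₀)‖ with hY
  have hp := pick_two_points hd hF hs hs₀
  -- Pick's inequality for `s` and `s₀`, multiplied by `|s|²`: one factor `|s|` is absorbed by `|s|
  -- ≤ M Re s`, the other turns `F(s)` into `sF(s)`.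
  have hYsq : Y ^ 2 ≤ M * ε * X := by
    have a1 : Y ^ 2 * (s.re * s₀.re) ≤ ‖s‖ ^ 2 * ((F s).re * (F s₀).re * ‖s + conj s₀‖ ^ 2) := by
      rw [hY, ← mul_add, norm_mul, mul_pow, mul_assoc]
      gcongr
    have a2 : ‖s‖ ^ 2 * ((F s).re * (F s₀).re * ‖s + conj s₀‖ ^ 2) ≤
        (M * s.re * X) * (ε * s₀.re) := by
      have b1 : ‖s‖ ^ 2 * (F s).re ≤ M * s.re * X := by
        rw [hX, norm_mul]
        calc ‖s‖ ^ 2 * (F s).re ≤ ‖s‖ ^ 2 * ‖F s‖ := by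
              gcongr; exact Complex.re_le_norm _
          _ = ‖s‖ * (‖s‖ * ‖F s‖) := by ring
          _ ≤ M * s.re * (‖s‖ * ‖F s‖) := by gcongr
      calc _ = (‖s‖ ^ 2 * (F s).re) * ((F s₀).re * ‖s + conj s₀‖ ^ 2) := by ring
        _ ≤ _ := mul_le_mul b1 h1.le (mul_nonneg (hF _ hs₀) (by positivity)) (by positivity)
    have a3 : Y ^ 2 * (s.re * s₀.re) ≤ (M * ε * X) * (s.re * s₀.re) := by linarith
    exact le_of_mul_le_mul_right a3 (mul_pos hs hs₀)
  have hXY : X ≤ Y + ε := by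
    have : s * F s = (s * F s + s * conj (F s₀)) - s * conj (F s₀) := by ring
    calc X = ‖(s * F s + s * conj (F s₀)) - s * conj (F s₀)‖ := by rw [hX, ← this]
      _ ≤ Y + ‖s * conj (F s₀)‖ := norm_sub_le _ _
      _ ≤ Y + ε := by rw [norm_mul, RCLike.norm_conj]; linarith
  have hYle : Y ≤ (M + 1) * ε := by
    by_contra! hcon
    have hMε : 0 ≤ M * ε := by positivity
    nlinarith [mul_le_mul_of_nonneg_left hXY hMε, norm_nonneg (s * F s + s * conj (F s₀))]
  calc X ≤ (M + 2) * ε := by linarith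
    _ < (M + 3) * ε := by nlinarith
    _ = η := by rw [hε]; field_simp

/-- The boundary value `v` is a cluster value of `G` along points `u n → 0` with `Re G ≤ A Re`.
Passing to the limit in Pick's inequality gives Julia's inequality, which says that `1/(G - v)`
carries a positive point mass at the origin. Removing this mass `c/s` leaves a function without mass
there, so `s/(G - v) → c` in sectors and `δ = 1/c`. -/
theorem exists_angular_quotient_limit_zero {G : ℂ → ℂ} (hd : DifferentiableOn ℂ G {s | 0 < s.re})
    (hG : ∀ s : ℂ, 0 < s.re → 0 < (G s).re) {A : ℝ}
    (hA : ∀ ε : ℝ, 0 < ε → ∃ s : ℂ, 0 < s.re ∧ ‖s‖ < ε ∧ (G s).re ≤ A * s.re) :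
    ∃ (v : ℂ) (δ : ℝ), v.re = 0 ∧ 0 < δ ∧ ∀ M : ℝ,
      Tendsto (fun s => (G s - v) / s) (𝓝[{s : ℂ | 0 < s.re ∧ ‖s‖ ≤ M * s.re}] 0) (𝓝 (δ : ℂ)) := by
  have hApos : 0 < A := by
    obtain ⟨s, h1, -, h3⟩ := hA 1 one_pos
    by_contra! h
    nlinarith [hG s h1]
  choose u hu0 hu1 hu2 using fun n : ℕ => hA (1 / ((n : ℝ) + 1)) (by positivity)
  have hu : Tendsto u atTop (𝓝 0) :=
    squeeze_zero_norm (fun n => (hu1 n).le) tendsto_one_div_add_atTop_nhds_zero_nat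
  have hG' : ∀ s : ℂ, 0 < s.re → 0 ≤ (G s).re := fun s hs => (hG s hs).le
  have hpick : ∀ s : ℂ, 0 < s.re → ∀ n, ‖G s + conj (G (u n))‖ ^ 2 * s.re ≤
      A * (G s).re * ‖s + conj (u n)‖ ^ 2 := by
    intro s hs n
    have h := pick_two_points hd hG' hs (hu0 n)
    refine le_of_mul_le_mul_right (a := (u n).re) ?_ (hu0 n)
    calc _ = ‖G s + conj (G (u n))‖ ^ 2 * (s.re * (u n).re) := by ring
      _ ≤ _ := h
      _ = ((G s).re * ‖s + conj (u n)‖ ^ 2) * (G (u n)).re := by ring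
      _ ≤ ((G s).re * ‖s + conj (u n)‖ ^ 2) * (A * (u n).re) :=
          mul_le_mul_of_nonneg_left (hu2 n) (mul_nonneg (hG' s hs) (by positivity))
      _ = _ := by ring
  have hbdd : ∀ n, G (u n) ∈ Metric.closedBall (0 : ℂ) (2 * (A * (G 1).re + 1) + 2 * ‖G 1‖ + 2) := by
    intro n
    have h := hpick 1 (by simp) n
    have h1 : ‖1 + conj (u n)‖ ≤ 2 := by
      refine (norm_add_le _ _).trans ?_
      rw [norm_one, RCLike.norm_conj]
      have : (1 : ℝ) / ((n : ℝ) + 1) ≤ 1 := by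
        rw [div_le_one (by positivity)]; linarith [(Nat.cast_nonneg n : (0 : ℝ) ≤ n)]
      linarith [hu1 n]
    have h2 : 0 ≤ A * (G 1).re := mul_nonneg hApos.le (hG' 1 (by simp))
    have h3 : ‖1 + conj (u n)‖ ^ 2 ≤ 4 := by nlinarith [norm_nonneg (1 + conj (u n))]
    have h4 : ‖G 1 + conj (G (u n))‖ ^ 2 ≤ A * (G 1).re * 4 := by
      simp only [Complex.one_re, mul_one] at h
      exact h.trans (by gcongr)
    have h5 : ‖G 1 + conj (G (u n))‖ ≤ A * (G 1).re + 1 + 1 := by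
      nlinarith [norm_nonneg (G 1 + conj (G (u n))), sq_nonneg (A * (G 1).re)]
    have h6 : ‖G (u n)‖ ≤ ‖G 1 + conj (G (u n))‖ + ‖G 1‖ := by
      have : conj (G (u n)) = (G 1 + conj (G (u n))) - G 1 := by ring
      calc ‖G (u n)‖ = ‖conj (G (u n))‖ := (RCLike.norm_conj _).symm
        _ = ‖(G 1 + conj (G (u n))) - G 1‖ := by rw [← this]
        _ ≤ _ := norm_sub_le _ _
    rw [mem_closedBall_zero_iff]
    linarith [norm_nonneg (G 1)]
  obtain ⟨v, -, k, hk, hv⟩ := tendsto_subseq_of_bounded Metric.isBounded_closedBall hbdd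
  have hku : Tendsto (u ∘ k) atTop (𝓝 0) := hu.comp hk.tendsto_atTop
  have hvre : v.re = 0 := by
    have h1 : Tendsto (fun n => (G (u (k n))).re) atTop (𝓝 v.re) :=
      (Complex.continuous_re.tendsto _).comp hv
    have h2 : Tendsto (fun n => (G (u (k n))).re) atTop (𝓝 0) := by
      have h3 : Tendsto (fun n => A * (u (k n)).re) atTop (𝓝 (A * (0 : ℂ).re)) :=
        ((Complex.continuous_re.tendsto _).comp hku).const_mul A
      rw [Complex.zero_re, mul_zero] at h3
      exact squeeze_zero (fun n => hG' _ (hu0 _)) (fun n => hu2 _) h3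
    exact tendsto_nhds_unique h1 h2
  have hvc : conj v = -v := by
    apply Complex.ext <;> simp [hvre]
  have hjulia : ∀ s : ℂ, 0 < s.re → ‖G s - v‖ ^ 2 * s.re ≤ A * (G s).re * ‖s‖ ^ 2 := by
    intro s hs
    have h1 : Tendsto (fun n => ‖G s + conj (G (u (k n)))‖ ^ 2 * s.re) atTop
        (𝓝 (‖G s + conj v‖ ^ 2 * s.re)) :=
      (((tendsto_const_nhds.add ((Complex.continuous_conj.tendsto _).comp hv)).norm.pow 2).mul_const _)
    have h2 : Tendsto (fun n => A * (G s).re * ‖s + conj (u (k n))‖ ^ 2) atTop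
        (𝓝 (A * (G s).re * ‖s + conj 0‖ ^ 2)) :=
      (((tendsto_const_nhds.add ((Complex.continuous_conj.tendsto _).comp hku)).norm.pow 2).const_mul _)
    have := le_of_tendsto_of_tendsto' h1 h2 (fun n => hpick s hs (k n))
    simpa [hvc, ← sub_eq_add_neg] using this
  have hne : ∀ s : ℂ, 0 < s.re → G s - v ≠ 0 := by
    intro s hs h
    have := congrArg Complex.re h
    simp only [Complex.sub_re, hvre, sub_zero, Complex.zero_re] at this
    linarith [hG s hs]
  have hinvre : ∀ s : ℂ, ((G s - v)⁻¹).re = (G s).re / ‖G s - v‖ ^ 2 := by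
    intro s
    rw [Complex.inv_re, Complex.normSq_eq_norm_sq, Complex.sub_re, hvre, sub_zero]
  -- Since `Re (c/s) = c Re s / |s|²`, the infimum of `B` is the largest `c` for which `1/(G - v) -
  -- c/s` keeps a nonnegative real part; Julia's inequality makes it at least `1/A`.
  set B : Set ℝ := (fun s : ℂ => ((G s - v)⁻¹).re * ‖s‖ ^ 2 / s.re) '' {s : ℂ | 0 < s.re} with hB
  have hBne : B.Nonempty := ⟨_, 1, by simp, rfl⟩
  have hlow : ∀ b ∈ B, 1 / A ≤ b := by
    rintro b ⟨s, hs, rfl⟩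
    have hs : 0 < s.re := hs
    have h1 := hjulia s hs
    have h2 : 0 < ‖G s - v‖ := norm_pos_iff.2 (hne s hs)
    simp only [hinvre]
    rw [div_le_div_iff₀ hApos hs, div_mul_eq_mul_div, div_mul_eq_mul_div, le_div_iff₀ (by positivity)]
    linarith
  set c := sInf B with hc
  have hcA : 1 / A ≤ c := le_csInf hBne hlow
  have hcpos : 0 < c := lt_of_lt_of_le (by positivity) hcA
  have hs0 : ∀ s : ℂ, 0 < s.re → s ≠ 0 := by
    rintro s hs rfl
    simp at hs
  set F : ℂ → ℂ := fun s => (G s - v)⁻¹ - c / s with hFdef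
  have hFre : ∀ s : ℂ, 0 < s.re → (F s).re = ((G s - v)⁻¹).re - c * s.re / ‖s‖ ^ 2 := by
    intro s hs
    simp only [hFdef]
    have h1 : ((c : ℂ) / s).re = c * s.re / ‖s‖ ^ 2 := by
      rw [div_eq_mul_inv, Complex.re_ofReal_mul, Complex.inv_re, Complex.normSq_eq_norm_sq,
        mul_div_assoc]
    rw [Complex.sub_re, h1]
  have hFd : DifferentiableOn ℂ F {s | 0 < s.re} :=
    ((hd.sub (differentiableOn_const _)).inv hne).sub
      ((differentiableOn_const _).div differentiableOn_id hs0)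
  have hF0 : ∀ s : ℂ, 0 < s.re → 0 ≤ (F s).re := by
    intro s hs
    have h1 : c ≤ ((G s - v)⁻¹).re * ‖s‖ ^ 2 / s.re := csInf_le ⟨1 / A, hlow⟩ ⟨s, hs, rfl⟩
    have h2 : 0 < ‖s‖ := norm_pos_iff.2 (hs0 s hs)
    rw [hFre s hs, sub_nonneg, div_le_iff₀ (by positivity)]
    rwa [le_div_iff₀ hs] at h1
  have hFsmall : ∀ ε : ℝ, 0 < ε → ∃ s : ℂ, 0 < s.re ∧ (F s).re * ‖s‖ ^ 2 < ε * s.re := by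
    intro ε hε
    obtain ⟨_, ⟨s, hs, rfl⟩, hlt⟩ := exists_lt_of_csInf_lt hBne (show sInf B < c + ε by linarith)
    have hs : 0 < s.re := hs
    have h2 : 0 < ‖s‖ := norm_pos_iff.2 (hs0 s hs)
    refine ⟨s, hs, ?_⟩
    rw [hFre s hs, sub_mul, div_mul_cancel₀ _ (by positivity)]
    simp only [div_lt_iff₀ hs] at hlt
    linarith
  refine ⟨v, 1 / c, hvre, by positivity, fun M => ?_⟩
  have h1 := tendsto_mul_zero_of_angular_mass_zero hFd hF0 hFsmall M
  have h2 : Tendsto (fun s => (s * F s + c)⁻¹) (𝓝[{s : ℂ | 0 < s.re ∧ ‖s‖ ≤ M * s.re}] 0)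
      (𝓝 ((0 + (c : ℂ))⁻¹)) :=
    (h1.add_const _).inv₀ (by simpa using hcpos.ne')
  have h3 : ((1 / c : ℝ) : ℂ) = (0 + (c : ℂ))⁻¹ := by push_cast; simp
  rw [h3]
  refine h2.congr' ?_
  filter_upwards [self_mem_nhdsWithin] with s hs
  have hsne := hs0 s hs.1
  have hGne := hne s hs.1
  have : s * F s + c = s / (G s - v) := by
    simp only [hFdef]
    field_simp
    ring
  rw [this, inv_div]

/-- The sector `|s - iα| ≤ M Re s` with vertex at the boundary point `iα`. -/
abbrev sector (α M : ℝ) : Set ℂ := {s : ℂ | 0 < s.re ∧ ‖s - α * Complex.I‖ ≤ M * s.re}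

/-- The angular difference quotient of `g` at `iα` is `δ`, with boundary value `v`. -/
def AngularQuotient (g : ℂ → ℂ) (α : ℝ) (v : ℂ) (δ : ℝ) : Prop :=
  ∀ M : ℝ, Tendsto (fun s => (g s - v) / (s - α * Complex.I)) (𝓝[sector α M] (α * Complex.I))
    (𝓝 (δ : ℂ))

theorem sub_ne_zero_of_re_pos {s : ℂ} (hs : 0 < s.re) (α : ℝ) : s - α * Complex.I ≠ 0 := by
  intro h
  have := congrArg Complex.re h
  simp at this
  linarith

theorem AngularQuotient.value {g : ℂ → ℂ} {α : ℝ} {v : ℂ} {δ : ℝ} (h : AngularQuotient g α v δ) :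
    NontangentialLimit g α v := by
  intro M
  have h1 : Tendsto (fun s : ℂ => s - α * Complex.I) (𝓝[sector α M] (α * Complex.I)) (𝓝 0) := by
    have : Tendsto (fun s : ℂ => s - α * Complex.I) (𝓝 (α * Complex.I)) (𝓝 (α * Complex.I - α * Complex.I)) :=
      Continuous.tendsto (by fun_prop) _
    rw [sub_self] at this
    exact this.mono_left nhdsWithin_le_nhds
  have h2 := ((h M).mul h1).add_const v
  rw [mul_zero, zero_add] at h2
  refine h2.congr' ?_
  filter_upwards [self_mem_nhdsWithin] with s hs
  rw [div_mul_cancel₀ _ (sub_ne_zero_of_re_pos hs.1 α)]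
  ring

/-- Cauchy's estimate for `g(z) - v - δ(z - iα)` on the disc of radius `Re s / 2` about `s`. -/
theorem AngularQuotient.deriv_limit {g : ℂ → ℂ} {α : ℝ} {v : ℂ} {δ : ℝ} (h : AngularQuotient g α v δ)
    (hd : DifferentiableOn ℂ g {s | 0 < s.re}) : NontangentialLimit (deriv g) α (δ : ℂ) := by
  intro M
  rw [Metric.tendsto_nhds]
  intro η hη
  rcases lt_or_ge M 0 with hM | hM
  · filter_upwards [self_mem_nhdsWithin] with s hs
    have := mul_neg_of_neg_of_pos hM hs.1
    linarith [norm_nonneg (s - α * Complex.I), hs.2]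
  have hopen : IsOpen {s : ℂ | 0 < s.re} := isOpen_lt continuous_const Complex.continuous_re
  -- That disc lies in the sector of aperture `2M + 1`. There the function is at most `ε(M + 1/2) Re
  -- s`, and dividing by the radius gives `ε(2M + 1) < η`.
  set ε := η / (2 * M + 2) with hε
  have hεpos : 0 < ε := by positivity
  have h1 := (Metric.tendsto_nhds.1 (h (2 * M + 1))) ε hεpos
  obtain ⟨r, hr, hball⟩ := Metric.mem_nhdsWithin_iff.1 h1
  have h2 : ∀ᶠ s in 𝓝[sector α M] (α * Complex.I), s ∈ Metric.ball (α * Complex.I) (r / 2) :=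
    mem_nhdsWithin_of_mem_nhds (Metric.ball_mem_nhds _ (by positivity))
  filter_upwards [h2, self_mem_nhdsWithin] with s hsr hs
  obtain ⟨hs0, hsM⟩ := hs
  rw [Metric.mem_ball, dist_eq_norm] at hsr
  set H : ℂ → ℂ := fun z => g z - v - δ * (z - α * Complex.I) with hH
  have hgs : DifferentiableAt ℂ g s := hd.differentiableAt (hopen.mem_nhds hs0)
  have hderivH : deriv H s = deriv g s - δ := by
    have h3 : HasDerivAt H (deriv g s - δ * 1) s := (hgs.hasDerivAt.sub_const v).sub
      (((hasDerivAt_id s).sub_const (α * Complex.I)).const_mul (δ : ℂ))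
    rw [h3.deriv, mul_one]
  have hsub : Metric.closedBall s (s.re / 2) ⊆ {z : ℂ | 0 < z.re} := by
    intro z hz
    rw [Metric.mem_closedBall, dist_eq_norm] at hz
    have := (abs_le.1 ((Complex.abs_re_le_norm (z - s)).trans hz)).1
    simp only [Complex.sub_re] at this
    simp only [Set.mem_ofPred_eq]
    linarith
  have hHd : DifferentiableOn ℂ H {s | 0 < s.re} :=
    (hd.sub (differentiableOn_const _)).sub
      ((differentiableOn_const _).mul (differentiableOn_id.sub (differentiableOn_const _)))
  have hbd := Complex.norm_deriv_le_of_forall_mem_sphere_norm_le (c := s) (R := s.re / 2)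
    (C := ε * ((M + 1 / 2) * s.re)) (f := H)
    (by positivity)
    (DifferentiableOn.diffContOnCl (by
      rw [closure_ball _ (by positivity)]
      exact hHd.mono hsub)) (by
      intro z hz
      have hz' : ‖z - s‖ = s.re / 2 := by simpa [dist_eq_norm] using hz
      have hzre0 := (abs_le.1 ((Complex.abs_re_le_norm (z - s)).trans hz'.le)).1
      simp only [Complex.sub_re] at hzre0
      have hzre : s.re / 2 ≤ z.re := by linarith
      have hz0 : 0 < z.re := by linarith
      have hzn : ‖z - α * Complex.I‖ ≤ ‖s - α * Complex.I‖ + s.re / 2 := by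
        calc _ = ‖(s - α * Complex.I) + (z - s)‖ := by congr 1; ring
          _ ≤ _ := (norm_add_le _ _).trans (by rw [hz'])
      have hsle : s.re ≤ ‖s - α * Complex.I‖ := by
        have := Complex.re_le_norm (s - α * Complex.I)
        simpa using this
      have hzsec : z ∈ sector α (2 * M + 1) := by
        refine ⟨hz0, hzn.trans ?_⟩
        nlinarith
      have hzball : z ∈ Metric.ball (α * Complex.I) r := by
        rw [Metric.mem_ball, dist_eq_norm]; linarith
      have hq := hball ⟨hzball, hzsec⟩
      simp only [Set.mem_ofPred_eq, dist_eq_norm] at hq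
      have hne := sub_ne_zero_of_re_pos hz0 α
      have hHz : H z = ((g z - v) / (z - α * Complex.I) - δ) * (z - α * Complex.I) := by
        rw [sub_mul, div_mul_cancel₀ _ hne]
      rw [hHz, norm_mul]
      exact mul_le_mul hq.le (hzn.trans (by linarith)) (norm_nonneg _) hεpos.le)
  rw [dist_eq_norm, ← hderivH]
  refine hbd.trans_lt ?_
  rw [div_lt_iff₀ (by positivity)]
  have : ε * (2 * M + 2) = η := by rw [hε]; field_simp
  rw [← this]
  nlinarith [mul_pos hεpos hs0]

/-- The Julia-Caratheodory theorem. -/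
theorem exists_angularQuotient {g : ℂ → ℂ} {θ α : ℝ} (hd : DifferentiableOn ℂ g {s | 0 < s.re})
    (hg : ∀ s : ℂ, 0 < s.re → θ < (g s).re) (h : HasFiniteAngularDerivative θ g α) :
    ∃ (v : ℂ) (δ : ℝ), v.re = θ ∧ 0 < δ ∧ AngularQuotient g α v δ := by
  obtain ⟨A, hA1, -⟩ := EReal.lt_iff_exists_real_btwn.1 h
  have hfreq := Filter.frequently_lt_of_liminf_lt (by isBoundedDefault) hA1
  set G : ℂ → ℂ := fun s => g (s + α * Complex.I) - θ with hG
  have hmaps : Set.MapsTo (fun s : ℂ => s + α * Complex.I) {s | 0 < s.re} {s | 0 < s.re} := by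
    intro s hs
    simpa using hs
  obtain ⟨v, δ, hv, hδ, hlim⟩ := exists_angular_quotient_limit_zero (G := G) (A := A)
    ((hd.comp (differentiableOn_id.add (differentiableOn_const _)) hmaps).sub
      (differentiableOn_const _))
    (fun s hs => by
      have := hg _ (hmaps hs)
      simp only [hG, Complex.sub_re, Complex.ofReal_re]
      linarith)
    (fun ε hε => by
      have hb : ∀ᶠ s in 𝓝[{s : ℂ | 0 < s.re}] (α * Complex.I),
          s ∈ Metric.ball (α * Complex.I) ε :=
        mem_nhdsWithin_of_mem_nhds (Metric.ball_mem_nhds _ hε)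
      obtain ⟨s, hs1, hs2, hs3⟩ := (hfreq.and_eventually (hb.and self_mem_nhdsWithin)).exists
      have hs3 : 0 < s.re := hs3
      refine ⟨s - α * Complex.I, by simpa using hs3, by simpa [dist_eq_norm] using hs2, ?_⟩
      have h4 : ((g s).re - θ) / s.re < A := by exact_mod_cast hs1
      rw [div_lt_iff₀ hs3] at h4
      simpa [hG] using h4.le)
  refine ⟨v + θ, δ, by simp [hv], hδ, fun M => ?_⟩
  have hshift : Tendsto (fun s : ℂ => s - α * Complex.I) (𝓝[sector α M] (α * Complex.I))
      (𝓝[{s : ℂ | 0 < s.re ∧ ‖s‖ ≤ M * s.re}] 0) := by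
    refine tendsto_nhdsWithin_iff.2 ⟨?_, ?_⟩
    · have : Tendsto (fun s : ℂ => s - α * Complex.I) (𝓝 (α * Complex.I))
          (𝓝 (α * Complex.I - α * Complex.I)) := Continuous.tendsto (by fun_prop) _
      rw [sub_self] at this
      exact this.mono_left nhdsWithin_le_nhds
    · filter_upwards [self_mem_nhdsWithin] with s hs
      exact ⟨by simpa using hs.1, by simpa using hs.2⟩
  refine ((hlim M).comp hshift).congr fun s => ?_
  simp only [Function.comp, hG, sub_add_cancel]
  congr 1
  ring

theorem AngularQuotient.hasAngularData {g : ℂ → ℂ} {θ α : ℝ} {v : ℂ} {δ : ℝ}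
    (h : AngularQuotient g α v δ) (hd : DifferentiableOn ℂ g {s | 0 < s.re})
    (hf : HasFiniteAngularDerivative θ g α) : HasAngularData θ g α v δ :=
  ⟨hf, h.value, h.deriv_limit hd⟩

/-! ### Dirichlet kernels with a pole. -/

/-- The Dirichlet series `∑ m^{-w}` over the integers `m` in `S`. -/
def kernelSum (S : Set ℕ) (w : ℂ) : ℂ := ∑' m : S, ((m : ℕ) : ℂ) ^ (-w)

/-- `∑_{m ∈ S} m^{-w}` converges absolutely for `Re w > x₀` and behaves like `R (w - x₀)^{-d}` at
`x₀`. -/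
structure PoleKernel (S : Set ℕ) (x₀ : ℝ) (d : ℕ) (R : ℝ) : Prop where
  ne_zero : ∀ m ∈ S, m ≠ 0
  one_le : 1 ≤ d
  pos : 0 < R
  summable : ∀ x : ℝ, x₀ < x → Summable (fun m : S => ((m : ℕ) : ℝ) ^ (-x))
  pole : Tendsto (fun w : ℂ => (w - x₀) ^ d * kernelSum S w) (𝓝[{w | x₀ < w.re}] (x₀ : ℂ))
    (𝓝 (R : ℂ))

theorem norm_natCast_cpow_neg {m : ℕ} (hm : m ≠ 0) (w : ℂ) :
    ‖(m : ℂ) ^ (-w)‖ = (m : ℝ) ^ (-w.re) := by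
  rw [Complex.norm_natCast_cpow_of_pos (Nat.pos_of_ne_zero hm), Complex.neg_re]

theorem kernelSum_ofReal (S : Set ℕ) (x : ℝ) :
    kernelSum S x = ((∑' m : S, ((m : ℕ) : ℝ) ^ (-x) : ℝ) : ℂ) := by
  rw [kernelSum, Complex.ofReal_tsum]
  refine tsum_congr fun m => ?_
  rw [← Complex.ofReal_neg, Complex.ofReal_cpow (Nat.cast_nonneg _), Complex.ofReal_natCast]

namespace PoleKernel

variable {S : Set ℕ} {x₀ : ℝ} {d : ℕ} {R : ℝ}

theorem summable_norm (h : PoleKernel S x₀ d R) {w : ℂ} (hw : x₀ < w.re) :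
    Summable (fun m : S => ‖((m : ℕ) : ℂ) ^ (-w)‖) :=
  (h.summable _ hw).congr fun m => (norm_natCast_cpow_neg (h.ne_zero m m.2) w).symm

theorem norm_le (h : PoleKernel S x₀ d R) {w : ℂ} {x : ℝ} (hx : x₀ < x) (hw : x ≤ w.re) :
    ‖kernelSum S w‖ ≤ ‖kernelSum S x‖ := by
  have hnn : 0 ≤ ∑' m : S, ((m : ℕ) : ℝ) ^ (-x) := tsum_nonneg fun m => by positivity
  rw [kernelSum_ofReal, Complex.norm_real, Real.norm_of_nonneg hnn]
  refine (norm_tsum_le_tsum_norm (h.summable_norm (hx.trans_le hw))).trans ?_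
  refine (h.summable_norm (hx.trans_le hw)).tsum_le_tsum (fun m => ?_) (h.summable x hx)
  rw [norm_natCast_cpow_neg (h.ne_zero m m.2)]
  exact Real.rpow_le_rpow_of_exponent_le
    (by exact_mod_cast Nat.one_le_iff_ne_zero.2 (h.ne_zero m m.2)) (by linarith)

/-- Along `w(σ) = w₀ + Dσ + o(σ)` the factor `(w - w₀)^d` is asymptotic to `(Dσ)^d`. The point `w₀`
need not be the pole `x₀`, and `L = 0` is allowed. -/
theorem tendsto_of_path {w₀ L D : ℂ} {w : ℝ → ℂ}
    (hL : Tendsto (fun w : ℂ => (w - w₀) ^ d * kernelSum S w) (𝓝[{w | x₀ < w.re}] w₀) (𝓝 L))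
    (hw : ∀ᶠ σ in 𝓝[>] (0 : ℝ), x₀ < (w σ).re) (hD : D ≠ 0)
    (hlim : Tendsto (fun σ : ℝ => (w σ - w₀) / σ) (𝓝[>] 0) (𝓝 D)) :
    Tendsto (fun σ : ℝ => kernelSum S (w σ) * (σ : ℂ) ^ d) (𝓝[>] 0) (𝓝 (L / D ^ d)) := by
  have hσ : Tendsto (fun σ : ℝ => (σ : ℂ)) (𝓝[>] 0) (𝓝 0) := by
    have : Tendsto (fun σ : ℝ => (σ : ℂ)) (𝓝 0) (𝓝 ((0 : ℝ) : ℂ)) :=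
      Complex.continuous_ofReal.tendsto 0
    rw [Complex.ofReal_zero] at this
    exact this.mono_left nhdsWithin_le_nhds
  have hw0 : Tendsto w (𝓝[>] 0) (𝓝 w₀) := by
    have h1 := (hlim.mul hσ).add_const w₀
    rw [mul_zero, zero_add] at h1
    refine h1.congr' ?_
    filter_upwards [self_mem_nhdsWithin] with σ hσ
    have : (σ : ℂ) ≠ 0 := by exact_mod_cast (ne_of_gt hσ)
    field_simp
    ring
  have h1 := hL.comp (tendsto_nhdsWithin_iff.2 ⟨hw0, hw⟩)
  have h2 := h1.div (hlim.pow d) (pow_ne_zero d hD)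
  have hDne : ∀ᶠ σ in 𝓝[>] (0 : ℝ), (w σ - w₀) / σ ≠ 0 := hlim.eventually_ne hD
  refine h2.congr' ?_
  filter_upwards [self_mem_nhdsWithin, hDne] with σ hσ hne
  have h3 : (σ : ℂ) ≠ 0 := by exact_mod_cast (ne_of_gt hσ)
  have h4 : w σ - w₀ ≠ 0 := fun h => hne (by rw [h, zero_div])
  simp only [Function.comp, Pi.div_apply]
  rw [div_pow]
  field_simp

theorem tendsto_real_path (h : PoleKernel S x₀ d R) {t : ℝ → ℝ} {D : ℝ} (hD : 0 < D)
    (hlim : Tendsto (fun σ : ℝ => (t σ - x₀) / σ) (𝓝[>] 0) (𝓝 D)) :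
    Tendsto (fun σ : ℝ => kernelSum S (t σ) * (σ : ℂ) ^ d) (𝓝[>] 0)
      (𝓝 ((R / D ^ d : ℝ) : ℂ)) := by
  have h1 := tendsto_of_path (w := fun σ => (t σ : ℂ)) (D := (D : ℂ)) h.pole (by
      filter_upwards [hlim.eventually_const_lt hD, self_mem_nhdsWithin] with σ h1 h2
      have h2 : 0 < σ := h2
      rw [lt_div_iff₀ h2, zero_mul] at h1
      simpa using h1) (by exact_mod_cast hD.ne') (by
      have := (Complex.continuous_ofReal.tendsto D).comp hlim
      refine this.congr fun σ => ?_
      simp)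
  simpa using h1

theorem tendsto_zero (h : PoleKernel S x₀ d R) {w : ℝ → ℂ}
    (hw : ∀ B : ℝ, ∀ᶠ σ in 𝓝[>] (0 : ℝ), B * σ ≤ (w σ).re - x₀) :
    Tendsto (fun σ : ℝ => kernelSum S (w σ) * (σ : ℂ) ^ d) (𝓝[>] 0) (𝓝 0) := by
  rw [Metric.tendsto_nhds]
  intro ε hε
  have hR := h.pos
  -- The kernel has positive coefficients, so `|K_S(w)| ≤ K_S(x₀ + Bσ)`. Multiplied by `σ^d` the
  -- right side tends to `R/B^d ≤ R/B < ε`.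
  set B := R / ε + 1 with hB
  have hB1 : 1 ≤ B := by rw [hB]; linarith [div_pos hR hε]
  have hBpos : 0 < B := by linarith
  have h1 := (h.tendsto_real_path (t := fun σ => x₀ + B * σ) hBpos (by
    refine (tendsto_const_nhds (x := B)).congr' ?_
    filter_upwards [self_mem_nhdsWithin] with σ hσ
    have : σ ≠ 0 := ne_of_gt hσ
    field_simp
    ring)).norm
  have hlt : ‖((R / B ^ d : ℝ) : ℂ)‖ < ε := by
    rw [Complex.norm_real, Real.norm_of_nonneg (by positivity), div_lt_iff₀ (by positivity)]
    have h2 : B ≤ B ^ d := le_self_pow₀ hB1 (by have := h.one_le; omega)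
    have h3 : ε * B = R + ε := by rw [hB]; field_simp
    nlinarith
  filter_upwards [h1.eventually_lt_const hlt, hw B, self_mem_nhdsWithin] with σ h2 h3 h4
  have h4 : 0 < σ := h4
  rw [dist_zero_right]
  refine lt_of_le_of_lt ?_ h2
  rw [norm_mul, norm_mul]
  refine mul_le_mul_of_nonneg_right (h.norm_le ?_ (by linarith)) (norm_nonneg _)
  nlinarith

end PoleKernel

theorem summable_factoredNumbers_rpow (Q : Finset ℕ) {x : ℝ} (hx : 0 < x) :
    Summable (fun m : Nat.factoredNumbers Q => ((m : ℕ) : ℝ) ^ (-x)) := by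
  have hr : (x : ℂ) ≠ 0 := by exact_mod_cast hx.ne'
  have hsum := (EulerProduct.summable_and_hasSum_factoredNumbers_prod_filter_prime_geometric
    (f := (riemannZetaSummandHom hr : ℕ →* ℂ)) (fun {p} hp => by
      change ‖(p : ℂ) ^ (-(x : ℂ))‖ < 1
      rw [norm_natCast_cpow_neg hp.ne_zero, Complex.ofReal_re]
      exact Real.rpow_lt_one_of_one_lt_of_neg (by exact_mod_cast hp.one_lt) (by linarith)) Q).1
  refine hsum.congr fun m => ?_
  change ‖((m : ℕ) : ℂ) ^ (-(x : ℂ))‖ = _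
  rw [norm_natCast_cpow_neg m.2.1, Complex.ofReal_re]

theorem kernelSum_factoredNumbers {Q : Finset ℕ} (hQ : ∀ p ∈ Q, p.Prime) {w : ℂ} (hw : 0 < w.re) :
    kernelSum (Nat.factoredNumbers Q) w = ∏ p ∈ Q, (1 - (p : ℂ) ^ (-w))⁻¹ := by
  have hr : w ≠ 0 := by rintro rfl; simp at hw
  have h := (EulerProduct.summable_and_hasSum_factoredNumbers_prod_filter_prime_geometric
    (f := (riemannZetaSummandHom hr : ℕ →* ℂ)) (fun {p} hp => by
      change ‖(p : ℂ) ^ (-w)‖ < 1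
      rw [norm_natCast_cpow_neg hp.ne_zero]
      exact Real.rpow_lt_one_of_one_lt_of_neg (by exact_mod_cast hp.one_lt) (by linarith)) Q).2
  rw [Finset.filter_true_of_mem hQ] at h
  exact h.tsum_eq

/-- The zeros of `1 - p^{-w}` are simple, with derivative `log p`, and recur with period `2πi / log
p`; hence the case distinction. -/
theorem tendsto_sub_mul_inv_one_sub_cpow {p : ℕ} (hp : p.Prime) {w₀ : ℂ} (hw₀ : w₀.re = 0) :
    Tendsto (fun w : ℂ => (w - w₀) * (1 - (p : ℂ) ^ (-w))⁻¹) (𝓝[{w | 0 < w.re}] w₀)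
      (𝓝 (if (p : ℂ) ^ (-w₀) = 1 then ((1 / Real.log p : ℝ) : ℂ) else 0)) := by
  have hp0 : (p : ℂ) ≠ 0 := by exact_mod_cast hp.ne_zero
  have hlog : 0 < Real.log p := Real.log_pos (by exact_mod_cast hp.one_lt)
  have hder : HasDerivAt (fun w : ℂ => 1 - (p : ℂ) ^ (-w)) (Complex.log p * (p : ℂ) ^ (-w₀)) w₀ := by
    have h1 : HasDerivAt (fun w : ℂ => 1 - (p : ℂ) ^ (-w))
        (-((p : ℂ) ^ (-w₀) * Complex.log p * -1)) w₀ :=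
      ((hasDerivAt_id w₀).neg.const_cpow (c := (p : ℂ)) (Or.inl hp0)).const_sub 1
    rwa [show -((p : ℂ) ^ (-w₀) * Complex.log p * -1) = Complex.log p * (p : ℂ) ^ (-w₀) by ring]
      at h1
  have hsub : {w : ℂ | 0 < w.re} ⊆ {w₀}ᶜ := by
    rintro w hw rfl
    have hw : 0 < w.re := hw
    linarith
  split_ifs with h
  · have h1 := (hasDerivAt_iff_tendsto_slope.1 hder).mono_left (nhdsWithin_mono w₀ hsub)
    have h2 : Complex.log p * (p : ℂ) ^ (-w₀) = (Real.log p : ℂ) := by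
      rw [h, mul_one, Complex.natCast_log]
    rw [h2] at h1
    have h3 := h1.inv₀ (by exact_mod_cast hlog.ne')
    have h4 : ((1 / Real.log p : ℝ) : ℂ) = (Real.log p : ℂ)⁻¹ := by push_cast; simp
    rw [h4]
    refine h3.congr fun w => ?_
    rw [slope_def_field, h]
    simp [div_eq_mul_inv, mul_comm]
  · have h1 : Tendsto (fun w : ℂ => (w - w₀) * (1 - (p : ℂ) ^ (-w))⁻¹) (𝓝 w₀)
        (𝓝 ((w₀ - w₀) * (1 - (p : ℂ) ^ (-w₀))⁻¹)) :=
      ((continuous_id.sub continuous_const).tendsto w₀).mul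
        (hder.continuousAt.tendsto.inv₀ (sub_ne_zero.2 (Ne.symm h)))
    rw [sub_self, zero_mul] at h1
    exact h1.mono_left nhdsWithin_le_nhds

-- In the Euler product each prime contributes at most a simple pole, so the full order `|Q|` occurs
-- only where all factors are singular. These common periods are the boundary values that the kernel
-- over `Q` cannot tell apart.
open Classical in
theorem tendsto_pow_mul_kernelSum_factoredNumbers {Q : Finset ℕ} (hQ : ∀ p ∈ Q, p.Prime) {w₀ : ℂ}
    (hw₀ : w₀.re = 0) :
    Tendsto (fun w : ℂ => (w - w₀) ^ Q.card * kernelSum (Nat.factoredNumbers Q) w)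
      (𝓝[{w | 0 < w.re}] w₀)
      (𝓝 (((∏ p ∈ Q, 1 / Real.log p : ℝ) : ℂ) *
        if ∀ p ∈ Q, (p : ℂ) ^ (-w₀) = 1 then 1 else 0)) := by
  have h1 := tendsto_finsetProd Q (fun p hp => tendsto_sub_mul_inv_one_sub_cpow (hQ p hp) hw₀)
  have h2 : (∏ p ∈ Q, if (p : ℂ) ^ (-w₀) = 1 then ((1 / Real.log p : ℝ) : ℂ) else 0) =
      ((∏ p ∈ Q, 1 / Real.log p : ℝ) : ℂ) * if ∀ p ∈ Q, (p : ℂ) ^ (-w₀) = 1 then 1 else 0 := by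
    split_ifs with h
    · rw [mul_one, Complex.ofReal_prod]
      exact Finset.prod_congr rfl fun p hp => if_pos (h p hp)
    · push Not at h
      obtain ⟨p, hp, hne⟩ := h
      rw [mul_zero]
      exact Finset.prod_eq_zero hp (if_neg hne)
  rw [← h2]
  refine h1.congr' ?_
  filter_upwards [self_mem_nhdsWithin] with w hw
  rw [kernelSum_factoredNumbers hQ hw, Finset.prod_mul_distrib, Finset.prod_const]

theorem poleKernel_factoredNumbers {Q : Finset ℕ} (hQ : ∀ p ∈ Q, p.Prime) (hne : Q.Nonempty) :
    PoleKernel (Nat.factoredNumbers Q) 0 Q.card (∏ p ∈ Q, 1 / Real.log p) where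
  ne_zero m hm := hm.1
  one_le := hne.card_pos
  pos := Finset.prod_pos fun p hp =>
    one_div_pos.2 (Real.log_pos (by exact_mod_cast (hQ p hp).one_lt))
  summable x hx := summable_factoredNumbers_rpow Q hx
  pole := by
    have := tendsto_pow_mul_kernelSum_factoredNumbers hQ (w₀ := 0) (by simp)
    simpa using this

theorem kernelSum_ne_zero {w : ℂ} (hw : 1 < w.re) : kernelSum {m | m ≠ 0} w = riemannZeta w := by
  rw [zeta_eq_tsum_one_div_nat_cpow hw, kernelSum]
  have h := Function.Injective.tsum_eq (f := fun n : ℕ => 1 / (n : ℂ) ^ w)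
    (g := (Subtype.val : {m : ℕ | m ≠ 0} → ℕ)) Subtype.val_injective (by
      intro n hn
      refine ⟨⟨n, ?_⟩, rfl⟩
      rintro rfl
      have hw0 : w ≠ 0 := by rintro rfl; norm_num at hw
      simp [hw0] at hn)
  rw [← h]
  refine tsum_congr fun m => ?_
  rw [Complex.cpow_neg, one_div]

/-- The zeta function has no pole except `1`, so the common periods met for finite `Q` have no
counterpart here. -/
theorem tendsto_sub_mul_kernelSum_ne_zero {w₀ : ℂ} :
    Tendsto (fun w : ℂ => (w - w₀) * kernelSum {m | m ≠ 0} w) (𝓝[{w | 1 < w.re}] w₀)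
      (𝓝 (if w₀ = 1 then 1 else 0)) := by
  have hcongr : ∀ᶠ w in 𝓝[{w : ℂ | 1 < w.re}] w₀,
      (w - w₀) * riemannZeta w = (w - w₀) * kernelSum {m | m ≠ 0} w := by
    filter_upwards [self_mem_nhdsWithin] with w hw
    rw [kernelSum_ne_zero hw]
  refine Tendsto.congr' hcongr ?_
  split_ifs with h
  · subst h
    refine riemannZeta_residue_one.mono_left (nhdsWithin_mono _ ?_)
    rintro w hw rfl
    simp at hw
  · have h1 : Tendsto (fun w => (w - w₀) * riemannZeta w) (𝓝 w₀)
        (𝓝 ((w₀ - w₀) * riemannZeta w₀)) :=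
      ((continuous_id.sub continuous_const).tendsto w₀).mul
        (differentiableAt_riemannZeta h).continuousAt
    rw [sub_self, zero_mul] at h1
    exact h1.mono_left nhdsWithin_le_nhds

theorem poleKernel_ne_zero : PoleKernel {m | m ≠ 0} 1 1 1 where
  ne_zero m hm := hm
  one_le := le_rfl
  pos := one_pos
  summable x hx := (Real.summable_nat_rpow.2 (by linarith)).subtype _
  pole := by
    have := tendsto_sub_mul_kernelSum_ne_zero (w₀ := 1)
    simpa using this

/-! ### The coefficients of `l^{-φ}`. -/

/-- The coefficients of an element of the Hardy space, extended by zero to `ℕ`. -/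
def Hardy.coeff (g : Hardy) (k : ℕ) : ℂ := if h : 0 < k then g ⟨k, h⟩ else 0

/-- The function `l^{-s}` as an element of the Hardy space. -/
def monomial (l : ℕ+) : Hardy := lp.single 2 l (1 : ℂ)

theorem Hardy.coeff_coe (g : Hardy) (k : ℕ+) : g.coeff k = g k := by
  rw [Hardy.coeff, dif_pos k.pos]
  rfl

theorem Hardy.norm_coeff_le (g : Hardy) (k : ℕ) : ‖g.coeff k‖ ≤ ‖g‖ := by
  rw [Hardy.coeff]
  split_ifs with h
  · exact lp.norm_apply_le_norm (by norm_num) g _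
  · simp

theorem Hardy.LSeries_coeff (g : Hardy) (s : ℂ) : LSeries g.coeff s = g.eval s := by
  rw [LSeries, Hardy.eval]
  have h := Function.Injective.tsum_eq (f := term g.coeff s)
    (g := (fun n : ℕ+ => (n : ℕ))) PNat.coe_injective (by
      intro n hn
      refine ⟨⟨n, Nat.pos_of_ne_zero ?_⟩, rfl⟩
      rintro rfl
      simp at hn)
  rw [← h]
  refine tsum_congr fun n => ?_
  rw [term_of_ne_zero n.ne_zero, Hardy.coeff_coe, Complex.cpow_neg, div_eq_mul_inv]

theorem monomial_eval (l : ℕ+) (s : ℂ) : (monomial l).eval s = ((l : ℕ) : ℂ) ^ (-s) := by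
  rw [Hardy.eval, tsum_eq_single l]
  · simp [monomial]
  · intro n hn
    simp [monomial, hn]

theorem Hardy.abscissa_coeff_le (g : Hardy) : abscissaOfAbsConv g.coeff ≤ 1 :=
  abscissaOfAbsConv_le_of_le_const ⟨‖g‖, fun n _ => g.norm_coeff_le n⟩

/-- Consecutive partial sums at the point `η` differ by `c_n n^{-η}`, which the Cauchy condition
bounds by `1` for large `n`; the finitely many other coefficients go into `C`. -/
theorem Symbol.norm_coeff_le (φ : Symbol) {η : ℝ} (hη : 0 < η) :
    ∃ C : ℝ, 0 < C ∧ ∀ n : ℕ, n ≠ 0 → ‖φ.coeff n‖ ≤ C * (n : ℝ) ^ η := by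
  have hu := (φ.uniform (η / 2) (by linarith)).uniformCauchySeqOn
  rw [Metric.uniformCauchySeqOn_iff] at hu
  obtain ⟨N, hN⟩ := hu 1 one_pos
  have hx : (η : ℂ) ∈ {s' : ℂ | η / 2 < s'.re} := by
    simp only [Set.mem_ofPred_eq, Complex.ofReal_re]; linarith
  have hlarge : ∀ n : ℕ, N < n → ‖φ.coeff n‖ ≤ (n : ℝ) ^ η := by
    intro n hn
    obtain ⟨m, rfl⟩ : ∃ m, n = m + 1 := ⟨n - 1, by omega⟩
    have h := hN (m + 1) hn.le m (by omega) _ hx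
    rw [dist_eq_norm, partialSum, partialSum, Finset.sum_Icc_succ_top (by omega),
      add_sub_cancel_left, norm_mul, norm_natCast_cpow_neg (by omega), Complex.ofReal_re,
      Real.rpow_neg (by positivity), ← div_eq_mul_inv, div_lt_one (by positivity)] at h
    exact h.le
  refine ⟨1 + ∑ k ∈ Finset.range (N + 1), ‖φ.coeff k‖, by positivity, fun n hn => ?_⟩
  have h1 : (1 : ℝ) ≤ (n : ℝ) ^ η :=
    Real.one_le_rpow (by exact_mod_cast Nat.one_le_iff_ne_zero.2 hn) hη.le
  have hS : 0 ≤ ∑ k ∈ Finset.range (N + 1), ‖φ.coeff k‖ := by positivity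
  rcases lt_or_ge N n with h | h
  · have := hlarge n h
    nlinarith
  · have : ‖φ.coeff n‖ ≤ ∑ k ∈ Finset.range (N + 1), ‖φ.coeff k‖ :=
      Finset.single_le_sum (f := fun k => ‖φ.coeff k‖) (fun k _ => norm_nonneg _)
        (Finset.mem_range.2 (by omega))
    nlinarith

theorem Symbol.LSeriesSummable_coeff (φ : Symbol) {s : ℂ} (hs : 1 < s.re) :
    LSeriesSummable φ.coeff s := by
  obtain ⟨C, -, hC⟩ := φ.norm_coeff_le (η := (s.re - 1) / 2) (by linarith)
  refine LSeriesSummable_of_le_const_mul_rpow (x := (s.re - 1) / 2 + 1) (by linarith) ⟨C, fun n hn => ?_⟩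
  simpa using hC n hn

theorem Symbol.abscissa_coeff_le (φ : Symbol) : abscissaOfAbsConv φ.coeff ≤ ((3 / 2 : ℝ) : EReal) := by
  have := (φ.LSeriesSummable_coeff (s := ((3 / 2 : ℝ) : ℂ)) (by rw [Complex.ofReal_re]; norm_num)).abscissaOfAbsConv_le
  simpa using this

theorem Symbol.dirichletSum_eq_LSeries (φ : Symbol) {s : ℂ} (hs : 1 < s.re) :
    dirichletSum φ.coeff s = LSeries φ.coeff s := by
  have h := (φ.LSeriesSummable_coeff hs).hasSum.tendsto_sum_nat
  have h2 := h.comp (tendsto_add_atTop_nat 1)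
  refine Tendsto.limUnder_eq (h2.congr fun N => ?_)
  simp only [Function.comp]
  rw [Finset.sum_range_succ', term_zero, add_zero, partialSum]
  induction N with
  | zero => simp
  | succ k ih =>
    rw [Finset.sum_range_succ, ih, Finset.sum_Icc_succ_top (by omega),
      term_of_ne_zero (by omega), Complex.cpow_neg, div_eq_mul_inv]

theorem IsCompositionOperator.LSeries_coeff {φ : Symbol} {T : Hardy →L[ℂ] Hardy}
    (hT : IsCompositionOperator φ T) (l : ℕ+) {s : ℂ} (hs : 1 < s.re) :
    LSeries (T (monomial l)).coeff s =
      Complex.exp (-(Complex.log l * (φ.char * s + LSeries φ.coeff s))) := by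
  rw [Hardy.LSeries_coeff, hT _ s (by linarith), monomial_eval, Symbol.toFun,
    φ.dirichletSum_eq_LSeries hs, Complex.cpow_def_of_ne_zero (by exact_mod_cast l.ne_zero)]
  congr 1
  ring

/-- The differential equation `F' = -log l · φ' F` for `F = l^{-φ}`, in terms of coefficients. -/
theorem IsCompositionOperator.coeff_recursion {φ : Symbol} {T : Hardy →L[ℂ] Hardy}
    (hT : IsCompositionOperator φ T) (l : ℕ+) {k : ℕ} (hk : k ≠ 0) :
    (Complex.log k - φ.char * Complex.log l) * (T (monomial l)).coeff k =
      -(Complex.log l * ∑ x ∈ k.divisorsAntidiagonal,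
        (Complex.log x.1 * φ.coeff x.1) * (T (monomial l)).coeff x.2) := by
  set g := (T (monomial l)).coeff with hg
  set c := φ.coeff with hc
  have hga : abscissaOfAbsConv g ≤ 1 := Hardy.abscissa_coeff_le _
  have hca : abscissaOfAbsConv c ≤ ((3 / 2 : ℝ) : EReal) := φ.abscissa_coeff_le
  have hglt : ∀ {x : ℝ}, 2 ≤ x → abscissaOfAbsConv g < x := fun {x} hx =>
    hga.trans_lt (by exact_mod_cast (by linarith : (1 : ℝ) < x))
  have hclt : ∀ {x : ℝ}, 2 ≤ x → abscissaOfAbsConv c < x := fun {x} hx =>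
    hca.trans_lt (by exact_mod_cast (by linarith : (3 / 2 : ℝ) < x))
  -- Differentiation of a Dirichlet series is `-logMul` on coefficients and a product is a
  -- convolution. The differential equation thus says that the series of `F` vanishes, and
  -- uniqueness of coefficients gives `F = 0`.
  set F : ℕ → ℂ := logMul g - (φ.char * Complex.log l) • g + Complex.log l • LSeries.convolution (logMul c) g with hF
  have hsum : ∀ {s : ℂ}, 2 ≤ s.re → LSeriesSummable F s ∧
      LSeries F s = LSeries (logMul g) s - φ.char * Complex.log l * LSeries g s +
        Complex.log l * (LSeries (logMul c) s * LSeries g s) := by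
    intro s hs
    have h1 := LSeriesSummable_logMul_of_lt_re (hglt hs)
    have h2 := LSeriesSummable_of_abscissaOfAbsConv_lt_re (hglt hs)
    have h3 := LSeriesSummable_logMul_of_lt_re (hclt hs)
    have h4 := h3.convolution h2
    refine ⟨(h1.sub (h2.smul _)).add (h4.smul _), ?_⟩
    rw [hF, LSeries_add (h1.sub (h2.smul _)) (h4.smul _), LSeries_sub h1 (h2.smul _), LSeries_smul,
      LSeries_smul, LSeries_convolution' h3 h2]
  have hzero : ∀ {s : ℂ}, 2 ≤ s.re → LSeries F s = 0 := by
    intro s hs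
    rw [(hsum hs).2]
    have hd1 : HasDerivAt (LSeries g) (-LSeries (logMul g) s) s := LSeries_hasDerivAt (hglt hs)
    have hd2 : HasDerivAt (LSeries c) (-LSeries (logMul c) s) s := LSeries_hasDerivAt (hclt hs)
    have hd3 : HasDerivAt (fun z => Complex.exp (-(Complex.log l * (φ.char * z + LSeries c z))))
        (Complex.exp (-(Complex.log l * (φ.char * s + LSeries c s))) *
          -(Complex.log l * (φ.char * 1 + -LSeries (logMul c) s))) s :=
      ((((hasDerivAt_id s).const_mul (φ.char : ℂ)).add hd2).const_mul (Complex.log l)).neg.cexp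
    have hev : (fun z => Complex.exp (-(Complex.log l * (φ.char * z + LSeries c z)))) =ᶠ[𝓝 s]
        LSeries g := by
      have hopen : IsOpen {z : ℂ | 1 < z.re} := isOpen_lt continuous_const Complex.continuous_re
      filter_upwards [hopen.mem_nhds (show 1 < s.re by linarith)] with z hz
      exact (hT.LSeries_coeff l hz).symm
    have h5 := (hd3.congr_of_eventuallyEq hev.symm).unique hd1
    rw [← hT.LSeries_coeff l (show 1 < s.re by linarith)] at h5
    linear_combination h5
  have hFtop : abscissaOfAbsConv F ≠ ⊤ := by
    have := ((hsum (s := ((2 : ℝ) : ℂ)) (by simp)).1).abscissaOfAbsConv_le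
    exact (this.trans_lt (EReal.coe_lt_top _)).ne
  have hFk := (LSeries_eventually_eq_zero_iff'.1 (by
    filter_upwards [eventually_ge_atTop (2 : ℝ)] with x hx
    exact hzero (by simpa using hx))).resolve_right hFtop k hk
  simp only [hF, Pi.add_apply, Pi.sub_apply, Pi.smul_apply, smul_eq_mul, convolution_def, logMul] at hFk
  linear_combination hFk

/-- The coefficients of `l^{-φ}` are supported on the multiples of `l^{c₀}`. -/
theorem IsCompositionOperator.pow_dvd_of_coeff_ne_zero {φ : Symbol} {T : Hardy →L[ℂ] Hardy}
    (hT : IsCompositionOperator φ T) (l : ℕ+) {k : ℕ} (hk : (T (monomial l)).coeff k ≠ 0) :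
    (l : ℕ) ^ φ.char ∣ k := by
  induction k using Nat.strong_induction_on with
  | _ k ih =>
    have hk0 : k ≠ 0 := by
      rintro rfl
      simp [Hardy.coeff] at hk
    by_cases hkl : k = (l : ℕ) ^ φ.char
    · exact hkl ▸ dvd_rfl
    -- The left factor of the recursion vanishes only at `k = l^{c₀}`. For any other `k` a nonzero
    -- coefficient forces one at a proper divisor of `k`.
    have hlog : Complex.log k - φ.char * Complex.log l ≠ 0 := by
      intro h
      apply hkl
      have h1 : Real.log k = φ.char * Real.log l := by
        have h2 : Complex.log k = φ.char * Complex.log (l : ℕ) := sub_eq_zero.1 h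
        rw [← Complex.natCast_log, ← Complex.natCast_log] at h2
        exact_mod_cast h2
      rw [← Real.log_pow] at h1
      have h3 := Real.log_injOn_pos (by exact_mod_cast Nat.pos_of_ne_zero hk0 : (0 : ℝ) < k)
        (by exact_mod_cast pow_pos l.pos _ : (0 : ℝ) < (l : ℕ) ^ φ.char) h1
      exact_mod_cast h3
    have hrec := hT.coeff_recursion l hk0
    have hne : ∑ x ∈ k.divisorsAntidiagonal,
        (Complex.log x.1 * φ.coeff x.1) * (T (monomial l)).coeff x.2 ≠ 0 := by
      intro h
      rw [h, mul_zero, neg_zero] at hrec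
      exact (mul_ne_zero hlog hk) hrec
    obtain ⟨x, hx, hxne⟩ := Finset.exists_ne_zero_of_sum_ne_zero hne
    obtain ⟨hmul, -⟩ := Nat.mem_divisorsAntidiagonal.1 hx
    have hx1 : x.1 ≠ 1 := by
      intro h
      simp [h] at hxne
    have hx0 : x.1 ≠ 0 := fun h => hk0 (by rw [← hmul, h, zero_mul])
    have hx20 : x.2 ≠ 0 := fun h => hk0 (by rw [← hmul, h, mul_zero])
    have hlt : x.2 < k := by
      rw [← hmul]
      have : 2 ≤ x.1 := by omega
      nlinarith [Nat.pos_of_ne_zero hx20]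
    exact (ih x.2 hlt (right_ne_zero_of_mul hxne)).trans (Dvd.intro_left _ hmul)

theorem LSeries_indicator (S : Set ℕ) (hS : ∀ m ∈ S, m ≠ 0) (c : ℕ → ℂ) (s : ℂ) :
    LSeries (S.indicator c) s = ∑' m : S, c m * ((m : ℕ) : ℂ) ^ (-s) := by
  rw [LSeries, tsum_subtype S (fun m : ℕ => c m * (m : ℂ) ^ (-s))]
  refine tsum_congr fun n => ?_
  by_cases hn : n ∈ S
  · rw [term_of_ne_zero (hS n hn), Set.indicator_of_mem hn, Set.indicator_of_mem hn,
      Complex.cpow_neg, div_eq_mul_inv]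
  · rw [Set.indicator_of_notMem hn, term_def]
    simp [Set.indicator_of_notMem hn]

theorem LSeriesSummable_indicator (S : Set ℕ) (hS : ∀ m ∈ S, m ≠ 0) (c : ℕ → ℂ) (s : ℂ)
    (h : Summable (fun m : S => ‖c m * ((m : ℕ) : ℂ) ^ (-s)‖)) :
    LSeriesSummable (S.indicator c) s := by
  rw [LSeriesSummable]
  have h1 := (summable_subtype_iff_indicator (f := fun m : ℕ => c m * (m : ℂ) ^ (-s))).1 h.of_norm
  refine h1.congr fun n => ?_
  by_cases hn : n ∈ S
  · rw [term_of_ne_zero (hS n hn), Set.indicator_of_mem hn, Set.indicator_of_mem hn,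
      Complex.cpow_neg, div_eq_mul_inv]
  · rw [Set.indicator_of_notMem hn, term_def]
    simp [Set.indicator_of_notMem hn]

/-- The Dirichlet series `ψ_Q`. -/
def Symbol.psi (φ : Symbol) (Q : Finset ℕ) (s : ℂ) : ℂ :=
  LSeries ((Nat.factoredNumbers Q).indicator φ.coeff) s

theorem ne_zero_of_mem_factored {Q : Finset ℕ} : ∀ m ∈ Nat.factoredNumbers Q, m ≠ 0 :=
  fun _ hm => hm.1

theorem one_mem_factored {Q : Finset ℕ} : 1 ∈ Nat.factoredNumbers Q :=
  ⟨one_ne_zero, by simp⟩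

theorem Symbol.restrict_eq (φ : Symbol) (Q : Finset ℕ) (s : ℂ) :
    φ.restrict Q s = φ.char * s + φ.psi Q s := by
  rw [Symbol.restrict, Symbol.psi, LSeries_indicator _ ne_zero_of_mem_factored]

theorem abscissa_indicator_le (Q : Finset ℕ) (c : ℕ → ℂ)
    (h : ∀ s : ℂ, 0 < s.re → Summable (fun m : Nat.factoredNumbers Q => ‖c m * ((m : ℕ) : ℂ) ^ (-s)‖)) :
    abscissaOfAbsConv ((Nat.factoredNumbers Q).indicator c) ≤ 0 := by
  refine abscissaOfAbsConv_le_of_forall_lt_LSeriesSummable fun y hy => ?_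
  have hy' : 0 < y := by exact_mod_cast hy
  exact LSeriesSummable_indicator _ ne_zero_of_mem_factored _ _ (h y (by simpa using hy'))

theorem Symbol.abscissa_psi_le (φ : Symbol) (Q : Finset ℕ) :
    abscissaOfAbsConv ((Nat.factoredNumbers Q).indicator φ.coeff) ≤ 0 :=
  abscissa_indicator_le Q _ fun _ hs => φ.summable_restrict Q hs

theorem Symbol.hasDerivAt_psi (φ : Symbol) (Q : Finset ℕ) {s : ℂ} (hs : 0 < s.re) :
    HasDerivAt (φ.psi Q)
      (-LSeries (logMul ((Nat.factoredNumbers Q).indicator φ.coeff)) s) s :=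
  LSeries_hasDerivAt ((φ.abscissa_psi_le Q).trans_lt (by exact_mod_cast hs))

theorem Symbol.differentiableOn_restrict (φ : Symbol) (Q : Finset ℕ) :
    DifferentiableOn ℂ (φ.restrict Q) {s | 0 < s.re} := by
  intro s hs
  have h : φ.restrict Q = fun s => φ.char * s + φ.psi Q s := funext (φ.restrict_eq Q)
  rw [h]
  exact (((hasDerivAt_id s).const_mul (φ.char : ℂ)).add
    (φ.hasDerivAt_psi Q hs)).differentiableAt.differentiableWithinAt

theorem summable_coeff_mul (Q : Finset ℕ) (g : Hardy) (N : ℕ) {s : ℂ} (hs : 0 < s.re) :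
    Summable (fun m : Nat.factoredNumbers Q => ‖g.coeff (N * m) * ((m : ℕ) : ℂ) ^ (-s)‖) := by
  refine Summable.of_nonneg_of_le (fun _ => norm_nonneg _) (fun m => ?_)
    ((summable_factoredNumbers_rpow Q hs).mul_left ‖g‖)
  rw [norm_mul, norm_natCast_cpow_neg m.2.1]
  gcongr
  exact g.norm_coeff_le _

/-- The coefficient of `l^{-φ}` at `l^{c₀}`. -/
theorem IsCompositionOperator.coeff_pow {φ : Symbol} {T : Hardy →L[ℂ] Hardy}
    (hT : IsCompositionOperator φ T) (l : ℕ+) :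
    (T (monomial l)).coeff ((l : ℕ) ^ φ.char) = Complex.exp (-(Complex.log l * φ.coeff 1)) := by
  set g := (T (monomial l)).coeff with hg
  have hlpos : 0 < (l : ℕ) ^ φ.char := pow_pos l.pos _
  obtain ⟨n, hn⟩ : ∃ n, (l : ℕ) ^ φ.char = n + 1 := ⟨(l : ℕ) ^ φ.char - 1, by omega⟩
  -- By the support condition `l^{c₀} = n + 1` carries the leading term, whose coefficient is read
  -- off from the behaviour at `+∞`.
  have h1 := LSeries.tendsto_cpow_mul_atTop (f := g) (n := n) (fun m hm => by
    by_contra hne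
    have hdvd := hT.pow_dvd_of_coeff_ne_zero l hne
    have hm0 : m ≠ 0 := by
      rintro rfl
      simp [hg, Hardy.coeff] at hne
    have := Nat.le_of_dvd (Nat.pos_of_ne_zero hm0) hdvd
    omega) ((Hardy.abscissa_coeff_le _).trans_lt (by exact EReal.coe_lt_top 1))
  have h2 : Tendsto (fun x : ℝ => Complex.exp (-(Complex.log l * LSeries φ.coeff x))) atTop
      (𝓝 (Complex.exp (-(Complex.log l * φ.coeff 1)))) :=
    ((LSeries.tendsto_atTop (φ.abscissa_coeff_le.trans_lt (EReal.coe_lt_top _))).const_mul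
      _).neg.cexp
  rw [hn]
  refine tendsto_nhds_unique h1 (h2.congr' ?_)
  filter_upwards [eventually_gt_atTop (1 : ℝ)] with x hx
  have hl0 : ((l : ℕ) : ℂ) ≠ 0 := by exact_mod_cast l.ne_zero
  rw [hg, hT.LSeries_coeff l (s := x) (by simpa using hx)]
  have h3 : ((n : ℂ) + 1) = ((l : ℕ) : ℂ) ^ φ.char := by
    have : ((n + 1 : ℕ) : ℂ) = (((l : ℕ) ^ φ.char : ℕ) : ℂ) := by rw [hn]
    push_cast at this
    exact this
  have h4 : ((n : ℂ) + 1) ^ (x : ℂ) = Complex.exp (Complex.log l * (φ.char * x)) := by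
    rw [h3, ← Complex.natCast_log, ← Complex.cpow_natCast, ← Complex.ofReal_natCast,
      ← Complex.ofReal_natCast, ← Complex.ofReal_cpow (Nat.cast_nonneg _),
      ← Complex.ofReal_cpow (by positivity), ← Real.rpow_mul (Nat.cast_nonneg _),
      Real.rpow_def_of_pos (by exact_mod_cast l.pos)]
    push_cast
    rfl
  rw [h4, ← Complex.exp_add]
  congr 1
  ring

/-- The recursion at `N m` only sees coefficients at multiples of `l^{c₀}`, hence of `N`. Dividing
by `N` turns it into a recursion at `m`, with `c₀ log l` replaced by `log M`; it survives the
restriction because the integers with prime factors in `Q` are closed under divisors and products.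
-/
theorem IsCompositionOperator.restricted_recursion {φ : Symbol} {T : Hardy →L[ℂ] Hardy}
    (hT : IsCompositionOperator φ T) (l : ℕ+) {Q : Finset ℕ} {N M : ℕ}
    (hNM : (l : ℕ) ^ φ.char = N * M) (m : ℕ) (hm : m ≠ 0) :
    (Complex.log m - Complex.log M) *
        (Nat.factoredNumbers Q).indicator (fun m => (T (monomial l)).coeff (N * m)) m =
      -(Complex.log l * ∑ x ∈ m.divisorsAntidiagonal,
        (Complex.log x.1 * (Nat.factoredNumbers Q).indicator φ.coeff x.1) *
          (Nat.factoredNumbers Q).indicator (fun m => (T (monomial l)).coeff (N * m)) x.2) := by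
  have hpos : 0 < N * M := hNM ▸ pow_pos l.pos _
  have hN0 : N ≠ 0 := (Nat.pos_of_mul_pos_right hpos).ne'
  have hM0 : M ≠ 0 := (Nat.pos_of_mul_pos_left hpos).ne'
  by_cases hmQ : m ∈ Nat.factoredNumbers Q
  · rw [Set.indicator_of_mem hmQ]
    have hrec := hT.coeff_recursion l (k := N * m) (mul_ne_zero hN0 hm)
    have hlog : Complex.log (N * m : ℕ) - φ.char * Complex.log l = Complex.log m - Complex.log M := by
      have h1 : Real.log (N * m : ℕ) - φ.char * Real.log l = Real.log m - Real.log M := by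
        rw [← Real.log_pow]
        have : ((l : ℕ) : ℝ) ^ φ.char = N * M := by exact_mod_cast hNM
        rw [this]
        push_cast
        rw [Real.log_mul (by exact_mod_cast hN0) (by exact_mod_cast hm),
          Real.log_mul (by exact_mod_cast hN0) (by exact_mod_cast hM0)]
        ring
      rw [← Complex.natCast_log, ← Complex.natCast_log, ← Complex.natCast_log,
        ← Complex.natCast_log]
      exact_mod_cast h1
    rw [hlog] at hrec
    rw [hrec]
    congr 2
    symm
    refine Finset.sum_of_injOn (fun x => (x.1, N * x.2)) ?_ ?_ ?_ ?_
    · rintro ⟨a, b⟩ - ⟨c, d⟩ - h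
      simp only [Prod.mk.injEq] at h
      rw [Prod.mk.injEq]
      exact ⟨h.1, Nat.eq_of_mul_eq_mul_left (Nat.pos_of_ne_zero hN0) h.2⟩
    · rintro ⟨a, b⟩ h
      simp only [Finset.mem_coe, Nat.mem_divisorsAntidiagonal] at h ⊢
      refine ⟨?_, mul_ne_zero hN0 hm⟩
      rw [← h.1]; ring
    · rintro ⟨a, b⟩ h hnot
      by_contra hne
      apply hnot
      have hb : (T (monomial l)).coeff b ≠ 0 := right_ne_zero_of_mul hne
      obtain ⟨y, rfl⟩ : N ∣ b := (Dvd.intro _ hNM.symm).trans (hT.pow_dvd_of_coeff_ne_zero l hb)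
      refine ⟨(a, y), ?_, rfl⟩
      simp only [Finset.mem_coe, Nat.mem_divisorsAntidiagonal] at h ⊢
      refine ⟨Nat.eq_of_mul_eq_mul_left (Nat.pos_of_ne_zero hN0) ?_, hm⟩
      rw [← h.1]; ring
    · rintro ⟨a, b⟩ h
      obtain ⟨hab, -⟩ := Nat.mem_divisorsAntidiagonal.1 h
      have ha : a ∈ Nat.factoredNumbers Q :=
        Nat.mem_factoredNumbers_of_dvd hmQ (Dvd.intro _ hab)
      have hb : b ∈ Nat.factoredNumbers Q :=
        Nat.mem_factoredNumbers_of_dvd hmQ (Dvd.intro_left _ hab)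
      simp only [Set.indicator_of_mem ha, Set.indicator_of_mem hb]
  · rw [Set.indicator_of_notMem hmQ, mul_zero]
    symm
    rw [neg_eq_zero]
    refine mul_eq_zero_of_right _ (Finset.sum_eq_zero ?_)
    rintro ⟨a, b⟩ h
    obtain ⟨hab, -⟩ := Nat.mem_divisorsAntidiagonal.1 h
    by_cases ha : a ∈ Nat.factoredNumbers Q
    · have hb : b ∉ Nat.factoredNumbers Q := fun hb =>
        hmQ (hab ▸ Nat.mul_mem_factoredNumbers ha hb)
      simp [Set.indicator_of_notMem hb]
    · simp [Set.indicator_of_notMem ha]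

/-- The part of `l^{-φ}` supported on `N` times the integers with prime factors in `Q`. -/
theorem IsCompositionOperator.tsum_coeff_mul {φ : Symbol} {T : Hardy →L[ℂ] Hardy}
    (hT : IsCompositionOperator φ T) (l : ℕ+) {Q : Finset ℕ} {N M : ℕ}
    (hNM : (l : ℕ) ^ φ.char = N * M) (hM : M ∈ Nat.factoredNumbers Q) {s : ℂ} (hs : 0 < s.re) :
    ∑' m : Nat.factoredNumbers Q, (T (monomial l)).coeff (N * m) * ((m : ℕ) : ℂ) ^ (-s) =
      Complex.exp (-(Complex.log M * s + Complex.log l * φ.psi Q s)) := by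
  set gQ := (Nat.factoredNumbers Q).indicator (fun m => (T (monomial l)).coeff (N * m)) with hgQ
  set cQ := (Nat.factoredNumbers Q).indicator φ.coeff with hcQ
  have hpos : 0 < N * M := hNM ▸ pow_pos l.pos _
  have hN0 : 0 < N := Nat.pos_of_mul_pos_right hpos
  have hM0 : 0 < M := Nat.pos_of_mul_pos_left hpos
  have hga : abscissaOfAbsConv gQ ≤ 0 :=
    abscissa_indicator_le Q _ fun _ hs => summable_coeff_mul Q _ N hs
  have hca : abscissaOfAbsConv cQ ≤ 0 := φ.abscissa_psi_le Q
  have hglt : ∀ {x : ℝ}, 0 < x → abscissaOfAbsConv gQ < x := fun hx =>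
    hga.trans_lt (by exact_mod_cast hx)
  have hclt : ∀ {x : ℝ}, 0 < x → abscissaOfAbsConv cQ < x := fun hx =>
    hca.trans_lt (by exact_mod_cast hx)
  rw [← LSeries_indicator _ ne_zero_of_mem_factored (fun m => (T (monomial l)).coeff (N * m)) s, ← hgQ]
  have hode : ∀ z : ℂ, 0 < z.re → LSeries (logMul gQ) z - Complex.log M * LSeries gQ z =
      -(Complex.log l * (LSeries (logMul cQ) z * LSeries gQ z)) := by
    intro z hz
    have h1 := LSeriesSummable_logMul_of_lt_re (hglt hz)
    have h2 := LSeriesSummable_of_abscissaOfAbsConv_lt_re (hglt hz)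
    have h3 := LSeriesSummable_logMul_of_lt_re (hclt hz)
    rw [← LSeries_convolution' h3 h2, ← LSeries_smul, ← LSeries_smul,
      ← LSeries_sub h1 (h2.smul _), ← LSeries_neg]
    refine LSeries_congr (fun {n} hn => ?_) z
    simp only [Pi.sub_apply, Pi.smul_apply, smul_eq_mul, Pi.neg_apply, convolution_def, logMul]
    rw [← hT.restricted_recursion l hNM n hn]
    ring
  -- The quotient of the restricted series by the claimed exponential. The recursion makes it
  -- constant, and its limit at `+∞` is `1`.
  set H : ℂ → ℂ := fun z => LSeries gQ z * Complex.exp (Complex.log M * z + Complex.log l * φ.psi Q z)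
    with hH
  have hHd : ∀ z : ℂ, 0 < z.re → HasDerivAt H 0 z := by
    intro z hz
    have hd1 : HasDerivAt (LSeries gQ) (-LSeries (logMul gQ) z) z := LSeries_hasDerivAt (hglt hz)
    have hd2 : HasDerivAt (φ.psi Q) (-LSeries (logMul cQ) z) z := φ.hasDerivAt_psi Q hz
    have hd3 : HasDerivAt (fun z => Complex.exp (Complex.log M * z + Complex.log l * φ.psi Q z))
        (Complex.exp (Complex.log M * z + Complex.log l * φ.psi Q z) *
          (Complex.log M * 1 + Complex.log l * -LSeries (logMul cQ) z)) z :=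
      (((hasDerivAt_id z).const_mul _).add (hd2.const_mul _)).cexp
    have hd4 := hd1.mul hd3
    have h0 : -LSeries (logMul gQ) z * Complex.exp (Complex.log M * z + Complex.log l * φ.psi Q z) +
        LSeries gQ z * (Complex.exp (Complex.log M * z + Complex.log l * φ.psi Q z) *
          (Complex.log M * 1 + Complex.log l * -LSeries (logMul cQ) z)) = 0 := by
      linear_combination (-Complex.exp (Complex.log M * z + Complex.log l * φ.psi Q z)) * hode z hz
    rw [h0] at hd4
    exact hd4
  have hopen : IsOpen {z : ℂ | 0 < z.re} := isOpen_lt continuous_const Complex.continuous_re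
  have hconn : IsPreconnected {z : ℂ | 0 < z.re} := (convex_halfSpace_re_gt 0).isPreconnected
  have hconst : ∀ x : ℝ, 0 < x → H x = H s := fun x hx =>
    hopen.is_const_of_deriv_eq_zero hconn
      (fun z hz => (hHd z hz).differentiableAt.differentiableWithinAt)
      (fun z hz => (hHd z hz).deriv) (show 0 < (x : ℂ).re by simpa using hx) hs
  have hgM : gQ M = Complex.exp (-(Complex.log l * φ.coeff 1)) := by
    rw [hgQ, Set.indicator_of_mem hM, ← hNM, hT.coeff_pow]
  -- The leading index of the restricted series is `M`, and `hM` puts it in the support.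
  have hlim : Tendsto (fun x : ℝ => H x) atTop (𝓝 1) := by
    obtain ⟨n, rfl⟩ : ∃ n, M = n + 1 := ⟨M - 1, by omega⟩
    have h1 := LSeries.tendsto_cpow_mul_atTop (f := gQ) (n := n) (fun m hm => by
      by_contra hne
      have hmQ : m ∈ Nat.factoredNumbers Q := Set.mem_of_indicator_ne_zero hne
      rw [hgQ, Set.indicator_of_mem hmQ] at hne
      have hdvd := hT.pow_dvd_of_coeff_ne_zero l hne
      rw [hNM] at hdvd
      have := Nat.le_of_dvd (Nat.pos_of_ne_zero hmQ.1) (Nat.dvd_of_mul_dvd_mul_left hN0 hdvd)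
      omega) (hga.trans_lt (EReal.coe_lt_top 0))
    have h2 : Tendsto (fun x : ℝ => Complex.exp (Complex.log l * φ.psi Q x)) atTop
        (𝓝 (Complex.exp (Complex.log l * cQ 1))) :=
      ((LSeries.tendsto_atTop (hca.trans_lt (EReal.coe_lt_top 0))).const_mul _).cexp
    have h3 := h1.mul h2
    have h4 : cQ 1 = φ.coeff 1 := by rw [hcQ, Set.indicator_of_mem one_mem_factored]
    rw [hgM, h4, ← Complex.exp_add, neg_add_cancel, Complex.exp_zero] at h3
    refine h3.congr fun x => ?_
    have hne : ((n : ℂ) + 1) ≠ 0 := by exact_mod_cast n.succ_ne_zero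
    simp only [hH]
    rw [Complex.cpow_def_of_ne_zero hne, Complex.exp_add]
    push_cast
    ring
  have hH1 : H s = 1 := by
    refine tendsto_nhds_unique (tendsto_const_nhds.congr' ?_) hlim
    filter_upwards [eventually_gt_atTop (0 : ℝ)] with x hx
    exact (hconst x hx).symm
  rw [Complex.exp_neg]
  exact eq_inv_of_mul_eq_one_left hH1

/-! ### Lower bounds for the essential norm by weakly null vectors. -/

theorem tendsto_inner_zero_of_coord {ι : Type*} {l : Filter ι} {y : ι → Hardy}
    (hy : ∀ i, ‖y i‖ ≤ 1) (hc : ∀ k : ℕ+, Tendsto (fun i => y i k) l (𝓝 0)) (g : Hardy) :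
    Tendsto (fun i => ⟪y i, g⟫) l (𝓝 0) := by
  rw [Metric.tendsto_nhds]
  intro ε hε
  have h1 := lp.hasSum_single (p := 2) (by norm_num) g
  obtain ⟨s, hs⟩ := ((Metric.tendsto_nhds.1 h1) (ε / 2) (by positivity)).exists
  rw [dist_eq_norm, norm_sub_rev] at hs
  set gs := ∑ k ∈ s, lp.single 2 k (g k) with hgs
  have h2 : Tendsto (fun i => ⟪y i, gs⟫) l (𝓝 0) := by
    have h3 : ∀ i, ⟪y i, gs⟫ = ∑ k ∈ s, g k * conj (y i k) := by
      intro i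
      rw [hgs, inner_sum]
      refine Finset.sum_congr rfl fun k _ => ?_
      rw [lp.inner_single_right]
      rfl
    simp_rw [h3]
    have h4 := tendsto_finsetSum s (fun k _ =>
      (((Complex.continuous_conj.tendsto _).comp (hc k)).const_mul (g k)))
    simpa using h4
  filter_upwards [(Metric.tendsto_nhds.1 h2) (ε / 2) (by positivity)] with i hi
  rw [dist_zero_right] at hi ⊢
  have h5 : ⟪y i, g⟫ = ⟪y i, gs⟫ + ⟪y i, g - gs⟫ := by rw [inner_sub_right]; ring
  rw [h5]
  have h6 : ‖⟪y i, g - gs⟫‖ ≤ ‖g - gs‖ :=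
    (norm_inner_le_norm _ _).trans (mul_le_of_le_one_left (norm_nonneg _) (hy i))
  linarith [norm_add_le ⟪y i, gs⟫ ⟪y i, g - gs⟫]

/-- The image of the unit ball under `K` is totally bounded, so weak convergence of `y` is uniform
on it. Only `y` has to be weakly null; `f` is arbitrary in the ball. -/
theorem tendsto_inner_compact_zero {ι : Type*} {l : Filter ι} {y f : ι → Hardy}
    (hy : ∀ i, ‖y i‖ ≤ 1) (hf : ∀ i, ‖f i‖ ≤ 1)
    (hc : ∀ k : ℕ+, Tendsto (fun i => y i k) l (𝓝 0)) {K : Hardy →L[ℂ] Hardy}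
    (hK : IsCompactOperator K) : Tendsto (fun i => ⟪y i, K (f i)⟫) l (𝓝 0) := by
  rw [Metric.tendsto_nhds]
  intro ε hε
  have hcpt := hK.isCompact_closure_image_closedBall (f := (K : Hardy →ₗ[ℂ] Hardy)) 1
  obtain ⟨t, ht, hcov⟩ := Metric.totallyBounded_iff.1 hcpt.totallyBounded (ε / 2) (by positivity)
  have h1 : ∀ᶠ i in l, ∀ g ∈ t, ‖⟪y i, g⟫‖ < ε / 2 := by
    rw [eventually_all_finite ht]
    intro g _
    have := (Metric.tendsto_nhds.1 (tendsto_inner_zero_of_coord hy hc g)) (ε / 2) (by positivity)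
    simpa using this
  filter_upwards [h1] with i hi
  have h2 : K (f i) ∈ closure ((K : Hardy →ₗ[ℂ] Hardy) '' Metric.closedBall 0 1) :=
    subset_closure ⟨f i, by simpa using hf i, rfl⟩
  obtain ⟨g, hg, hdist⟩ := Set.mem_iUnion₂.1 (hcov h2)
  rw [Metric.mem_ball, dist_eq_norm] at hdist
  rw [dist_zero_right]
  have h5 : ⟪y i, K (f i)⟫ = ⟪y i, g⟫ + ⟪y i, K (f i) - g⟫ := by rw [inner_sub_right]; ring
  rw [h5]
  have h6 : ‖⟪y i, K (f i) - g⟫‖ ≤ ‖K (f i) - g‖ :=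
    (norm_inner_le_norm _ _).trans (mul_le_of_le_one_left (norm_nonneg _) (hy i))
  linarith [norm_add_le ⟪y i, g⟫ ⟪y i, K (f i) - g⟫, hi g hg]

/-- A lower bound for the essential norm by the action on normalised, weakly null vectors. -/
theorem le_essentialNorm_of_frequently {ι : Type*} {l : Filter ι} {y f : ι → Hardy}
    (hy : ∀ i, ‖y i‖ ≤ 1) (hf : ∀ i, ‖f i‖ ≤ 1)
    (hc : ∀ k : ℕ+, Tendsto (fun i => y i k) l (𝓝 0)) {T : Hardy →L[ℂ] Hardy} {B : ℝ}
    (hB : ∀ ε : ℝ, 0 < ε → ∃ᶠ i in l, B - ε ≤ ‖⟪y i, T (f i)⟫‖) : B ≤ essentialNorm T := by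
  have : Nonempty {K : Hardy →L[ℂ] Hardy // IsCompactOperator K} :=
    ⟨⟨0, isCompactOperator_zero⟩⟩
  refine le_ciInf fun K => le_of_forall_pos_le_add fun ε hε => ?_
  have h1 := (Metric.tendsto_nhds.1 (tendsto_inner_compact_zero hy hf hc K.2)) (ε / 2)
    (by positivity)
  obtain ⟨i, hi, hKi⟩ := ((hB (ε / 2) (by positivity)).and_eventually h1).exists
  rw [dist_zero_right] at hKi
  have h3 : ⟪y i, T (f i)⟫ = ⟪y i, (T - K.1) (f i)⟫ + ⟪y i, K.1 (f i)⟫ := by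
    rw [sub_apply, inner_sub_right]; ring
  have h4 : ‖⟪y i, (T - K.1) (f i)⟫‖ ≤ ‖T - K.1‖ := by
    refine (norm_inner_le_norm _ _).trans ?_
    have h5 := (T - K.1).le_opNorm (f i)
    have h6 : ‖T - K.1‖ * ‖f i‖ ≤ ‖T - K.1‖ := mul_le_of_le_one_right (norm_nonneg _) (hf i)
    exact (mul_le_of_le_one_left (norm_nonneg _) (hy i)).trans (h5.trans h6)
  rw [h3] at hi
  linarith [norm_add_le ⟪y i, (T - K.1) (f i)⟫ ⟪y i, K.1 (f i)⟫]

theorem le_essentialNorm_of_tendsto {ι : Type*} {l : Filter ι} [l.NeBot] {y f : ι → Hardy}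
    (hy : ∀ i, ‖y i‖ ≤ 1) (hf : ∀ i, ‖f i‖ ≤ 1)
    (hc : ∀ k : ℕ+, Tendsto (fun i => y i k) l (𝓝 0)) {T : Hardy →L[ℂ] Hardy} {B : ℝ}
    (hB : Tendsto (fun i => ‖⟪y i, T (f i)⟫‖) l (𝓝 B)) : B ≤ essentialNorm T :=
  le_essentialNorm_of_frequently hy hf hc fun ε hε =>
    ((hB.eventually_const_lt (show B - ε < B by linarith)).mono fun _ h => h.le).frequently

theorem essentialNorm_le_norm (T : Hardy →L[ℂ] Hardy) : essentialNorm T ≤ ‖T‖ := by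
  have h := ciInf_le (f := fun K : {K : Hardy →L[ℂ] Hardy // IsCompactOperator K} => ‖T - K‖)
    ⟨0, by rintro _ ⟨K, rfl⟩; exact norm_nonneg _⟩ ⟨0, isCompactOperator_zero⟩
  simpa [essentialNorm] using h

/-! ### Kernel vectors. -/

/-- The index `N m`, for `m ∈ S`. -/
def kernelIndex (S : Set ℕ) (N : ℕ+) (m : S) : ℕ+ := N * (m : ℕ).toPNat'

theorem kernelIndex_coe {S : Set ℕ} (hS : ∀ m ∈ S, m ≠ 0) (N : ℕ+) (m : S) :
    (kernelIndex S N m : ℕ) = N * m := by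
  rw [kernelIndex, PNat.mul_coe, Nat.toPNat'_coe, if_pos (Nat.pos_of_ne_zero (hS m m.2))]

theorem kernelIndex_injective {S : Set ℕ} (hS : ∀ m ∈ S, m ≠ 0) (N : ℕ+) :
    Function.Injective (kernelIndex S N) := by
  intro a b h
  have h1 := congrArg PNat.val h
  change (kernelIndex S N a : ℕ) = kernelIndex S N b at h1
  rw [kernelIndex_coe hS, kernelIndex_coe hS] at h1
  exact Subtype.ext (Nat.eq_of_mul_eq_mul_left N.pos h1)

def kernelFun (S : Set ℕ) (N : ℕ+) (w : ℂ) : ℕ+ → ℂ :=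
  Function.extend (kernelIndex S N) (fun m : S => ((m : ℕ) : ℂ) ^ (-w)) 0

open Classical in
/-- The vector with entries `m^{-w}` at the indices `N m`, `m ∈ S`. -/
def kernelVec (S : Set ℕ) (N : ℕ+) (w : ℂ) : Hardy :=
  if h : Memℓp (kernelFun S N w) 2 then ⟨kernelFun S N w, h⟩ else 0

section kernelVec

variable {S : Set ℕ} {x₀ : ℝ} {d : ℕ} {R : ℝ}

theorem norm_sq_natCast_cpow {m : ℕ} (hm : m ≠ 0) (w : ℂ) :
    ‖(m : ℂ) ^ (-w)‖ ^ 2 = (m : ℝ) ^ (-(2 * w.re)) := by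
  rw [norm_natCast_cpow_neg hm, ← Real.rpow_natCast, ← Real.rpow_mul (Nat.cast_nonneg _)]
  congr 1
  push_cast
  ring

/-- The general `F` serves norms, inner products and images of kernel vectors alike. -/
theorem hasSum_kernelFun (hS : ∀ m ∈ S, m ≠ 0) (N : ℕ+) (w : ℂ) {E : Type*} [AddCommMonoid E]
    [TopologicalSpace E] (F : ℕ+ → ℂ → E) (hF : ∀ k, F k 0 = 0) {x : E} :
    HasSum (fun k => F k (kernelFun S N w k)) x ↔
      HasSum (fun m : S => F (kernelIndex S N m) (((m : ℕ) : ℂ) ^ (-w))) x := by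
  rw [← (kernelIndex_injective hS N).hasSum_iff]
  · refine iff_of_eq (congrArg (fun f => HasSum f x) (funext fun m => ?_))
    simp only [Function.comp, kernelFun, (kernelIndex_injective hS N).extend_apply]
  · intro k hk
    rw [kernelFun, Function.extend_apply' _ _ _ hk, Pi.zero_apply, hF]

theorem PoleKernel.hasSum_norm_sq (h : PoleKernel S x₀ d R) {w : ℂ} (hw : x₀ < 2 * w.re) :
    HasSum (fun m : S => ‖((m : ℕ) : ℂ) ^ (-w)‖ ^ 2) ‖kernelSum S ((2 * w.re : ℝ) : ℂ)‖ := by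
  have h1 : 0 ≤ ∑' m : S, ((m : ℕ) : ℝ) ^ (-(2 * w.re)) := tsum_nonneg fun m => by positivity
  rw [kernelSum_ofReal, Complex.norm_real, Real.norm_of_nonneg h1]
  simp_rw [fun m : S => norm_sq_natCast_cpow (h.ne_zero m m.2) w]
  exact (h.summable _ hw).hasSum

theorem PoleKernel.memℓp (h : PoleKernel S x₀ d R) (N : ℕ+) {w : ℂ} (hw : x₀ < 2 * w.re) :
    Memℓp (kernelFun S N w) 2 := by
  refine memℓp_gen ?_
  have h1 := (hasSum_kernelFun h.ne_zero N w (F := fun _ z => ‖z‖ ^ 2) (by simp)).2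
    (h.hasSum_norm_sq hw)
  simpa using h1.summable

theorem PoleKernel.kernelVec_apply (h : PoleKernel S x₀ d R) (N : ℕ+) {w : ℂ}
    (hw : x₀ < 2 * w.re) (k : ℕ+) : kernelVec S N w k = kernelFun S N w k := by
  rw [kernelVec, dif_pos (h.memℓp N hw)]

theorem PoleKernel.norm_kernelVec_sq (h : PoleKernel S x₀ d R) (N : ℕ+) {w : ℂ}
    (hw : x₀ < 2 * w.re) : ‖kernelVec S N w‖ ^ 2 = ‖kernelSum S ((2 * w.re : ℝ) : ℂ)‖ := by
  have h1 := lp.norm_rpow_eq_tsum (p := 2) (by norm_num) (kernelVec S N w)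
  simp only [ENNReal.toReal_ofNat, Real.rpow_ofNat] at h1
  rw [h1]
  simp_rw [h.kernelVec_apply N hw]
  exact ((hasSum_kernelFun h.ne_zero N w (F := fun _ z => ‖z‖ ^ 2) (by simp)).2
    (h.hasSum_norm_sq hw)).tsum_eq

theorem PoleKernel.norm_kernelVec_apply_le (h : PoleKernel S x₀ d R) (N : ℕ+) {w : ℂ}
    (hw : x₀ < 2 * w.re) (hw0 : 0 ≤ w.re) (k : ℕ+) : ‖kernelVec S N w k‖ ≤ 1 := by
  rw [h.kernelVec_apply N hw, kernelFun]
  by_cases hk : ∃ m, kernelIndex S N m = k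
  · obtain ⟨m, rfl⟩ := hk
    rw [(kernelIndex_injective h.ne_zero N).extend_apply, norm_natCast_cpow_neg (h.ne_zero m m.2)]
    refine Real.rpow_le_one_of_one_le_of_nonpos ?_ (by linarith)
    exact_mod_cast Nat.one_le_iff_ne_zero.2 (h.ne_zero m m.2)
  · rw [Function.extend_apply' _ _ _ hk]
    simp

theorem PoleKernel.hasSum_inner_kernelVec (h : PoleKernel S x₀ d R) (N : ℕ+) {w : ℂ}
    (hw : x₀ < 2 * w.re) (g : Hardy) :
    HasSum (fun m : S => g.coeff (N * m) * conj (((m : ℕ) : ℂ) ^ (-w))) ⟪kernelVec S N w, g⟫ := by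
  have h1 := lp.hasSum_inner (𝕜 := ℂ) (kernelVec S N w) g
  have h2 : HasSum (fun k => g k * conj (kernelFun S N w k)) ⟪kernelVec S N w, g⟫ := by
    refine h1.congr_fun fun k => ?_
    rw [h.kernelVec_apply N hw]
    rfl
  rw [hasSum_kernelFun h.ne_zero N w (F := fun k z => g k * conj z) (by simp)] at h2
  refine h2.congr_fun fun m => ?_
  rw [← Hardy.coeff_coe, kernelIndex_coe h.ne_zero]

theorem PoleKernel.hasSum_map_kernelVec (h : PoleKernel S x₀ d R) (N : ℕ+) {w : ℂ}
    (hw : x₀ < 2 * w.re) (L : Hardy →L[ℂ] ℂ) :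
    HasSum (fun m : S => ((m : ℕ) : ℂ) ^ (-w) * L (monomial (kernelIndex S N m)))
      (L (kernelVec S N w)) := by
  have h1 := (lp.hasSum_single (p := 2) (by norm_num) (kernelVec S N w)).mapL L
  have h2 : HasSum (fun k => kernelFun S N w k * L (monomial k)) (L (kernelVec S N w)) := by
    refine h1.congr_fun fun k => ?_
    rw [← h.kernelVec_apply N hw, monomial, ← smul_eq_mul, ← map_smul, ← lp.single_smul,
      smul_eq_mul, mul_one]
  rw [hasSum_kernelFun h.ne_zero N w (F := fun k z => z * L (monomial k)) (by simp)] at h2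
  exact h2

end kernelVec

/-! ### Matrix entries of composition operators between kernel vectors. -/

theorem conj_natCast_cpow (m : ℕ) (s : ℂ) : conj ((m : ℂ) ^ (-conj s)) = (m : ℂ) ^ (-s) := by
  rw [← map_neg, Complex.cpow_conj _ _ (by
    rw [Complex.natCast_arg]; exact Real.pi_pos.ne), Complex.conj_natCast, Complex.conj_conj]

section Pairing

variable {φ : Symbol} {T : Hardy →L[ℂ] Hardy} {Q : Finset ℕ}

theorem IsCompositionOperator.inner_kernelVec (hT : IsCompositionOperator φ T)
    (hQ : ∀ p ∈ Q, p.Prime) (hne : Q.Nonempty) (l N : ℕ+) {M : ℕ}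
    (hNM : (l : ℕ) ^ φ.char = N * M) (hM : M ∈ Nat.factoredNumbers Q) {s : ℂ} (hs : 0 < s.re) :
    ⟪kernelVec (Nat.factoredNumbers Q) N (conj s), T (monomial l)⟫ =
      Complex.exp (-(Complex.log M * s + Complex.log l * φ.psi Q s)) := by
  rw [← hT.tsum_coeff_mul l hNM hM hs,
    ← ((poleKernel_factoredNumbers hQ hne).hasSum_inner_kernelVec N (w := conj s)
      (by simpa using hs) (T (monomial l))).tsum_eq]
  exact tsum_congr fun m => by rw [conj_natCast_cpow]

theorem IsCompositionOperator.inner_kernelVec_eq_zero (hT : IsCompositionOperator φ T)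
    (hQ : ∀ p ∈ Q, p.Prime) (hne : Q.Nonempty) (l N : ℕ+)
    (hN : ∀ m ∈ Nat.factoredNumbers Q, ¬ (l : ℕ) ^ φ.char ∣ N * m) {s : ℂ} (hs : 0 < s.re) :
    ⟪kernelVec (Nat.factoredNumbers Q) N (conj s), T (monomial l)⟫ = 0 := by
  rw [← ((poleKernel_factoredNumbers hQ hne).hasSum_inner_kernelVec N (w := conj s)
      (by simpa using hs) (T (monomial l))).tsum_eq]
  refine (tsum_congr fun m => ?_).trans tsum_zero
  have : (T (monomial l)).coeff (N * m) = 0 := by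
    by_contra h
    exact hN m m.2 (hT.pow_dvd_of_coeff_ne_zero l h)
  rw [this, zero_mul]

theorem natCast_log_mul {m n : ℕ} (hm : m ≠ 0) (hn : n ≠ 0) :
    Complex.log ((m * n : ℕ) : ℂ) = Complex.log m + Complex.log n := by
  rw [← Complex.natCast_log, ← Complex.natCast_log, ← Complex.natCast_log]
  push_cast
  rw [Real.log_mul (by exact_mod_cast hm) (by exact_mod_cast hn)]
  push_cast
  rfl

theorem natCast_log_pow (m k : ℕ) :
    Complex.log ((m ^ k : ℕ) : ℂ) = k * Complex.log m := by
  rw [← Complex.natCast_log, ← Complex.natCast_log]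
  push_cast
  rw [Real.log_pow]
  push_cast
  rfl

/-- With `l = n m` one has `l^{c₀} = n^{c₀} m^{c₀}`. The factor `m^{c₀}` supplies the term `c₀ s` of
`φ_Q`, while `n` only contributes the twist `n^{-ψ_Q(s)}`. -/
theorem IsCompositionOperator.inner_kernelVec_kernelIndex (hT : IsCompositionOperator φ T)
    (hQ : ∀ p ∈ Q, p.Prime) (hne : Q.Nonempty) (n : ℕ+) {s : ℂ} (hs : 0 < s.re)
    (m : Nat.factoredNumbers Q) :
    ⟪kernelVec (Nat.factoredNumbers Q) (n ^ φ.char) (conj s),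
        T (monomial (kernelIndex (Nat.factoredNumbers Q) n m))⟫ =
      ((n : ℕ) : ℂ) ^ (-φ.psi Q s) * ((m : ℕ) : ℂ) ^ (-φ.restrict Q s) := by
  have hm : (m : ℕ) ≠ 0 := m.2.1
  have hidx := kernelIndex_coe (S := Nat.factoredNumbers Q) ne_zero_of_mem_factored n m
  have hpow : ∀ k : ℕ, (m : ℕ) ^ k ∈ Nat.factoredNumbers Q := by
    intro k
    induction k with
    | zero => simpa using one_mem_factored
    | succ k ih => rw [pow_succ]; exact Nat.mul_mem_factoredNumbers ih m.2
  rw [hT.inner_kernelVec hQ hne _ _ (M := (m : ℕ) ^ φ.char) (by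
    rw [hidx, PNat.pow_coe, mul_pow]) (hpow _) hs, hidx,
    Complex.cpow_def_of_ne_zero (by exact_mod_cast n.ne_zero),
    Complex.cpow_def_of_ne_zero (by exact_mod_cast hm), ← Complex.exp_add,
    natCast_log_mul n.ne_zero hm, natCast_log_pow, Symbol.restrict_eq]
  congr 1
  ring

/-- As `n` is prime to `Q`, the integers `n^k m'` contain too small a power of `n` to be multiples
of `n^{c₀}`. This detects symbols of larger characteristic. -/
theorem IsCompositionOperator.inner_kernelVec_kernelIndex_eq_zero (hT : IsCompositionOperator φ T)
    (hQ : ∀ p ∈ Q, p.Prime) (hne : Q.Nonempty) {n : ℕ+} (hn : 1 < (n : ℕ))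
    (hcop : ∀ p ∈ Q, ¬ p ∣ n) {k : ℕ} (hk : k < φ.char) {s : ℂ} (hs : 0 < s.re)
    (m : Nat.factoredNumbers Q) :
    ⟪kernelVec (Nat.factoredNumbers Q) (n ^ k) (conj s),
        T (monomial (kernelIndex (Nat.factoredNumbers Q) n m))⟫ = 0 := by
  have hidx := kernelIndex_coe (S := Nat.factoredNumbers Q) ne_zero_of_mem_factored n m
  refine hT.inner_kernelVec_eq_zero hQ hne _ _ (fun m' hm' hdvd => ?_) hs
  rw [hidx, mul_pow, PNat.pow_coe] at hdvd
  have h1 : (n : ℕ) ^ φ.char ∣ (n : ℕ) ^ k * m' := (Dvd.intro _ rfl).trans hdvd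
  have h2 : Nat.Coprime ((n : ℕ) ^ φ.char) m' := by
    refine Nat.Coprime.pow_left _ (Nat.coprime_of_dvd fun p hp hpn hpm => ?_)
    exact hcop p (hm'.2 p ((Nat.mem_primeFactorsList hm'.1).2 ⟨hp, hpm⟩)) hpn
  have h3 := (Nat.pow_dvd_pow_iff_le_right hn).1 (h2.dvd_of_dvd_mul_right h1)
  omega

theorem IsCompositionOperator.inner_kernelVec_of_char_zero (hT : IsCompositionOperator φ T)
    (hQ : ∀ p ∈ Q, p.Prime) (hne : Q.Nonempty) (h0 : φ.char = 0) (l : ℕ+) {s : ℂ} (hs : 0 < s.re) :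
    ⟪kernelVec (Nat.factoredNumbers Q) 1 (conj s), T (monomial l)⟫ =
      ((l : ℕ) : ℂ) ^ (-φ.restrict Q s) := by
  rw [hT.inner_kernelVec hQ hne l 1 (M := 1) (by simp [h0]) one_mem_factored hs,
    Complex.cpow_def_of_ne_zero (by exact_mod_cast l.ne_zero), Symbol.restrict_eq, h0]
  congr 1
  simp

/-- Evaluation of `⟪y, T f⟫` for a kernel vector `f`, if the matrix entries are exponentials. -/
theorem inner_map_kernelVec {S S' : Set ℕ} {x₀ : ℝ} {d : ℕ} {R : ℝ} (h : PoleKernel S x₀ d R)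
    (hS : S' ⊆ S) (T : Hardy →L[ℂ] Hardy) (y : Hardy) (n : ℕ+) {a b A : ℂ} (ha : x₀ < 2 * a.re)
    (hmem : ∀ m : S, (m : ℕ) ∈ S' →
      ⟪y, T (monomial (kernelIndex S n m))⟫ = A * ((m : ℕ) : ℂ) ^ (-b))
    (hnot : ∀ m : S, (m : ℕ) ∉ S' → ⟪y, T (monomial (kernelIndex S n m))⟫ = 0) :
    ⟪y, T (kernelVec S n (conj a))⟫ = A * kernelSum S' (conj a + b) := by
  have h1 := (h.hasSum_map_kernelVec n (w := conj a) (by simpa using ha)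
    ((innerSL ℂ y).comp T)).tsum_eq
  simp only [ContinuousLinearMap.comp_apply, innerSL_apply_apply] at h1
  rw [← h1, kernelSum, ← tsum_mul_left,
    tsum_subtype S' (fun m : ℕ => A * (m : ℂ) ^ (-(conj a + b)))]
  have h2 : ∀ m : S, ((m : ℕ) : ℂ) ^ (-conj a) * ⟪y, T (monomial (kernelIndex S n m))⟫ =
      S'.indicator (fun m : ℕ => A * (m : ℂ) ^ (-(conj a + b))) m := by
    intro m
    by_cases hm : (m : ℕ) ∈ S'
    · rw [Set.indicator_of_mem hm, hmem m hm, neg_add,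
        Complex.cpow_add _ _ (by exact_mod_cast h.ne_zero m m.2)]
      ring
    · rw [Set.indicator_of_notMem hm, hnot m hm, mul_zero]
  simp_rw [h2]
  rw [tsum_subtype S (S'.indicator (fun m : ℕ => A * (m : ℂ) ^ (-(conj a + b)))),
    Set.indicator_indicator, Set.inter_eq_right.2 hS]

/-- Up to conjugation these are the coefficients of the adjoint applied to `y`. -/
theorem summable_norm_inner_map_monomial (T : Hardy →L[ℂ] Hardy) (y : Hardy) :
    Summable (fun l : ℕ+ => ‖⟪y, T (monomial l)⟫‖ ^ 2) := by
  have h1 := (lp.memℓp (ContinuousLinearMap.adjoint T y)).summable (by norm_num)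
  refine h1.congr fun l => ?_
  rw [← ContinuousLinearMap.adjoint_inner_left, monomial, lp.inner_single_right]
  simp

/-- The mapping property of `φ_Q` is read off from the boundedness of `T`: the entries `l^{-φ_Q(s)}`
are square summable over all `l`, which requires `2 Re φ_Q(s) > 1`. -/
theorem IsCompositionOperator.restrict_re_gt_half (hT : IsCompositionOperator φ T)
    (hQ : ∀ p ∈ Q, p.Prime) (hne : Q.Nonempty) (h0 : φ.char = 0) {s : ℂ} (hs : 0 < s.re) :
    1 / 2 < (φ.restrict Q s).re := by
  have h1 := summable_norm_inner_map_monomial T (kernelVec (Nat.factoredNumbers Q) 1 (conj s))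
  simp_rw [fun l : ℕ+ => hT.inner_kernelVec_of_char_zero hQ hne h0 l hs,
    fun l : ℕ+ => norm_sq_natCast_cpow l.ne_zero (φ.restrict Q s)] at h1
  have h2 := (summable_pnat_iff_summable_nat
    (f := fun n : ℕ => (n : ℝ) ^ (-(2 * (φ.restrict Q s).re)))).1 h1
  rw [Real.summable_nat_rpow] at h2
  linarith

/-- Square summability along the powers of one prime of `Q` forces `p^{-k Re φ_Q(s)} → 0`. -/
theorem IsCompositionOperator.restrict_re_pos (hT : IsCompositionOperator φ T)
    (hQ : ∀ p ∈ Q, p.Prime) (hne : Q.Nonempty) {s : ℂ} (hs : 0 < s.re) :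
    0 < (φ.restrict Q s).re := by
  obtain ⟨p, hp⟩ := hne
  have hpp := hQ p hp
  have h1 := summable_norm_inner_map_monomial T (kernelVec (Nat.factoredNumbers Q) (1 ^ φ.char) (conj s))
  have hmem : ∀ k : ℕ, p ^ k ∈ Nat.factoredNumbers Q := by
    intro k
    refine Nat.mem_factoredNumbers'.2 fun q hq hqk => ?_
    rwa [(Nat.prime_dvd_prime_iff_eq hq hpp).1 (hq.dvd_of_dvd_pow hqk)]
  have h2 := h1.comp_injective (kernelIndex_injective (S := Nat.factoredNumbers Q)
    ne_zero_of_mem_factored 1)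
  have hinj : Function.Injective (fun k : ℕ => (⟨p ^ k, hmem k⟩ : Nat.factoredNumbers Q)) := by
    intro a b hab
    exact Nat.pow_right_injective hpp.two_le (Subtype.ext_iff.1 hab)
  have h3 := (h2.comp_injective hinj).tendsto_atTop_zero
  by_contra! hcon
  have h4 : ∀ k : ℕ, 1 ≤ ((fun l : ℕ+ => ‖⟪kernelVec (Nat.factoredNumbers Q) (1 ^ φ.char) (conj s),
      T (monomial l)⟫‖ ^ 2) ∘ kernelIndex (Nat.factoredNumbers Q) 1 ∘
      fun k : ℕ => (⟨p ^ k, hmem k⟩ : Nat.factoredNumbers Q)) k := by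
    intro k
    simp only [Function.comp]
    rw [hT.inner_kernelVec_kernelIndex hQ ⟨p, hp⟩ 1 hs]
    simp only [PNat.one_coe, Nat.cast_one, Complex.one_cpow, one_mul]
    rw [norm_sq_natCast_cpow (pow_ne_zero _ hpp.ne_zero)]
    refine Real.one_le_rpow ?_ (by linarith)
    exact_mod_cast Nat.one_le_pow _ _ hpp.pos
  have h5 := ge_of_tendsto' h3 h4
  norm_num at h5

end Pairing

/-! ### Asymptotics of normalised kernel vectors. -/

/-- The lower bound for the essential norm by the action on normalised kernel vectors. -/
theorem le_essentialNorm_of_kernelVec {Q S : Set ℕ} {x₀ RQ R δ : ℝ} {d : ℕ}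
    (hQ : PoleKernel Q 0 d RQ) (hS : PoleKernel S x₀ d R) (T : Hardy →L[ℂ] Hardy) (N n : ℕ+)
    {s a : ℝ → ℂ} (hs : ∀ σ, (s σ).re = σ) (ha : ∀ᶠ σ in 𝓝[>] (0 : ℝ), x₀ < 2 * (a σ).re)
    (hδ : 0 < δ) (hlim : Tendsto (fun σ : ℝ => (2 * (a σ).re - x₀) / σ) (𝓝[>] 0) (𝓝 (2 * δ)))
    {X : ℂ} (hX : Tendsto (fun σ : ℝ =>
      ⟪kernelVec Q N (conj (s σ)), T (kernelVec S n (conj (a σ)))⟫ * (σ : ℂ) ^ d) (𝓝[>] 0) (𝓝 X)) :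
    ‖X‖ / (√(RQ / 2 ^ d) * √(R / (2 * δ) ^ d)) ≤ essentialNorm T := by
  have hRQ := hQ.pos
  have hR := hS.pos
  have hpos : ∀ᶠ σ in 𝓝[>] (0 : ℝ), 0 < σ := self_mem_nhdsWithin
  have hσd : Tendsto (fun σ : ℝ => σ ^ d) (𝓝[>] 0) (𝓝 0) := by
    have h1 : Tendsto (fun σ : ℝ => σ ^ d) (𝓝 0) (𝓝 ((0 : ℝ) ^ d)) :=
      Continuous.tendsto (by fun_prop) 0
    rw [zero_pow (by have := hQ.one_le; omega)] at h1
    exact h1.mono_left nhdsWithin_le_nhds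
  set y : ℝ → Hardy := fun σ => kernelVec Q N (conj (s σ)) with hy
  set f : ℝ → Hardy := fun σ => kernelVec S n (conj (a σ)) with hf
  have hysq : Tendsto (fun σ => ‖y σ‖ ^ 2 * σ ^ d) (𝓝[>] 0) (𝓝 (RQ / 2 ^ d)) := by
    have h1 := (hQ.tendsto_real_path (t := fun σ => 2 * σ) (D := 2) two_pos (by
      refine (tendsto_const_nhds (x := (2 : ℝ))).congr' ?_
      filter_upwards [hpos] with σ hσ
      field_simp
      ring)).norm
    rw [Complex.norm_real, Real.norm_of_nonneg (by positivity)] at h1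
    refine h1.congr' ?_
    filter_upwards [hpos] with σ hσ
    rw [hy, hQ.norm_kernelVec_sq N (by simpa [hs] using hσ), norm_mul, norm_pow, Complex.norm_real,
      Real.norm_of_nonneg hσ.le, Complex.conj_re, hs]
  have hfsq : Tendsto (fun σ => ‖f σ‖ ^ 2 * σ ^ d) (𝓝[>] 0) (𝓝 (R / (2 * δ) ^ d)) := by
    have h1 := (hS.tendsto_real_path (t := fun σ => 2 * (a σ).re) (by positivity) hlim).norm
    rw [Complex.norm_real, Real.norm_of_nonneg (by positivity)] at h1
    refine h1.congr' ?_
    filter_upwards [hpos, ha] with σ hσ haσ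
    rw [hf, hS.norm_kernelVec_sq n (by simpa using haσ), norm_mul, norm_pow, Complex.norm_real,
      Real.norm_of_nonneg hσ.le, Complex.conj_re]
  have hA : 0 < RQ / 2 ^ d := by positivity
  have hB : 0 < R / (2 * δ) ^ d := by positivity
  -- The coordinates of `y σ` have modulus at most `1` while its norm blows up, so the normalised
  -- vectors are weakly null.
  have hynorm : Tendsto (fun σ => ‖y σ‖⁻¹) (𝓝[>] 0) (𝓝 0) := by
    have h1 := (hσd.div hysq hA.ne').sqrt
    rw [zero_div, Real.sqrt_zero] at h1
    refine h1.congr' ?_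
    filter_upwards [hpos] with σ hσ
    simp only [Pi.div_apply]
    rw [div_mul_cancel_right₀ (pow_ne_zero d hσ.ne'), Real.sqrt_inv, Real.sqrt_sq (norm_nonneg _)]
  have hunit : ∀ z : Hardy, ‖((‖z‖⁻¹ : ℝ) : ℂ) • z‖ ≤ 1 := by
    intro z
    rw [norm_smul, Complex.norm_real, Real.norm_of_nonneg (by positivity)]
    exact inv_mul_le_one
  refine le_essentialNorm_of_tendsto (l := 𝓝[>] (0 : ℝ))
    (y := fun σ => if 0 < σ then ((‖y σ‖⁻¹ : ℝ) : ℂ) • y σ else 0)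
    (f := fun σ => ((‖f σ‖⁻¹ : ℝ) : ℂ) • f σ) (fun σ => ?_) (fun σ => hunit _) (fun k => ?_) ?_
  · split_ifs
    · exact hunit _
    · simp
  · refine squeeze_zero_norm' ?_ hynorm
    filter_upwards [hpos] with σ hσ
    rw [if_pos hσ]
    change ‖((‖y σ‖⁻¹ : ℝ) : ℂ) • y σ k‖ ≤ _
    rw [norm_smul, Complex.norm_real, Real.norm_of_nonneg (by positivity)]
    refine mul_le_of_le_one_right (by positivity) ?_
    exact hQ.norm_kernelVec_apply_le N (by simpa [hs] using hσ) (by simpa [hs] using hσ.le) k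
  · have h1 := hX.norm.div (hysq.sqrt.mul hfsq.sqrt)
      (mul_pos (Real.sqrt_pos.2 hA) (Real.sqrt_pos.2 hB)).ne'
    refine h1.congr' ?_
    filter_upwards [hpos] with σ hσ
    rw [if_pos hσ]
    simp only [Pi.div_apply]
    rw [Real.sqrt_mul (by positivity), Real.sqrt_mul (by positivity), Real.sqrt_sq (norm_nonneg _),
      Real.sqrt_sq (norm_nonneg _), map_smul, inner_smul_left, inner_smul_right, norm_mul, norm_mul,
      norm_mul, RCLike.norm_conj, Complex.norm_real, Complex.norm_real, norm_pow, Complex.norm_real,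
      Real.norm_of_nonneg hσ.le, Real.norm_of_nonneg (by positivity : 0 ≤ ‖y σ‖⁻¹),
      Real.norm_of_nonneg (by positivity : 0 ≤ ‖f σ‖⁻¹)]
    have h2 : √(σ ^ d) * √(σ ^ d) = σ ^ d := Real.mul_self_sqrt (by positivity)
    have h4 : ‖y σ‖ * √(σ ^ d) * (‖f σ‖ * √(σ ^ d)) = ‖y σ‖ * ‖f σ‖ * σ ^ d := by
      calc _ = ‖y σ‖ * ‖f σ‖ * (√(σ ^ d) * √(σ ^ d)) := by ring
        _ = _ := by rw [h2]
    rw [h4, mul_div_mul_right _ _ (pow_ne_zero d hσ.ne')]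
    rw [div_eq_mul_inv, mul_inv]
    ring

/-! ### Size of the coefficients at prime powers. -/

theorem Symbol.tendsto_dirichletSum (φ : Symbol) :
    Tendsto (fun x : ℝ => (dirichletSum φ.coeff x).re) atTop (𝓝 (φ.coeff 1).re) := by
  have h1 := LSeries.tendsto_atTop (φ.abscissa_coeff_le.trans_lt (EReal.coe_lt_top _))
  refine ((Complex.continuous_re.tendsto _).comp h1).congr' ?_
  filter_upwards [eventually_gt_atTop (1 : ℝ)] with x hx
  rw [Function.comp, φ.dirichletSum_eq_LSeries (by simpa using hx)]

theorem Symbol.coeff_one_re_nonneg (φ : Symbol) : 0 ≤ (φ.coeff 1).re := by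
  refine ge_of_tendsto φ.tendsto_dirichletSum ?_
  filter_upwards [eventually_gt_atTop (0 : ℝ)] with x hx
  have hx' : 0 < (x : ℂ).re := by simpa using hx
  rcases Nat.eq_zero_or_pos φ.char with h | h
  · linarith [φ.maps_zero h x hx']
  · rcases φ.maps_pos h with ⟨h3, h4⟩ | h3
    · rw [h4 x hx']; exact h3
    · exact (h3 x hx').le

theorem Symbol.coeff_one_re_pos_of_char_zero (φ : Symbol) (h : φ.char = 0) :
    0 < (φ.coeff 1).re := by
  have : 1 / 2 ≤ (φ.coeff 1).re := by
    refine ge_of_tendsto φ.tendsto_dirichletSum ?_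
    filter_upwards [eventually_gt_atTop (0 : ℝ)] with x hx
    exact (φ.maps_zero h x (by simpa using hx)).le
  linarith

theorem norm_exp_neg_log_mul (n : ℕ) (z : ℂ) (hn : n ≠ 0) :
    ‖Complex.exp (-(Complex.log n * z))‖ = (n : ℝ) ^ (-z.re) := by
  rw [← norm_natCast_cpow_neg hn, Complex.cpow_def_of_ne_zero (by exact_mod_cast hn)]
  congr 2
  ring

/-- At `p^{c₀+j}` the recursion expresses the coefficient through those at `p^{c₀+j-i}`, `1 ≤ i ≤
j`. The start `p^{-c₁}` has modulus `p^{-Re c₁}`, and each step costs only an arbitrarily small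
power of `p`, uniformly in the prime. -/
theorem IsCompositionOperator.norm_coeff_prime_pow_le {φ : Symbol} {T : Hardy →L[ℂ] Hardy}
    (hT : IsCompositionOperator φ T) (j : ℕ) : ∀ η : ℝ, 0 < η → ∃ C : ℝ, 0 ≤ C ∧
      ∀ p : ℕ+, (p : ℕ).Prime → ‖(T (monomial p)).coeff ((p : ℕ) ^ (φ.char + j))‖ ≤
        C * ((p : ℕ) : ℝ) ^ (η - (φ.coeff 1).re) := by
  induction j using Nat.strong_induction_on with
  | _ j ih =>
    intro η hη
    rcases Nat.eq_zero_or_pos j with rfl | hj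
    · refine ⟨1, zero_le_one, fun p hp => ?_⟩
      rw [add_zero, hT.coeff_pow, norm_exp_neg_log_mul _ _ hp.ne_zero, one_mul]
      exact Real.rpow_le_rpow_of_exponent_le (by exact_mod_cast hp.one_lt.le) (by linarith)
    -- Three losses occur: `p^ε` from `log p`, `p^{iε}` from `c_{p^i}`, and `p^ε` from the induction
    -- hypothesis. Together they are at most `p^{(j+2)ε}`.
    set ε := η / (j + 2) with hε
    have hεpos : 0 < ε := by positivity
    obtain ⟨B, hB0, hB⟩ := φ.norm_coeff_le hεpos
    choose! D hD0 hD using fun i (hi : i < j) => ih i hi ε hεpos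
    refine ⟨∑ i ∈ Finset.Icc 1 j, (i / ε) * B * D (j - i), Finset.sum_nonneg fun i hi => ?_,
      fun p hp => ?_⟩
    · obtain ⟨h1, h2⟩ := Finset.mem_Icc.1 hi
      have := hD0 (j - i) (by omega)
      positivity
    have hp0 : ((p : ℕ) : ℝ) ≠ 0 := by exact_mod_cast hp.ne_zero
    have hp1 : (1 : ℝ) ≤ ((p : ℕ) : ℝ) := by exact_mod_cast hp.one_lt.le
    have hppos : (0 : ℝ) < ((p : ℕ) : ℝ) := by linarith
    have hlogpos : 0 < Real.log p := Real.log_pos (by exact_mod_cast hp.one_lt)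
    set g := (T (monomial p)).coeff with hg
    have hrec := hT.coeff_recursion p (k := (p : ℕ) ^ (φ.char + j)) (pow_ne_zero _ hp.ne_zero)
    rw [Nat.sum_divisorsAntidiagonal (f := fun a b => (Complex.log a * φ.coeff a) * g b),
      Nat.sum_divisors_prime_pow hp, natCast_log_pow] at hrec
    have hterm : ∀ i ∈ Finset.range (φ.char + j + 1), i ∉ Finset.Icc 1 j →
        Complex.log ((p : ℕ) ^ i : ℕ) * φ.coeff ((p : ℕ) ^ i) *
          g ((p : ℕ) ^ (φ.char + j) / (p : ℕ) ^ i) = 0 := by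
      intro i hi hi2
      have hi := Finset.mem_range.1 hi
      rcases Nat.eq_zero_or_pos i with rfl | hipos
      · simp
      have hij : j < i := by
        by_contra! h
        exact hi2 (Finset.mem_Icc.2 ⟨hipos, h⟩)
      refine mul_eq_zero_of_right _ ?_
      by_contra hne
      have hdvd := hT.pow_dvd_of_coeff_ne_zero p hne
      rw [Nat.pow_div (by omega) hp.pos, Nat.pow_dvd_pow_iff_le_right hp.one_lt] at hdvd
      omega
    have hsub : Finset.Icc 1 j ⊆ Finset.range (φ.char + j + 1) := by
      intro i hi
      have := Finset.mem_Icc.1 hi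
      exact Finset.mem_range.2 (by omega)
    rw [← Finset.sum_subset hsub hterm] at hrec
    have hlogne : Complex.log (p : ℕ) ≠ 0 := by
      rw [← Complex.natCast_log]
      exact_mod_cast hlogpos.ne'
    have hg2 : (j : ℂ) * g ((p : ℕ) ^ (φ.char + j)) = -∑ i ∈ Finset.Icc 1 j,
        Complex.log ((p : ℕ) ^ i : ℕ) * φ.coeff ((p : ℕ) ^ i) *
          g ((p : ℕ) ^ (φ.char + j) / (p : ℕ) ^ i) := by
      apply mul_left_cancel₀ hlogne
      rw [mul_neg, ← hrec]
      push_cast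
      ring
    have hle1 : ‖g ((p : ℕ) ^ (φ.char + j))‖ ≤ ‖(j : ℂ) * g ((p : ℕ) ^ (φ.char + j))‖ := by
      rw [norm_mul, Complex.norm_natCast]
      exact le_mul_of_one_le_left (norm_nonneg _) (by exact_mod_cast hj)
    refine hle1.trans ?_
    rw [hg2, norm_neg, Finset.sum_mul]
    refine norm_sum_le_of_le _ fun i hi => ?_
    obtain ⟨hi1, hi2⟩ := Finset.mem_Icc.1 hi
    rw [Nat.pow_div (by omega) hp.pos, show φ.char + j - i = φ.char + (j - i) by omega, norm_mul,
      norm_mul, natCast_log_pow, norm_mul, Complex.norm_natCast, ← Complex.natCast_log,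
      Complex.norm_real, Real.norm_of_nonneg hlogpos.le]
    have e1 : Real.log p ≤ ((p : ℕ) : ℝ) ^ ε / ε := Real.log_le_rpow_div hppos.le hεpos
    have e2 : ‖φ.coeff ((p : ℕ) ^ i)‖ ≤ B * ((p : ℕ) : ℝ) ^ (i * ε) := by
      refine (hB _ (pow_ne_zero _ hp.ne_zero)).trans_eq ?_
      rw [Nat.cast_pow, ← Real.rpow_natCast, ← Real.rpow_mul hppos.le]
    have e3 := hD (j - i) (by omega) p hp
    have hDn := hD0 (j - i) (by omega)
    calc (i : ℝ) * Real.log p * ‖φ.coeff ((p : ℕ) ^ i)‖ * ‖g ((p : ℕ) ^ (φ.char + (j - i)))‖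
        ≤ (i : ℝ) * (((p : ℕ) : ℝ) ^ ε / ε) * (B * ((p : ℕ) : ℝ) ^ (i * ε)) *
          (D (j - i) * ((p : ℕ) : ℝ) ^ (ε - (φ.coeff 1).re)) := by gcongr
      _ = (i / ε) * B * D (j - i) * ((p : ℕ) : ℝ) ^ (ε + i * ε + (ε - (φ.coeff 1).re)) := by
          rw [Real.rpow_add hppos, Real.rpow_add hppos]; ring
      _ ≤ (i / ε) * B * D (j - i) * ((p : ℕ) : ℝ) ^ (η - (φ.coeff 1).re) := by
          have h1 : η = (j + 2) * ε := by rw [hε]; field_simp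
          have h2 : (i : ℝ) * ε ≤ j * ε := by gcongr
          gcongr
          rw [h1]; linarith

theorem IsCompositionOperator.exists_prime_coeff_small {φ : Symbol} {T : Hardy →L[ℂ] Hardy}
    (hT : IsCompositionOperator φ T) (hre : 0 < (φ.coeff 1).re) {K : ℕ} (hK : φ.char ≤ K)
    {ε : ℝ} (hε : 0 < ε) (A : ℕ) : ∃ p : ℕ+, A ≤ p ∧ (p : ℕ).Prime ∧
      ‖(T (monomial p)).coeff ((p : ℕ) ^ K)‖ ≤ ε := by
  obtain ⟨j, rfl⟩ := Nat.exists_eq_add_of_le hK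
  set r := (φ.coeff 1).re with hr
  obtain ⟨C, hC0, hC⟩ := hT.norm_coeff_prime_pow_le j (r / 2) (by positivity)
  have h1 : Tendsto (fun n : ℕ => C * (n : ℝ) ^ (-(r / 2))) atTop (𝓝 (C * 0)) :=
    ((tendsto_rpow_neg_atTop (by positivity)).comp tendsto_natCast_atTop_atTop).const_mul C
  rw [mul_zero] at h1
  obtain ⟨A', hA'⟩ := eventually_atTop.1 (h1.eventually_lt_const hε)
  obtain ⟨p, hpA, hp⟩ := Nat.exists_infinite_primes (max A A')
  refine ⟨⟨p, hp.pos⟩, (le_max_left _ _).trans hpA, hp, (hC ⟨p, hp.pos⟩ hp).trans ?_⟩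
  have h2 := hA' p ((le_max_right _ _).trans hpA)
  rw [PNat.mk_coe, show r / 2 - r = -(r / 2) by ring]
  exact h2.le

/-! ### Separation of the values `n^{iτ}` from `1`. -/

/-- For a unimodular `w` with `|1 - w| < 1` one has `Re w > 1/2`, so squaring multiplies the
distance to `1` by `|1 + w| ≥ 3/2`; repeated squaring would leave the disc. -/
theorem eq_one_of_forall_norm_one_sub_pow_lt {z : ℂ} (hz : ‖z‖ = 1)
    (h : ∀ j : ℕ, ‖1 - z ^ (j + 1)‖ < 1) : z = 1 := by
  by_contra hne
  have hpos : 0 < ‖1 - z‖ := norm_pos_iff.2 (sub_ne_zero.2 (Ne.symm hne))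
  have hstep : ∀ k : ℕ, (3 / 2 : ℝ) ^ k * ‖1 - z‖ ≤ ‖1 - z ^ 2 ^ k‖ := by
    intro k
    induction k with
    | zero => simp
    | succ k ih =>
      set w := z ^ 2 ^ k with hw
      have hw1 : ‖w‖ = 1 := by rw [hw, norm_pow, hz, one_pow]
      have hlt : ‖1 - w‖ < 1 := by
        have := h (2 ^ k - 1)
        rwa [Nat.sub_add_cancel Nat.one_le_two_pow] at this
      have h1 : z ^ 2 ^ (k + 1) = w ^ 2 := by rw [hw, ← pow_mul, pow_succ]
      have h2 : 1 - w ^ 2 = (1 + w) * (1 - w) := by ring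
      have h3 : (3 / 2 : ℝ) ≤ ‖1 + w‖ := by
        have e1 : ‖1 - w‖ ^ 2 = 2 - 2 * w.re := by
          rw [← Complex.normSq_eq_norm_sq, Complex.normSq_apply]
          have : w.re * w.re + w.im * w.im = 1 := by
            rw [← Complex.normSq_apply, Complex.normSq_eq_norm_sq, hw1]; norm_num
          simp only [Complex.sub_re, Complex.sub_im, Complex.one_re, Complex.one_im]
          linarith
        have e2 : 1 / 2 ≤ w.re := by nlinarith [norm_nonneg (1 - w)]
        have e3 := Complex.re_le_norm (1 + w)
        simp only [Complex.add_re, Complex.one_re] at e3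
        linarith
      rw [h1, h2, norm_mul, pow_succ]
      nlinarith [norm_nonneg (1 - w)]
  obtain ⟨k, hk⟩ := pow_unbounded_of_one_lt (1 / ‖1 - z‖) (by norm_num : (1 : ℝ) < 3 / 2)
  rw [div_lt_iff₀ hpos] at hk
  have h1 := h (2 ^ k - 1)
  rw [Nat.sub_add_cancel Nat.one_le_two_pow] at h1
  linarith [hstep k]

theorem exp_log_mul_pow (n j : ℕ) (τ : ℝ) :
    Complex.exp (Complex.log ((n ^ j : ℕ) : ℂ) * (τ * Complex.I)) =
      Complex.exp (Complex.log n * (τ * Complex.I)) ^ j := by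
  rw [natCast_log_pow, ← Complex.exp_nat_mul]
  congr 1
  ring

/-- Among the integers `n ≡ 1` modulo `P`, the values `n^{iτ}` do not stay close to `1`. -/
theorem exists_norm_one_sub_exp_ge {P : ℕ} (hP : 0 < P) {τ : ℝ} (hτ : τ ≠ 0) (A : ℕ) :
    ∃ n : ℕ, A ≤ n ∧ n ≡ 1 [MOD P] ∧
      1 ≤ ‖1 - Complex.exp (Complex.log n * (τ * Complex.I))‖ := by
  by_contra! hcon
  -- The powers of `n` lie in the same residue class, so closeness to `1` along the class upgrades
  -- to equality.
  have hone : ∀ n : ℕ, A ≤ n → 0 < n → n ≡ 1 [MOD P] →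
      Complex.exp (Complex.log n * (τ * Complex.I)) = 1 := by
    intro n hn hn0 hmod
    refine eq_one_of_forall_norm_one_sub_pow_lt ?_ fun j => ?_
    · rw [← Complex.natCast_log, ← mul_assoc, ← Complex.ofReal_mul]
      exact Complex.norm_exp_ofReal_mul_I _
    · rw [← exp_log_mul_pow]
      exact hcon _ (hn.trans (Nat.le_self_pow (by omega) n)) (by simpa using hmod.pow (j + 1))
  obtain ⟨k, hk⟩ := exists_nat_gt (max (A : ℝ) (|τ| * P))
  have hkA : (A : ℝ) < k := (le_max_left _ _).trans_lt hk
  have hkτ : |τ| * P < k := (le_max_right _ _).trans_lt hk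
  have hkA' : A < k := by exact_mod_cast hkA
  have hn : ∀ i : ℕ, 1 + P * i ≡ 1 [MOD P] := fun i => by
    simp [Nat.ModEq]
  -- Neighbouring members `a`, `a + P` of the class: `τ log((a + P)/a)` is nonzero, yet of modulus
  -- less than `1` by the choice of `k`, so it is not a multiple of `2π`.
  set a := 1 + P * k with ha
  set b := 1 + P * (k + 1) with hb
  have hka : k ≤ a := by rw [ha]; nlinarith
  have h1 := hone a (by omega) (by omega) (hn k)
  have h2 := hone b (by rw [hb]; nlinarith) (by omega) (hn (k + 1))
  have hapos : (0 : ℝ) < a := by rw [ha]; positivity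
  have hbpos : (0 : ℝ) < b := by rw [hb]; positivity
  have hba : (b : ℝ) = a + P := by rw [ha, hb]; push_cast; ring
  have hPpos : (0 : ℝ) < P := by exact_mod_cast hP
  set x := Real.log b - Real.log a with hx
  have hx0 : 0 < x := sub_pos.2 (Real.log_lt_log hapos (by linarith))
  have hxle : x ≤ P / a := by
    rw [hx, ← Real.log_div hbpos.ne' hapos.ne']
    refine (Real.log_le_sub_one_of_pos (by positivity)).trans_eq ?_
    rw [hba]
    field_simp
    ring
  have h3 : Complex.exp ((x * τ : ℝ) * Complex.I) = 1 := by
    have : ((x * τ : ℝ) : ℂ) * Complex.I =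
        Complex.log b * (τ * Complex.I) - Complex.log a * (τ * Complex.I) := by
      rw [hx, ← Complex.natCast_log, ← Complex.natCast_log]
      push_cast
      ring
    rw [this, Complex.exp_sub, h1, h2, div_one]
  obtain ⟨n, hn⟩ := Complex.exp_eq_one_iff.1 h3
  have h4 : x * τ = n * (2 * Real.pi) := by
    have h5 : ((x * τ : ℝ) : ℂ) * Complex.I = ((n * (2 * Real.pi) : ℝ) : ℂ) * Complex.I := by
      rw [hn]; push_cast; ring
    exact_mod_cast mul_right_cancel₀ Complex.I_ne_zero h5
  have hne : n ≠ 0 := by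
    rintro rfl
    simp only [Int.cast_zero, zero_mul, mul_eq_zero] at h4
    exact h4.elim hx0.ne' hτ
  have h5 : |x * τ| < 1 := by
    rw [abs_mul, abs_of_pos hx0]
    have hka' : (k : ℝ) ≤ a := by exact_mod_cast hka
    calc x * |τ| ≤ P / a * |τ| := by gcongr
      _ = (|τ| * P) / a := by ring
      _ < 1 := by rw [div_lt_one hapos]; linarith
  have h6 : (1 : ℝ) ≤ |(n : ℝ)| := by exact_mod_cast Int.one_le_abs hne
  rw [h4, abs_mul, abs_of_pos (by positivity : (0 : ℝ) < 2 * Real.pi)] at h5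
  nlinarith [Real.pi_gt_three]

/-! ### Monomials as test vectors. -/

theorem monomial_apply (l k : ℕ+) : monomial l k = if k = l then 1 else 0 := by
  by_cases h : k = l
  · subst h; simp [monomial]
  · simp [monomial, h]

theorem inner_monomial (l : ℕ+) (g : Hardy) : ⟪monomial l, g⟫ = g.coeff l := by
  rw [monomial, lp.inner_single_left, Hardy.coeff_coe]
  simp

theorem norm_monomial (l : ℕ+) : ‖monomial l‖ = 1 := by
  rw [monomial, lp.norm_single (by norm_num), norm_one]

theorem le_essentialNorm_of_coeff (T : Hardy →L[ℂ] Hardy) {K : ℕ} (hK : K ≠ 0) {B : ℝ}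
    (hB : ∀ ε : ℝ, 0 < ε → ∀ A : ℕ, ∃ n : ℕ+, A ≤ n ∧
      B - ε ≤ ‖(T (monomial n)).coeff ((n : ℕ) ^ K)‖) : B ≤ essentialNorm T := by
  refine le_essentialNorm_of_frequently (l := atTop) (y := fun n : ℕ+ => monomial (n ^ K))
    (f := fun n => monomial n) (fun n => (norm_monomial _).le) (fun n => (norm_monomial _).le)
    (fun k => ?_) (fun ε hε => ?_)
  · refine tendsto_const_nhds.congr' ?_
    filter_upwards [eventually_gt_atTop k] with n hn
    rw [monomial_apply, if_neg]
    intro h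
    have h1 : (k : ℕ) = (n : ℕ) ^ K := by rw [h, PNat.pow_coe]
    have h2 : (n : ℕ) ≤ (n : ℕ) ^ K := Nat.le_self_pow hK _
    have h3 : (k : ℕ) < n := hn
    omega
  · refine frequently_atTop.2 fun a => ?_
    obtain ⟨n, hn, h⟩ := hB ε hε a
    refine ⟨n, hn, ?_⟩
    rw [inner_monomial, PNat.pow_coe]
    exact h

/-! ### Rays to the boundary point and lower bounds along them. -/

/-- A ray with vertex at the boundary point `iα`. -/
def ray (α M : ℝ) (σ : ℝ) : ℂ := α * Complex.I + σ * (1 + M * Complex.I)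

theorem ray_re (α M σ : ℝ) : (ray α M σ).re = σ := by simp [ray]

theorem tendsto_ray (α M : ℝ) : Tendsto (ray α M) (𝓝[>] 0)
    (𝓝[sector α ‖1 + M * Complex.I‖] (α * Complex.I)) := by
  refine tendsto_nhdsWithin_iff.2 ⟨?_, ?_⟩
  · have h : Tendsto (ray α M) (𝓝 0) (𝓝 (ray α M 0)) := by
      refine Continuous.tendsto ?_ 0
      unfold ray
      fun_prop
    have h0 : ray α M 0 = α * Complex.I := by simp [ray]
    rw [h0] at h
    exact h.mono_left nhdsWithin_le_nhds
  · filter_upwards [self_mem_nhdsWithin] with σ hσ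
    have hσ : 0 < σ := hσ
    refine ⟨by rwa [ray_re], ?_⟩
    rw [ray_re, ray, add_sub_cancel_left, norm_mul, Complex.norm_real, Real.norm_of_nonneg hσ.le,
      mul_comm]

theorem AngularQuotient.tendsto_ray {g : ℂ → ℂ} {α : ℝ} {v : ℂ} {δ : ℝ}
    (h : AngularQuotient g α v δ) (M : ℝ) :
    Tendsto (fun σ : ℝ => (g (ray α M σ) - v) / σ) (𝓝[>] 0) (𝓝 (δ * (1 + M * Complex.I))) := by
  refine (((h _).comp (DirichletComposition.tendsto_ray α M)).mul_const (1 + M * Complex.I)).congr' ?_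
  have hne : (1 + M * Complex.I : ℂ) ≠ 0 := by
    intro h
    have := congrArg Complex.re h
    simp at this
  filter_upwards [self_mem_nhdsWithin] with σ hσ
  have hσ : (σ : ℂ) ≠ 0 := by exact_mod_cast (ne_of_gt hσ)
  simp only [Function.comp]
  have : ray α M σ - α * Complex.I = σ * (1 + M * Complex.I) := by rw [ray]; ring
  rw [this]
  field_simp

theorem AngularQuotient.tendsto_ray_re {g : ℂ → ℂ} {α : ℝ} {v : ℂ} {δ x₀ : ℝ}
    (h : AngularQuotient g α v δ) (hv : 2 * v.re = x₀) (M : ℝ) :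
    Tendsto (fun σ : ℝ => (2 * (g (ray α M σ)).re - x₀) / σ) (𝓝[>] 0) (𝓝 (2 * δ)) := by
  have h1 := ((Complex.continuous_re.tendsto _).comp (h.tendsto_ray M)).const_mul 2
  have h2 : ((δ : ℂ) * (1 + M * Complex.I)).re = δ := by simp
  rw [h2] at h1
  refine h1.congr fun σ => ?_
  simp only [Function.comp]
  rw [Complex.div_ofReal_re, Complex.sub_re, ← hv]
  ring

theorem AngularQuotient.tendsto_ray_conj_add {g₀ g₁ : ℂ → ℂ} {α : ℝ} {v₀ v₁ : ℂ} {δ₀ δ₁ : ℝ}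
    (h₀ : AngularQuotient g₀ α v₀ δ₀) (h₁ : AngularQuotient g₁ α v₁ δ₁) (M : ℝ) :
    Tendsto (fun σ : ℝ => (conj (g₀ (ray α M σ)) + g₁ (ray α M σ) - (conj v₀ + v₁)) / σ) (𝓝[>] 0)
      (𝓝 ((δ₀ + δ₁ : ℝ) + (M * (δ₁ - δ₀) : ℝ) * Complex.I)) := by
  have h1 := ((Complex.continuous_conj.tendsto _).comp (h₀.tendsto_ray M)).add (h₁.tendsto_ray M)
  have h2 : conj ((δ₀ : ℂ) * (1 + M * Complex.I)) + δ₁ * (1 + M * Complex.I) =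
      (δ₀ + δ₁ : ℝ) + (M * (δ₁ - δ₀) : ℝ) * Complex.I := by
    simp only [map_mul, map_add, map_one, Complex.conj_ofReal, Complex.conj_I]
    push_cast
    ring
  rw [h2] at h1
  refine h1.congr fun σ => ?_
  simp only [Function.comp, map_div₀, map_sub, Complex.conj_ofReal]
  ring

theorem eventually_le_of_not_hasFiniteAngularDerivative {θ α : ℝ} {g : ℂ → ℂ}
    (h : ¬ HasFiniteAngularDerivative θ g α) (M B : ℝ) :
    ∀ᶠ σ in 𝓝[>] (0 : ℝ), B * σ ≤ (g (ray α M σ)).re - θ := by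
  have h1 : (B : EReal) < liminf (fun s : ℂ => ((((g s).re - θ) / s.re : ℝ) : EReal))
      (𝓝[{s : ℂ | 0 < s.re}] (α * Complex.I)) := by
    rw [HasFiniteAngularDerivative, not_lt, top_le_iff] at h
    rw [h]
    exact EReal.coe_lt_top _
  have h2 := eventually_lt_of_lt_liminf h1
  have h3 : Tendsto (ray α M) (𝓝[>] 0) (𝓝[{s : ℂ | 0 < s.re}] (α * Complex.I)) :=
    (tendsto_ray α M).mono_right (nhdsWithin_mono _ fun s hs => hs.1)
  filter_upwards [h3.eventually h2, self_mem_nhdsWithin] with σ h4 h5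
  have h5 : 0 < σ := h5
  rw [ray_re] at h4
  have h6 : B < ((g (ray α M σ)).re - θ) / σ := by exact_mod_cast h4
  rw [lt_div_iff₀ h5] at h6
  exact h6.le

/-- The diagonal entry has the size of `‖f‖²`; after division by `‖y‖ ‖f‖` the ratio `‖f‖ / ‖y‖`
remains, which is the right-hand side. -/
theorem div_sqrt_mul_sqrt_eq {R R' δ : ℝ} (hR : 0 < R) (hR' : 0 < R') (hδ : 0 < δ) (d : ℕ) :
    (R / (2 * δ) ^ d) / (√(R' / 2 ^ d) * √(R / (2 * δ) ^ d)) = √(R / R') / δ ^ ((d : ℝ) / 2) := by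
  have h1 : 0 < R / (2 * δ) ^ d := by positivity
  have h2 : δ ^ ((d : ℝ) / 2) = √(δ ^ d) := by
    rw [Real.sqrt_eq_rpow, ← Real.rpow_natCast, ← Real.rpow_mul hδ.le]
    congr 1
    ring
  rw [h2, ← Real.sqrt_div (by positivity), mul_comm (√_), ← div_div, Real.div_sqrt,
    ← Real.sqrt_div h1.le]
  congr 1
  rw [mul_pow]
  field_simp

theorem essentialNorm_sub_comm (T T' : Hardy →L[ℂ] Hardy) :
    essentialNorm (T - T') = essentialNorm (T' - T) := by
  have key : ∀ A B : Hardy →L[ℂ] Hardy, essentialNorm (A - B) ≤ essentialNorm (B - A) := by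
    intro A B
    have : Nonempty {K : Hardy →L[ℂ] Hardy // IsCompactOperator K} :=
      ⟨⟨0, isCompactOperator_zero⟩⟩
    refine le_ciInf fun K => ?_
    have h := ciInf_le (f := fun K : {K : Hardy →L[ℂ] Hardy // IsCompactOperator K} => ‖A - B - K‖)
      ⟨0, by rintro _ ⟨K, rfl⟩; exact norm_nonneg _⟩ ⟨-K.1, K.2.neg⟩
    refine h.trans_eq ?_
    rw [← norm_neg]
    congr 1
    rw [sub_neg_eq_add]
    abel
  exact le_antisymm (key _ _) (key _ _)

/-- The lower bound for the essential norm of a difference, along a ray. -/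
theorem le_essentialNorm_sub {Q S : Set ℕ} {x₀ RQ R δ : ℝ} {d : ℕ}
    (hQ : PoleKernel Q 0 d RQ) (hS : PoleKernel S x₀ d R) (T₀ T₁ : Hardy →L[ℂ] Hardy) (N n : ℕ+)
    {α : ℝ} (M : ℝ) {g : ℂ → ℂ} {v : ℂ} (hq : AngularQuotient g α v δ) (hδ : 0 < δ)
    (hv : 2 * v.re = x₀) (hg : ∀ s : ℂ, 0 < s.re → x₀ < 2 * (g s).re) {A : ℝ → ℂ} {ω μ : ℂ}
    (hA : Tendsto A (𝓝[>] 0) (𝓝 ω))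
    (h₀ : ∀ σ, 0 < σ → ⟪kernelVec Q N (conj (ray α M σ)),
      T₀ (kernelVec S n (conj (g (ray α M σ))))⟫ =
        A σ * kernelSum S (conj (g (ray α M σ)) + g (ray α M σ)))
    (h₁ : Tendsto (fun σ : ℝ => ⟪kernelVec Q N (conj (ray α M σ)),
      T₁ (kernelVec S n (conj (g (ray α M σ))))⟫ * (σ : ℂ) ^ d) (𝓝[>] 0)
        (𝓝 ((R / (2 * δ) ^ d : ℝ) * μ))) :
    √(R / RQ) / δ ^ ((d : ℝ) / 2) * ‖ω - μ‖ ≤ essentialNorm (T₀ - T₁) := by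
  have hR := hS.pos
  have hlim := hq.tendsto_ray_re hv M
  have hk := hS.tendsto_real_path (t := fun σ => 2 * (g (ray α M σ)).re)
    (by positivity : 0 < 2 * δ) hlim
  have hX := (hA.mul hk).sub h₁
  have h := le_essentialNorm_of_kernelVec hQ hS (T₀ - T₁) N n (s := ray α M)
    (a := fun σ => g (ray α M σ)) (ray_re α M) (by
      filter_upwards [self_mem_nhdsWithin] with σ hσ
      exact hg _ (by rw [ray_re]; exact hσ)) hδ hlim (hX.congr' (by
      filter_upwards [self_mem_nhdsWithin] with σ hσ
      rw [sub_apply, inner_sub_right, h₀ σ hσ, sub_mul]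
      rw [← mul_assoc, add_comm (conj _), Complex.add_conj]))
  refine le_trans (le_of_eq ?_) h
  have h2 : ω * ((R / (2 * δ) ^ d : ℝ) : ℂ) - ((R / (2 * δ) ^ d : ℝ) : ℂ) * μ =
      ((R / (2 * δ) ^ d : ℝ) : ℂ) * (ω - μ) := by ring
  rw [h2, norm_mul, Complex.norm_real, Real.norm_of_nonneg (by positivity),
    ← div_sqrt_mul_sqrt_eq hR hQ.pos hδ]
  ring

/-- If both maps have angular derivatives at `iα`, and either the kernel has no pole at the
relevant boundary value or the derivatives differ, then the full lower bound holds. -/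
theorem le_essentialNorm_sub_of_data {Q S : Set ℕ} {x₀ RQ R δ₀ δ₁ : ℝ} {d : ℕ}
    (hQ : PoleKernel Q 0 d RQ) (hS : PoleKernel S x₀ d R) (T₀ T₁ : Hardy →L[ℂ] Hardy) {α : ℝ}
    {g₀ g₁ : ℂ → ℂ} {v₀ v₁ : ℂ} (hq₀ : AngularQuotient g₀ α v₀ δ₀)
    (hq₁ : AngularQuotient g₁ α v₁ δ₁) (hδ₀ : 0 < δ₀) (hδ₁ : 0 < δ₁)
    (hv₀ : 2 * v₀.re = x₀) (hg₀ : ∀ s : ℂ, 0 < s.re → x₀ < 2 * (g₀ s).re)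
    (hg₁ : ∀ s : ℂ, 0 < s.re → x₀ < 2 * (g₁ s).re)
    (h₀ : ∀ s : ℂ, 0 < s.re → ⟪kernelVec Q 1 (conj s), T₀ (kernelVec S 1 (conj (g₀ s)))⟫ =
        kernelSum S (conj (g₀ s) + g₀ s))
    (h₁ : ∀ s : ℂ, 0 < s.re → ⟪kernelVec Q 1 (conj s), T₁ (kernelVec S 1 (conj (g₀ s)))⟫ =
        kernelSum S (conj (g₀ s) + g₁ s))
    {ε : ℂ} (hε : ‖ε‖ ≤ 1)
    (hpole : Tendsto (fun w : ℂ => (w - (conj v₀ + v₁)) ^ d * kernelSum S w)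
      (𝓝[{w | x₀ < w.re}] (conj v₀ + v₁)) (𝓝 (R * ε)))
    (hcase : ε = 0 ∨ δ₁ ≠ δ₀) :
    √(R / RQ) / δ₀ ^ ((d : ℝ) / 2) ≤ essentialNorm (T₀ - T₁) := by
  set b := √(R / RQ) / δ₀ ^ ((d : ℝ) / 2) with hb
  have hbnn : 0 ≤ b := by positivity
  -- On the ray of slope `M`, `conj g₀ + g₁` leaves its boundary value with velocity `δ₀ + δ₁ +
  -- iM(δ₁ - δ₀)`, against `2δ₀` for the diagonal entry.
  have hmain : ∀ M : ℝ, b * ‖1 - ε * (2 * δ₀ /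
      ((δ₀ + δ₁ : ℝ) + (M * (δ₁ - δ₀) : ℝ) * Complex.I)) ^ d‖ ≤ essentialNorm (T₀ - T₁) := by
    intro M
    set D : ℂ := (δ₀ + δ₁ : ℝ) + (M * (δ₁ - δ₀) : ℝ) * Complex.I with hD
    have hDne : D ≠ 0 := by
      intro h
      have := congrArg Complex.re h
      rw [hD, Complex.add_re, Complex.ofReal_re, Complex.re_ofReal_mul, Complex.I_re, mul_zero,
        add_zero, Complex.zero_re] at this
      linarith
    refine le_essentialNorm_sub hQ hS T₀ T₁ 1 1 M hq₀ hδ₀ hv₀ hg₀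
      (A := fun _ => 1) tendsto_const_nhds (fun σ hσ => ?_) ?_
    · rw [h₀ _ (by rw [ray_re]; exact hσ), one_mul]
    · have h2 := PoleKernel.tendsto_of_path (S := S) (x₀ := x₀) (d := d) hpole
        (w := fun σ => conj (g₀ (ray α M σ)) + g₁ (ray α M σ)) (by
          filter_upwards [self_mem_nhdsWithin] with σ hσ
          have e1 := hg₀ (ray α M σ) (by rw [ray_re]; exact hσ)
          have e2 := hg₁ (ray α M σ) (by rw [ray_re]; exact hσ)
          rw [Complex.add_re, Complex.conj_re]
          linarith) hDne (hq₀.tendsto_ray_conj_add hq₁ M)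
      have h3 : (R : ℂ) * ε / D ^ d = ((R / (2 * δ₀) ^ d : ℝ) : ℂ) * (ε * (2 * δ₀ / D) ^ d) := by
        have : (δ₀ : ℂ) ≠ 0 := by exact_mod_cast hδ₀.ne'
        push_cast
        rw [div_pow]
        field_simp
      rw [h3] at h2
      refine h2.congr' ?_
      filter_upwards [self_mem_nhdsWithin] with σ hσ
      rw [h₁ _ (by rw [ray_re]; exact hσ)]
  rcases hcase with h | h
  · have := hmain 0
    rw [h, zero_mul, sub_zero, norm_one, mul_one] at this
    exact this
  · have hdiff : 0 < |δ₁ - δ₀| := abs_pos.2 (sub_ne_zero.2 h)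
    have hlim : Tendsto (fun M : ℝ => b * (1 - 2 * δ₀ / (M * |δ₁ - δ₀|))) atTop
        (𝓝 (b * (1 - 0))) := by
      refine ((tendsto_const_nhds (x := (1 : ℝ))).sub ?_).const_mul b
      exact tendsto_const_nhds.div_atTop (tendsto_id.atTop_mul_const hdiff)
    rw [sub_zero, mul_one] at hlim
    refine le_of_tendsto hlim ?_
    filter_upwards [eventually_ge_atTop (2 * δ₀ / |δ₁ - δ₀|), eventually_gt_atTop (0 : ℝ)]
      with M hM hM0
    refine le_trans (mul_le_mul_of_nonneg_left ?_ hbnn) (hmain M)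
    set D : ℂ := (δ₀ + δ₁ : ℝ) + (M * (δ₁ - δ₀) : ℝ) * Complex.I with hD
    have hDle : M * |δ₁ - δ₀| ≤ ‖D‖ := by
      have := Complex.abs_im_le_norm D
      rw [hD, Complex.add_im, Complex.ofReal_im, Complex.im_ofReal_mul, Complex.I_im, zero_add,
        mul_one, abs_mul, abs_of_pos hM0] at this
      exact this
    have hMpos : 0 < M * |δ₁ - δ₀| := mul_pos hM0 hdiff
    have hq : ‖(2 * δ₀ / D : ℂ)‖ ≤ 2 * δ₀ / (M * |δ₁ - δ₀|) := by
      rw [norm_div, norm_mul, Complex.norm_real, Real.norm_of_nonneg hδ₀.le, Complex.norm_ofNat]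
      gcongr
    have hq1 : ‖(2 * δ₀ / D : ℂ)‖ ≤ 1 := by
      refine hq.trans ?_
      rw [div_le_one hMpos]
      rwa [div_le_iff₀ hdiff] at hM
    have hμ : ‖ε * (2 * δ₀ / D) ^ d‖ ≤ 2 * δ₀ / (M * |δ₁ - δ₀|) := by
      rw [norm_mul, norm_pow]
      calc ‖ε‖ * ‖(2 * δ₀ / D : ℂ)‖ ^ d ≤ 1 * ‖(2 * δ₀ / D : ℂ)‖ ^ d := by gcongr
        _ ≤ ‖(2 * δ₀ / D : ℂ)‖ := by
          rw [one_mul]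
          exact pow_le_of_le_one (norm_nonneg _) hq1 (by have := hS.one_le; omega)
        _ ≤ _ := hq
    have h5 := norm_sub_norm_le (1 : ℂ) (ε * (2 * δ₀ / D) ^ d)
    rw [norm_one] at h5
    linarith

/-! ### Positive characteristic, `Q` empty. -/

theorem Symbol.restrict_empty (φ : Symbol) (s : ℂ) :
    φ.restrict ∅ s = φ.char * s + φ.coeff 1 := by
  rw [Symbol.restrict_eq, Symbol.psi, Nat.factoredNumbers_empty,
    LSeries_indicator _ (by simp), tsum_singleton 1 (fun m : ℕ => φ.coeff m * (m : ℂ) ^ (-s))]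
  simp

/-- Here `Re φ_Q(s) = c₀ Re s + Re c₁`, and the quotient by `Re s` stays bounded along some sequence
only if `Re c₁ = 0`. -/
theorem Symbol.coeff_one_re_eq_zero (φ : Symbol) {α : ℝ}
    (h : HasFiniteAngularDerivative 0 (φ.restrict ∅) α) : (φ.coeff 1).re = 0 := by
  by_contra hne
  have hpos : 0 < (φ.coeff 1).re := lt_of_le_of_ne φ.coeff_one_re_nonneg (Ne.symm hne)
  obtain ⟨A, hA1, -⟩ := EReal.lt_iff_exists_real_btwn.1 h
  have hfreq := Filter.frequently_lt_of_liminf_lt (by isBoundedDefault) hA1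
  have h1 : Tendsto (fun s : ℂ => A * s.re) (𝓝[{s : ℂ | 0 < s.re}] (α * Complex.I)) (𝓝 0) := by
    have : Tendsto (fun s : ℂ => A * s.re) (𝓝 (α * Complex.I)) (𝓝 (A * (α * Complex.I).re)) :=
      Continuous.tendsto (by fun_prop) _
    rw [show (α * Complex.I).re = 0 by simp, mul_zero] at this
    exact this.mono_left nhdsWithin_le_nhds
  obtain ⟨s, hs1, hs2, hs3⟩ := (hfreq.and_eventually
    ((h1.eventually_lt_const hpos).and self_mem_nhdsWithin)).exists
  have hs3 : 0 < s.re := hs3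
  have h4 : ((φ.restrict ∅ s).re - 0) / s.re < A := by exact_mod_cast hs1
  rw [div_lt_iff₀ hs3, Symbol.restrict_empty] at h4
  simp only [Complex.add_re, Complex.mul_re, Complex.natCast_re, Complex.natCast_im, zero_mul,
    sub_zero] at h4
  have : 0 ≤ (φ.char : ℝ) * s.re := by positivity
  linarith

theorem Symbol.hasAngularData_empty (φ : Symbol) (h : (φ.coeff 1).re = 0) (α : ℝ) :
    HasAngularData 0 (φ.restrict ∅) α (φ.char * (α * Complex.I) + φ.coeff 1) φ.char := by
  have hfun : φ.restrict ∅ = fun s => φ.char * s + φ.coeff 1 := funext φ.restrict_empty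
  refine ⟨?_, fun M => ?_, fun M => ?_⟩
  · have hev : ∀ᶠ s in 𝓝[{s : ℂ | 0 < s.re}] (α * Complex.I),
        ((((φ.restrict ∅ s).re - 0) / s.re : ℝ) : EReal) = ((φ.char : ℝ) : EReal) := by
      filter_upwards [self_mem_nhdsWithin] with s hs
      have hs : 0 < s.re := hs
      rw [Symbol.restrict_empty]
      simp only [Complex.add_re, Complex.mul_re, Complex.natCast_re, Complex.natCast_im, zero_mul,
        sub_zero, h, add_zero]
      rw [mul_div_cancel_right₀ _ hs.ne']
    have hne : (𝓝[{s : ℂ | 0 < s.re}] (α * Complex.I)).NeBot :=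
      NeBot.mono inferInstance (map_le_iff_le_comap.2
        (tendsto_iff_comap.1 ((tendsto_ray α 0).mono_right (nhdsWithin_mono _ fun s hs => hs.1))))
    rw [HasFiniteAngularDerivative, liminf_congr hev, liminf_const]
    exact EReal.coe_lt_top _
  · rw [hfun]
    exact (Continuous.tendsto (by fun_prop) _).mono_left nhdsWithin_le_nhds
  · have hd : deriv (φ.restrict ∅) = fun _ => (φ.char : ℂ) := by
      rw [hfun]
      funext s
      have : HasDerivAt (fun s : ℂ => φ.char * s + φ.coeff 1) ((φ.char : ℂ) * 1) s :=
        ((hasDerivAt_id s).const_mul _).add_const _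
      rw [this.deriv, mul_one]
    rw [hd]
    exact_mod_cast tendsto_const_nhds

theorem Hardy.coeff_sub (f g : Hardy) (k : ℕ) : (f - g).coeff k = f.coeff k - g.coeff k := by
  simp only [Hardy.coeff]
  split_ifs
  · rfl
  · simp

theorem IsCompositionOperator.coeff_pow_eq_zero {φ : Symbol} {T : Hardy →L[ℂ] Hardy}
    (hT : IsCompositionOperator φ T) {n : ℕ+} (hn : 1 < (n : ℕ)) {K : ℕ} (hK : K < φ.char) :
    (T (monomial n)).coeff ((n : ℕ) ^ K) = 0 := by
  by_contra h
  have := (Nat.pow_dvd_pow_iff_le_right hn).1 (hT.pow_dvd_of_coeff_ne_zero n h)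
  omega

theorem IsCompositionOperator.norm_coeff_pow {φ : Symbol} {T : Hardy →L[ℂ] Hardy}
    (hT : IsCompositionOperator φ T) (h : (φ.coeff 1).re = 0) (n : ℕ+) :
    ‖(T (monomial n)).coeff ((n : ℕ) ^ φ.char)‖ = 1 := by
  rw [hT.coeff_pow, norm_exp_neg_log_mul _ _ n.ne_zero, h, neg_zero, Real.rpow_zero]

/-- The coefficient of `n^{-φ₀}` at `n^{c₀}` is unimodular. For `φ₁` the coefficient at the same
place is zero if its characteristic is larger, tends to zero along suitable primes if `Re c₁ > 0`,
and has a separable phase if only the imaginary parts of `c₁` differ. If `φ₁` has smaller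
characteristic and `Re c₁ = 0`, the symbols exchange roles. -/
theorem angular_alternative_empty {φ₀ φ₁ : Symbol} {T₀ T₁ : Hardy →L[ℂ] Hardy}
    (h₀ : IsCompositionOperator φ₀ T₀) (h₁ : IsCompositionOperator φ₁ T₁) (hc : 1 ≤ φ₀.char)
    {α : ℝ} (hfin : HasFiniteAngularDerivative 0 (φ₀.restrict ∅) α) :
    ∃ (v : ℂ) (δ : ℝ), 0 < δ ∧ HasAngularData 0 (φ₀.restrict ∅) α v δ ∧
      ((1 ≤ φ₁.char ∧ HasAngularData 0 (φ₁.restrict ∅) α v δ) ∨ 1 ≤ essentialNorm (T₀ - T₁)) := by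
  have hre := φ₀.coeff_one_re_eq_zero hfin
  refine ⟨_, φ₀.char, by exact_mod_cast hc, φ₀.hasAngularData_empty hre α, ?_⟩
  by_cases hsame : φ₁.char = φ₀.char ∧ φ₁.coeff 1 = φ₀.coeff 1
  · left
    refine ⟨by omega, ?_⟩
    have := φ₁.hasAngularData_empty (by rw [hsame.2]; exact hre) α
    rwa [hsame.1, hsame.2] at this
  right
  rcases lt_or_ge φ₀.char φ₁.char with hlt | hge
  · refine le_essentialNorm_of_coeff (T₀ - T₁) (K := φ₀.char) (by omega) fun ε hε A => ?_
    obtain ⟨n, hn⟩ : ∃ n : ℕ+, (n : ℕ) = A + 2 := ⟨⟨A + 2, by omega⟩, rfl⟩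
    refine ⟨n, by omega, ?_⟩
    rw [sub_apply, Hardy.coeff_sub, h₁.coeff_pow_eq_zero (by omega) hlt, sub_zero,
      h₀.norm_coeff_pow hre]
    linarith
  rcases (φ₁.coeff_one_re_nonneg).eq_or_lt with hre₁ | hre₁
  · have hc₁ : φ₁.char ≠ 0 := fun h => by
      have := φ₁.coeff_one_re_pos_of_char_zero h
      linarith
    rcases hge.lt_or_eq with hlt | heq
    · rw [essentialNorm_sub_comm]
      refine le_essentialNorm_of_coeff (T₁ - T₀) hc₁ fun ε hε A => ?_
      obtain ⟨n, hn⟩ : ∃ n : ℕ+, (n : ℕ) = A + 2 := ⟨⟨A + 2, by omega⟩, rfl⟩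
      refine ⟨n, by omega, ?_⟩
      rw [sub_apply, Hardy.coeff_sub, h₀.coeff_pow_eq_zero (by omega) hlt, sub_zero,
        h₁.norm_coeff_pow hre₁.symm]
      linarith
    · have hne : φ₁.coeff 1 - φ₀.coeff 1 ≠ 0 := fun h => hsame ⟨heq, sub_eq_zero.1 h⟩
      set τ := (φ₀.coeff 1 - φ₁.coeff 1).im with hτ
      have hτI : φ₀.coeff 1 - φ₁.coeff 1 = τ * Complex.I := by
        apply Complex.ext <;> simp [hre, ← hre₁, hτ]
      have hτ0 : τ ≠ 0 := by
        intro h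
        rw [h, Complex.ofReal_zero, zero_mul] at hτI
        exact hne (by rw [← neg_sub, hτI, neg_zero])
      refine le_essentialNorm_of_coeff (T₀ - T₁) (K := φ₀.char) (by omega) fun ε hε A => ?_
      obtain ⟨n', hn', -, hnorm⟩ := exists_norm_one_sub_exp_ge one_pos hτ0 (A + 1)
      obtain ⟨n, rfl⟩ : ∃ n : ℕ+, (n : ℕ) = n' := ⟨⟨n', by omega⟩, rfl⟩
      refine ⟨n, by omega, ?_⟩
      rw [sub_apply, Hardy.coeff_sub, h₀.coeff_pow, ← heq, h₁.coeff_pow]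
      have e1 : Complex.exp (-(Complex.log n * φ₀.coeff 1)) - Complex.exp (-(Complex.log n * φ₁.coeff 1))
          = Complex.exp (-(Complex.log n * φ₀.coeff 1)) *
            (1 - Complex.exp (Complex.log n * (τ * Complex.I))) := by
        rw [mul_sub, mul_one, ← Complex.exp_add, ← hτI]
        congr 2
        ring
      rw [e1, norm_mul, norm_exp_neg_log_mul _ _ (by omega), hre, neg_zero, Real.rpow_zero, one_mul]
      linarith
  · refine le_essentialNorm_of_coeff (T₀ - T₁) (K := φ₀.char) (by omega) fun ε hε A => ?_
    obtain ⟨p, hpA, -, hsmall⟩ := h₁.exists_prime_coeff_small hre₁ hge hε A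
    refine ⟨p, hpA, ?_⟩
    rw [sub_apply, Hardy.coeff_sub]
    have h2 := norm_sub_norm_le ((T₀ (monomial p)).coeff ((p : ℕ) ^ φ₀.char))
      ((T₁ (monomial p)).coeff ((p : ℕ) ^ φ₀.char))
    rw [h₀.norm_coeff_pow hre] at h2
    linarith

/-! ### Positive characteristic, `Q` nonempty. -/

section Nonempty

variable {φ φ₀ φ₁ : Symbol} {T T₀ T₁ : Hardy →L[ℂ] Hardy} {Q : Finset ℕ}

/-- The matrix entry `⟪y, C_φ f⟫` for kernel vectors, positive characteristic. -/
theorem IsCompositionOperator.inner_kernelVec_kernelVec (hT : IsCompositionOperator φ T)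
    (hQ : ∀ p ∈ Q, p.Prime) (hne : Q.Nonempty) (n : ℕ+) {s a : ℂ} (hs : 0 < s.re) (ha : 0 < a.re) :
    ⟪kernelVec (Nat.factoredNumbers Q) (n ^ φ.char) (conj s),
        T (kernelVec (Nat.factoredNumbers Q) n (conj a))⟫ =
      ((n : ℕ) : ℂ) ^ (-φ.psi Q s) *
        kernelSum (Nat.factoredNumbers Q) (conj a + φ.restrict Q s) :=
  inner_map_kernelVec (poleKernel_factoredNumbers hQ hne) le_rfl T _ n (by linarith)
    (fun m _ => hT.inner_kernelVec_kernelIndex hQ hne n hs m) (fun m hm => absurd m.2 hm)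

theorem IsCompositionOperator.inner_kernelVec_kernelVec_one (hT : IsCompositionOperator φ T)
    (hQ : ∀ p ∈ Q, p.Prime) (hne : Q.Nonempty) {s a : ℂ} (hs : 0 < s.re) (ha : 0 < a.re) :
    ⟪kernelVec (Nat.factoredNumbers Q) 1 (conj s),
        T (kernelVec (Nat.factoredNumbers Q) 1 (conj a))⟫ =
      kernelSum (Nat.factoredNumbers Q) (conj a + φ.restrict Q s) := by
  have h := hT.inner_kernelVec_kernelVec hQ hne 1 hs ha
  simpa using h

theorem sqrt_div_self_div {R x : ℝ} (hR : 0 < R) : √(R / R) / x = 1 / x := by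
  rw [div_self hR.ne', Real.sqrt_one]

theorem AngularQuotient.tendsto_natCast_cpow_neg_psi {α δ : ℝ} {v : ℂ}
    (hq : AngularQuotient (φ.restrict Q) α v δ) (n : ℕ+) :
    Tendsto (fun σ => ((n : ℕ) : ℂ) ^ (-φ.psi Q (ray α 0 σ))) (𝓝[>] 0)
      (𝓝 (((n : ℕ) : ℂ) ^ (-(v - φ.char * (α * Complex.I))))) := by
  have h1 := (hq.value _).comp (DirichletComposition.tendsto_ray α 0)
  have h2 : Tendsto (ray α 0) (𝓝[>] 0) (𝓝 (α * Complex.I)) :=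
    (DirichletComposition.tendsto_ray α 0).mono_right nhdsWithin_le_nhds
  have h3 := (h1.sub (h2.const_mul (φ.char : ℂ))).neg
  have h4 := h3.const_cpow (a := ((n : ℕ) : ℂ)) (Or.inl (by exact_mod_cast n.ne_zero))
  refine h4.congr fun σ => ?_
  simp only [Function.comp]
  rw [Symbol.restrict_eq, add_sub_cancel_left]

theorem norm_natCast_cpow_boundary {v : ℂ} (hv : v.re = 0) (c : ℕ) (α : ℝ) (n : ℕ+) :
    ‖((n : ℕ) : ℂ) ^ (-(v - c * (α * Complex.I)))‖ = 1 := by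
  rw [norm_natCast_cpow_neg n.ne_zero]
  simp [hv]

/-- The bound for a symbol of larger characteristic. -/
theorem le_essentialNorm_sub_of_char_lt (h₀ : IsCompositionOperator φ₀ T₀)
    (h₁ : IsCompositionOperator φ₁ T₁) (hQ : ∀ p ∈ Q, p.Prime) (hne : Q.Nonempty)
    (hlt : φ₀.char < φ₁.char) {α δ : ℝ} {v : ℂ} (hq : AngularQuotient (φ₀.restrict Q) α v δ)
    (hδ : 0 < δ) (hv : v.re = 0) :
    1 / δ ^ ((Q.card : ℝ) / 2) ≤ essentialNorm (T₀ - T₁) := by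
  have hK := poleKernel_factoredNumbers hQ hne
  have hprod : 0 < ∏ p ∈ Q, p := Finset.prod_pos fun p hp => (hQ p hp).pos
  -- Some integer greater than `1` and prime to `Q`.
  obtain ⟨n, hn⟩ : ∃ n : ℕ+, (n : ℕ) = 1 + ∏ p ∈ Q, p := ⟨⟨1 + ∏ p ∈ Q, p, by omega⟩, rfl⟩
  have hcop : ∀ p ∈ Q, ¬ p ∣ (n : ℕ) := by
    intro p hp hdvd
    rw [hn] at hdvd
    exact (hQ p hp).one_lt.ne' (Nat.dvd_one.1
      ((Nat.dvd_add_left (Finset.dvd_prod_of_mem (fun p => p) hp)).1 hdvd))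
  have h := le_essentialNorm_sub hK hK T₀ T₁ (n ^ φ₀.char) n 0 hq hδ (by rw [hv, mul_zero])
    (fun s hs => by have := h₀.restrict_re_pos hQ hne hs; linarith) (μ := 0)
    (hq.tendsto_natCast_cpow_neg_psi n) (fun σ hσ => by
      have hs : 0 < (ray α 0 σ).re := by rwa [ray_re]
      exact h₀.inner_kernelVec_kernelVec hQ hne n hs (h₀.restrict_re_pos hQ hne hs)) (by
      rw [mul_zero]
      refine tendsto_const_nhds.congr' ?_
      filter_upwards [self_mem_nhdsWithin] with σ hσ
      have hs : 0 < (ray α 0 σ).re := by rwa [ray_re]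
      have ha := h₀.restrict_re_pos hQ hne hs
      rw [inner_map_kernelVec hK le_rfl T₁ _ n (A := 0) (b := 0) (by linarith)
        (fun m _ => by
          rw [zero_mul]
          exact h₁.inner_kernelVec_kernelIndex_eq_zero hQ hne (by omega) hcop hlt hs m)
        (fun m hm => absurd m.2 hm), zero_mul, zero_mul])
  rwa [sub_zero, norm_natCast_cpow_boundary hv, mul_one, sqrt_div_self_div hK.pos] at h

/-- The bound for a symbol with the same derivative and a different boundary value that is not
seen by the primes in `Q`. -/
theorem le_essentialNorm_sub_of_value_ne (h₀ : IsCompositionOperator φ₀ T₀)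
    (h₁ : IsCompositionOperator φ₁ T₁) (hQ : ∀ p ∈ Q, p.Prime) (hne : Q.Nonempty)
    (hchar : φ₀.char = φ₁.char) {α δ : ℝ} {v v₁ : ℂ} (hq : AngularQuotient (φ₀.restrict Q) α v δ)
    (hq₁ : AngularQuotient (φ₁.restrict Q) α v₁ δ)
    (hδ : 0 < δ) (hv : v.re = 0) (hv₁ : v₁.re = 0) (hvne : v₁ ≠ v)
    (hper : ∀ p ∈ Q, (p : ℂ) ^ (-(conj v + v₁)) = 1) :
    1 / δ ^ ((Q.card : ℝ) / 2) ≤ essentialNorm (T₀ - T₁) := by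
  have hK := poleKernel_factoredNumbers hQ hne
  have hprod : 0 < ∏ p ∈ Q, p := Finset.prod_pos fun p hp => (hQ p hp).pos
  set τ := (v - v₁).im with hτ
  have hτI : v - v₁ = τ * Complex.I := by
    apply Complex.ext <;> simp [hv, hv₁, hτ]
  have hτ0 : τ ≠ 0 := by
    intro h
    rw [h, Complex.ofReal_zero, zero_mul] at hτI
    exact hvne (sub_eq_zero.1 hτI).symm
  -- By `hper` the kernel over `Q` gives both entries the same modulus in the limit. The twist by
  -- `n` gives them phases whose distance is at least `1`.
  obtain ⟨n', hn', hmod, hnorm⟩ := exists_norm_one_sub_exp_ge hprod hτ0 1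
  obtain ⟨n, rfl⟩ : ∃ n : ℕ+, (n : ℕ) = n' := ⟨⟨n', by omega⟩, rfl⟩
  have hre : ∀ σ : ℝ, 0 < σ → 0 < (ray α 0 σ).re := fun σ hσ => by rwa [ray_re]
  have hpole := PoleKernel.tendsto_of_path (S := Nat.factoredNumbers Q) (x₀ := 0) (d := Q.card)
    (tendsto_pow_mul_kernelSum_factoredNumbers hQ (w₀ := conj v + v₁) (by simp [hv, hv₁]))
    (w := fun σ => conj (φ₀.restrict Q (ray α 0 σ)) + φ₁.restrict Q (ray α 0 σ)) (by
      filter_upwards [self_mem_nhdsWithin] with σ hσ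
      rw [Complex.add_re, Complex.conj_re]
      exact add_pos (h₀.restrict_re_pos hQ hne (hre σ hσ))
        (h₁.restrict_re_pos hQ hne (hre σ hσ)))
    (by
      simp only [sub_self, mul_zero, Complex.ofReal_zero, zero_mul, add_zero]
      exact_mod_cast (by positivity : δ + δ ≠ 0))
    (hq.tendsto_ray_conj_add hq₁ 0)
  rw [if_pos hper, mul_one] at hpole
  have hlim := (hq₁.tendsto_natCast_cpow_neg_psi n).mul hpole
  have h := le_essentialNorm_sub hK hK T₀ T₁ (n ^ φ₀.char) n 0 hq hδ (by rw [hv, mul_zero])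
    (fun s hs => by have := h₀.restrict_re_pos hQ hne hs; linarith)
    (μ := ((n : ℕ) : ℂ) ^ (-(v₁ - φ₁.char * (α * Complex.I))))
    (hq.tendsto_natCast_cpow_neg_psi n) (fun σ hσ =>
      h₀.inner_kernelVec_kernelVec hQ hne n (hre σ hσ) (h₀.restrict_re_pos hQ hne (hre σ hσ))) (by
      have e : (((∏ p ∈ Q, 1 / Real.log p) / (2 * δ) ^ Q.card : ℝ) : ℂ) *
          ((n : ℕ) : ℂ) ^ (-(v₁ - φ₁.char * (α * Complex.I))) =
          ((n : ℕ) : ℂ) ^ (-(v₁ - φ₁.char * (α * Complex.I))) *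
          (((∏ p ∈ Q, 1 / Real.log p : ℝ) : ℂ) /
            ((δ + δ : ℝ) + (0 * (δ - δ) : ℝ) * Complex.I) ^ Q.card) := by
        rw [zero_mul, Complex.ofReal_zero, zero_mul, add_zero, ← two_mul]
        push_cast
        ring
      rw [e]
      refine hlim.congr' ?_
      filter_upwards [self_mem_nhdsWithin] with σ hσ
      rw [hchar, h₁.inner_kernelVec_kernelVec hQ hne n (hre σ hσ)
        (h₀.restrict_re_pos hQ hne (hre σ hσ)), mul_assoc])
  rw [sqrt_div_self_div hK.pos] at h
  refine le_trans ?_ h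
  refine le_mul_of_one_le_right (by positivity) ?_
  have e1 : ((n : ℕ) : ℂ) ^ (-(v - φ₀.char * (α * Complex.I))) -
      ((n : ℕ) : ℂ) ^ (-(v₁ - φ₁.char * (α * Complex.I))) =
      ((n : ℕ) : ℂ) ^ (-(v - φ₀.char * (α * Complex.I))) *
        (1 - Complex.exp (Complex.log n * (τ * Complex.I))) := by
    have hn0 : ((n : ℕ) : ℂ) ≠ 0 := by exact_mod_cast n.ne_zero
    rw [mul_sub, mul_one, Complex.cpow_def_of_ne_zero hn0, Complex.cpow_def_of_ne_zero hn0,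
      ← Complex.exp_add, ← hτI, hchar]
    congr 2
    ring
  rw [e1, norm_mul, norm_natCast_cpow_boundary hv, one_mul]
  exact hnorm

/-- The characteristic of `φ₁` is left free and its positivity is part of the conclusion, because a
connected component is not known in advance to contain symbols of one type only. -/
theorem angular_alternative_nonempty (h₀ : IsCompositionOperator φ₀ T₀)
    (h₁ : IsCompositionOperator φ₁ T₁) (hQ : ∀ p ∈ Q, p.Prime) (hne : Q.Nonempty)
    {α : ℝ} (hfin : HasFiniteAngularDerivative 0 (φ₀.restrict Q) α) :
    ∃ (v : ℂ) (δ : ℝ), 0 < δ ∧ HasAngularData 0 (φ₀.restrict Q) α v δ ∧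
      ((1 ≤ φ₁.char ∧ HasAngularData 0 (φ₁.restrict Q) α v δ) ∨
        1 / δ ^ ((Q.card : ℝ) / 2) ≤ essentialNorm (T₀ - T₁)) := by
  have hK := poleKernel_factoredNumbers hQ hne
  have hd₀ := φ₀.differentiableOn_restrict Q
  have hd₁ := φ₁.differentiableOn_restrict Q
  have hp₀ : ∀ s : ℂ, 0 < s.re → 0 < (φ₀.restrict Q s).re := fun s hs =>
    h₀.restrict_re_pos hQ hne hs
  have hp₁ : ∀ s : ℂ, 0 < s.re → 0 < (φ₁.restrict Q s).re := fun s hs =>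
    h₁.restrict_re_pos hQ hne hs
  have hre : ∀ σ : ℝ, 0 < σ → 0 < (ray α 0 σ).re := fun σ hσ => by rwa [ray_re]
  obtain ⟨v, δ, hv, hδ, hq⟩ := exists_angularQuotient hd₀ hp₀ hfin
  refine ⟨v, δ, hδ, hq.hasAngularData hd₀ hfin, ?_⟩
  have hentry₀ : ∀ s : ℂ, 0 < s.re → _ := fun s hs =>
    h₀.inner_kernelVec_kernelVec_one hQ hne hs (hp₀ s hs)
  have hentry₁ : ∀ s : ℂ, 0 < s.re → _ := fun s hs =>
    h₁.inner_kernelVec_kernelVec_one hQ hne hs (hp₀ s hs)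
  -- This covers both a `φ₁` without finite angular derivative and a `φ₁` of characteristic zero,
  -- whose real part stays above `1/2`.
  by_cases hinf : ∀ B : ℝ, ∀ᶠ σ in 𝓝[>] (0 : ℝ), B * σ ≤ (φ₁.restrict Q (ray α 0 σ)).re
  · right
    have h := le_essentialNorm_sub hK hK T₀ T₁ 1 1 0 hq hδ (by rw [hv, mul_zero])
      (fun s hs => by have := hp₀ s hs; linarith) (A := fun _ => 1) (ω := 1) (μ := 0)
      tendsto_const_nhds (fun σ hσ => by rw [hentry₀ _ (hre σ hσ), one_mul]) (by
        rw [mul_zero]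
        refine (hK.tendsto_zero (w := fun σ => conj (φ₀.restrict Q (ray α 0 σ)) +
          φ₁.restrict Q (ray α 0 σ)) fun B => ?_).congr' ?_
        · filter_upwards [hinf B, self_mem_nhdsWithin] with σ h1 h2
          have := hp₀ _ (hre σ h2)
          rw [Complex.add_re, Complex.conj_re]
          linarith
        · filter_upwards [self_mem_nhdsWithin] with σ hσ
          rw [hentry₁ _ (hre σ hσ)])
    rwa [sub_zero, norm_one, mul_one, sqrt_div_self_div hK.pos] at h
  have hc₁ : 1 ≤ φ₁.char := by
    by_contra hlt
    refine hinf fun B => ?_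
    have hlim : Tendsto (fun σ : ℝ => B * σ) (𝓝[>] 0) (𝓝 0) := by
      have : Tendsto (fun σ : ℝ => B * σ) (𝓝 0) (𝓝 (B * 0)) := Continuous.tendsto (by fun_prop) 0
      rw [mul_zero] at this
      exact this.mono_left nhdsWithin_le_nhds
    filter_upwards [hlim.eventually_lt_const (show (0 : ℝ) < 1 / 2 by norm_num),
      self_mem_nhdsWithin] with σ h1 h2
    exact h1.le.trans (h₁.restrict_re_gt_half hQ hne (by omega) (hre σ h2)).le
  have hfin₁ : HasFiniteAngularDerivative 0 (φ₁.restrict Q) α := by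
    by_contra hnot
    refine hinf fun B => ?_
    simpa using eventually_le_of_not_hasFiniteAngularDerivative hnot 0 B
  obtain ⟨v₁, δ₁, hv₁, hδ₁, hq₁⟩ := exists_angularQuotient hd₁ hp₁ hfin₁
  have hw₀ : (conj v + v₁).re = 0 := by simp [hv, hv₁]
  by_cases hcase : (∀ p ∈ Q, (p : ℂ) ^ (-(conj v + v₁)) = 1) ∧ δ₁ = δ
  swap
  · right
    classical
    have h := le_essentialNorm_sub_of_data hK hK T₀ T₁ hq hq₁ hδ hδ₁ (by rw [hv, mul_zero])
      (fun s hs => by have := hp₀ s hs; linarith) (fun s hs => by have := hp₁ s hs; linarith)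
      hentry₀ hentry₁ (ε := if ∀ p ∈ Q, (p : ℂ) ^ (-(conj v + v₁)) = 1 then 1 else 0)
      (by split_ifs <;> simp) (by
        convert tendsto_pow_mul_kernelSum_factoredNumbers hQ hw₀) (by
        by_cases h : ∀ p ∈ Q, (p : ℂ) ^ (-(conj v + v₁)) = 1
        · exact Or.inr fun h2 => hcase ⟨h, h2⟩
        · exact Or.inl (if_neg h))
    rwa [sqrt_div_self_div hK.pos] at h
  obtain ⟨hper, rfl⟩ := hcase
  by_cases hveq : v₁ = v
  · subst hveq
    exact Or.inl ⟨hc₁, hq₁.hasAngularData hd₁ hfin₁⟩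
  right
  -- The derivatives agree by now, so exchanging the two symbols does not change the bound.
  rcases lt_trichotomy φ₀.char φ₁.char with hlt | heq | hlt
  · exact le_essentialNorm_sub_of_char_lt h₀ h₁ hQ hne hlt hq hδ hv
  · exact le_essentialNorm_sub_of_value_ne h₀ h₁ hQ hne heq hq hq₁ hδ hv hv₁ hveq hper
  · rw [essentialNorm_sub_comm]
    exact le_essentialNorm_sub_of_char_lt h₁ h₀ hQ hne hlt hq₁ hδ hv₁

theorem angular_alternative (h₀ : IsCompositionOperator φ₀ T₀)
    (h₁ : IsCompositionOperator φ₁ T₁) (hQ : ∀ p ∈ Q, p.Prime)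
    (hc : 1 ≤ φ₀.char) {α : ℝ} (hfin : HasFiniteAngularDerivative 0 (φ₀.restrict Q) α) :
    ∃ (v : ℂ) (δ : ℝ), 0 < δ ∧ HasAngularData 0 (φ₀.restrict Q) α v δ ∧
      ((1 ≤ φ₁.char ∧ HasAngularData 0 (φ₁.restrict Q) α v δ) ∨
        1 / δ ^ ((Q.card : ℝ) / 2) ≤ essentialNorm (T₀ - T₁)) := by
  rcases Q.eq_empty_or_nonempty with rfl | hne
  · simpa using angular_alternative_empty h₀ h₁ hc hfin
  · exact angular_alternative_nonempty h₀ h₁ hQ hne hfin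

end Nonempty

/-! ### Characteristic zero. -/

section CharZero

variable {φ φ₀ φ₁ : Symbol} {T T₀ T₁ : Hardy →L[ℂ] Hardy} {p : ℕ}

theorem poleKernel_factoredNumbers_singleton (hp : p.Prime) :
    PoleKernel (Nat.factoredNumbers {p}) 0 1 (1 / Real.log p) := by
  have := poleKernel_factoredNumbers (Q := {p}) (by simpa using hp) (Finset.singleton_nonempty p)
  simpa using this

theorem IsCompositionOperator.inner_kernelVec_zeta_of_char_zero (hT : IsCompositionOperator φ T)
    (hp : p.Prime) (h0 : φ.char = 0) {s a : ℂ} (hs : 0 < s.re) (ha : 1 / 2 < a.re) :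
    ⟪kernelVec (Nat.factoredNumbers {p}) 1 (conj s), T (kernelVec {m | m ≠ 0} 1 (conj a))⟫ =
      kernelSum {m | m ≠ 0} (conj a + φ.restrict {p} s) := by
  have h := inner_map_kernelVec poleKernel_ne_zero le_rfl T
    (kernelVec (Nat.factoredNumbers {p}) 1 (conj s)) 1 (a := a) (b := φ.restrict {p} s) (A := 1)
    (by linarith) (fun m _ => by
      rw [hT.inner_kernelVec_of_char_zero (by simpa using hp) (Finset.singleton_nonempty p) h0 _ hs,
        kernelIndex_coe poleKernel_ne_zero.ne_zero, one_mul, PNat.one_coe, one_mul])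
    (fun m hm => absurd m.2 hm)
  rw [h, one_mul]

/-- For positive characteristic `l^{-φ}` lives on multiples of `l`, so only powers of `p` among the
`l` reach the support of the first vector, and the zeta kernel shrinks to the kernel of `{p}`. -/
theorem IsCompositionOperator.inner_kernelVec_zeta_of_char_pos (hT : IsCompositionOperator φ T)
    (hp : p.Prime) (hc : φ.char ≠ 0) {s a : ℂ} (hs : 0 < s.re) (ha : 1 / 2 < a.re) :
    ⟪kernelVec (Nat.factoredNumbers {p}) 1 (conj s), T (kernelVec {m | m ≠ 0} 1 (conj a))⟫ =
      kernelSum (Nat.factoredNumbers {p}) (conj a + φ.restrict {p} s) := by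
  have hQ : ∀ q ∈ ({p} : Finset ℕ), q.Prime := by simpa using hp
  have hne := Finset.singleton_nonempty p
  have h := inner_map_kernelVec poleKernel_ne_zero (S' := Nat.factoredNumbers {p})
    (fun m hm => ne_zero_of_mem_factored m hm) T
    (kernelVec (Nat.factoredNumbers {p}) 1 (conj s)) 1 (a := a) (b := φ.restrict {p} s) (A := 1)
    (by linarith) (fun m hm => by
      have h1 := hT.inner_kernelVec_kernelIndex hQ hne 1 hs ⟨m, hm⟩
      have h2 : kernelIndex (Nat.factoredNumbers {p}) 1 ⟨m, hm⟩ = kernelIndex {m | m ≠ 0} 1 m := by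
        apply PNat.eq
        rw [kernelIndex_coe ne_zero_of_mem_factored, kernelIndex_coe poleKernel_ne_zero.ne_zero]
      rw [h2] at h1
      simpa using h1)
    (fun m hm => by
      refine hT.inner_kernelVec_eq_zero hQ hne _ _ (fun m' hm' hdvd => hm ?_) hs
      rw [kernelIndex_coe poleKernel_ne_zero.ne_zero, PNat.one_coe, one_mul, one_mul] at hdvd
      exact Nat.mem_factoredNumbers_of_dvd hm' ((dvd_pow_self _ hc).trans hdvd))
  rw [h, one_mul]

theorem angular_alternative_of_char_zero (h₀ : IsCompositionOperator φ₀ T₀)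
    (h₁ : IsCompositionOperator φ₁ T₁) (hp : p.Prime) (hc : φ₀.char = 0) {α : ℝ}
    (hfin : HasFiniteAngularDerivative (1 / 2) (φ₀.restrict {p}) α) :
    ∃ (v : ℂ) (δ : ℝ), 0 < δ ∧ HasAngularData (1 / 2) (φ₀.restrict {p}) α v δ ∧
      ((φ₁.char = 0 ∧ HasAngularData (1 / 2) (φ₁.restrict {p}) α v δ) ∨
        √(Real.log p) / δ ^ (1 / 2 : ℝ) ≤ essentialNorm (T₀ - T₁)) := by
  have hK := poleKernel_factoredNumbers_singleton hp
  have hS := poleKernel_ne_zero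
  have hQ : ∀ q ∈ ({p} : Finset ℕ), q.Prime := by simpa using hp
  have hne := Finset.singleton_nonempty p
  have hd₀ := φ₀.differentiableOn_restrict {p}
  have hd₁ := φ₁.differentiableOn_restrict {p}
  have hp₀ : ∀ s : ℂ, 0 < s.re → 1 / 2 < (φ₀.restrict {p} s).re := fun s hs =>
    h₀.restrict_re_gt_half hQ hne hc hs
  have hre : ∀ σ : ℝ, 0 < σ → 0 < (ray α 0 σ).re := fun σ hσ => by rwa [ray_re]
  obtain ⟨v, δ, hv, hδ, hq⟩ := exists_angularQuotient hd₀ hp₀ hfin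
  refine ⟨v, δ, hδ, hq.hasAngularData hd₀ hfin, ?_⟩
  have hv2 : 2 * v.re = 1 := by rw [hv]; norm_num
  have hg₀ : ∀ s : ℂ, 0 < s.re → 1 < 2 * (φ₀.restrict {p} s).re := fun s hs => by
    have := hp₀ s hs
    linarith
  have hentry₀ : ∀ s : ℂ, 0 < s.re → _ := fun s hs =>
    h₀.inner_kernelVec_zeta_of_char_zero hp hc hs (hp₀ s hs)
  have hzero : Tendsto (fun σ : ℝ => ⟪kernelVec (Nat.factoredNumbers {p}) 1 (conj (ray α 0 σ)),
      T₁ (kernelVec {m | m ≠ 0} 1 (conj (φ₀.restrict {p} (ray α 0 σ))))⟫ * (σ : ℂ) ^ 1)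
      (𝓝[>] 0) (𝓝 0) → √(Real.log p) / δ ^ (1 / 2 : ℝ) ≤ essentialNorm (T₀ - T₁) := by
    intro hz
    have h := le_essentialNorm_sub hK hS T₀ T₁ 1 1 0 hq hδ hv2 hg₀ (A := fun _ => 1) (ω := 1)
      (μ := 0) tendsto_const_nhds (fun σ hσ => by rw [hentry₀ _ (hre σ hσ), one_mul])
      (by rwa [mul_zero])
    rwa [sub_zero, norm_one, mul_one, one_div_one_div, Nat.cast_one] at h
  by_cases hc₁ : φ₁.char = 0
  swap
  · right
    -- The kernel of `{p}` is evaluated at real parts above `1/2`, away from its poles, so the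
    -- factor `σ` wins.
    refine hzero ?_
    have hlim : ∀ B : ℝ, Tendsto (fun σ : ℝ => B * σ) (𝓝[>] 0) (𝓝 0) := by
      intro B
      have : Tendsto (fun σ : ℝ => B * σ) (𝓝 0) (𝓝 (B * 0)) := Continuous.tendsto (by fun_prop) 0
      rw [mul_zero] at this
      exact this.mono_left nhdsWithin_le_nhds
    refine (hK.tendsto_zero (w := fun σ => conj (φ₀.restrict {p} (ray α 0 σ)) +
      φ₁.restrict {p} (ray α 0 σ)) fun B => ?_).congr' ?_
    · filter_upwards [(hlim B).eventually_lt_const (show (0 : ℝ) < 1 / 2 by norm_num),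
        self_mem_nhdsWithin] with σ h1 h2
      have h3 := hp₀ _ (hre σ h2)
      have h4 := h₁.restrict_re_pos hQ hne (hre σ h2)
      rw [Complex.add_re, Complex.conj_re]
      linarith
    · filter_upwards [self_mem_nhdsWithin] with σ hσ
      rw [h₁.inner_kernelVec_zeta_of_char_pos hp hc₁ (hre σ hσ) (hp₀ _ (hre σ hσ))]
  have hp₁ : ∀ s : ℂ, 0 < s.re → 1 / 2 < (φ₁.restrict {p} s).re := fun s hs =>
    h₁.restrict_re_gt_half hQ hne hc₁ hs
  have hentry₁ : ∀ s : ℂ, 0 < s.re → _ := fun s hs =>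
    h₁.inner_kernelVec_zeta_of_char_zero hp hc₁ hs (hp₀ s hs)
  by_cases hfin₁ : HasFiniteAngularDerivative (1 / 2) (φ₁.restrict {p}) α
  swap
  · right
    refine hzero ((hS.tendsto_zero (w := fun σ => conj (φ₀.restrict {p} (ray α 0 σ)) +
      φ₁.restrict {p} (ray α 0 σ)) fun B => ?_).congr' ?_)
    · filter_upwards [eventually_le_of_not_hasFiniteAngularDerivative hfin₁ 0 B,
        self_mem_nhdsWithin] with σ h1 h2
      have h3 := hp₀ _ (hre σ h2)
      rw [Complex.add_re, Complex.conj_re]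
      linarith
    · filter_upwards [self_mem_nhdsWithin] with σ hσ
      rw [hentry₁ _ (hre σ hσ)]
  obtain ⟨v₁, δ₁, hv₁, hδ₁, hq₁⟩ := exists_angularQuotient hd₁ hp₁ hfin₁
  -- Both boundary values lie on `Re = 1/2`, so the pole of zeta is hit exactly when they coincide,
  -- and no twist is needed.
  by_cases hcase : conj v + v₁ = 1 ∧ δ₁ = δ
  · obtain ⟨hveq, rfl⟩ := hcase
    have : v₁ = v := by
      apply Complex.ext
      · rw [hv, hv₁]
      · have := congrArg Complex.im hveq
        rw [Complex.add_im, Complex.conj_im, Complex.one_im] at this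
        linarith
    subst this
    exact Or.inl ⟨hc₁, hq₁.hasAngularData hd₁ hfin₁⟩
  right
  have h := le_essentialNorm_sub_of_data hK hS T₀ T₁ hq hq₁ hδ hδ₁ hv2 hg₀
    (fun s hs => by have := hp₁ s hs; linarith)
    hentry₀ hentry₁ (ε := if conj v + v₁ = 1 then 1 else 0)
    (by split_ifs <;> simp) (by
      simpa using tendsto_sub_mul_kernelSum_ne_zero (w₀ := conj v + v₁)) (by
      by_cases h : conj v + v₁ = 1
      · exact Or.inr fun h2 => hcase ⟨h, h2⟩
      · exact Or.inl (if_neg h))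
  rwa [one_div_one_div, Nat.cast_one] at h

end CharZero

/-! ### Connected components. -/

section Components

theorem NontangentialLimit.unique {g : ℂ → ℂ} {α : ℝ} {l l' : ℂ} (h : NontangentialLimit g α l)
    (h' : NontangentialLimit g α l') : l = l' :=
  tendsto_nhds_unique ((h _).comp (tendsto_ray α 0)) ((h' _).comp (tendsto_ray α 0))

theorem HasAngularData.unique {θ α δ δ' : ℝ} {g : ℂ → ℂ} {v v' : ℂ}
    (h : HasAngularData θ g α v δ) (h' : HasAngularData θ g α v' δ') : v = v' ∧ δ = δ' :=
  ⟨h.value.unique h'.value, by exact_mod_cast h.deriv.unique h'.deriv⟩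

/-- A subset of a set that absorbs all points at distance less than `r` contains the whole
connected component of each of its points. -/
theorem connectedComponentIn_subset_of_dist_lt {E : Type*} [PseudoMetricSpace E] {S U : Set E}
    {r : ℝ} (hr : 0 < r) (hU : ∀ A ∈ S ∩ U, ∀ B ∈ S, dist A B < r → B ∈ U) {x y : E} (hx : x ∈ U)
    (hy : y ∈ connectedComponentIn S x) : y ∈ U := by
  have hS : connectedComponentIn S x ⊆ S := connectedComponentIn_subset S x
  have hxS : x ∈ connectedComponentIn S x := by
    refine mem_connectedComponentIn ?_
    by_contra h
    rw [connectedComponentIn_eq_empty h] at hy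
    exact hy
  -- Balls of radius `r/2` about points inside and outside `U` cannot meet, so they separate `S`
  -- into two relatively open parts.
  set V : Set E := ⋃ A ∈ S ∩ U, Metric.ball A (r / 2)
  set W : Set E := ⋃ A ∈ S \ U, Metric.ball A (r / 2)
  have hV : IsOpen V := isOpen_biUnion fun _ _ => Metric.isOpen_ball
  have hW : IsOpen W := isOpen_biUnion fun _ _ => Metric.isOpen_ball
  have hdisj : Disjoint V W := by
    rw [Set.disjoint_left]
    intro z hz hz'
    simp only [V, W, Set.mem_iUnion, exists_prop, Metric.mem_ball] at hz hz'
    obtain ⟨A, hA, hzA⟩ := hz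
    obtain ⟨B, hB, hzB⟩ := hz'
    refine hB.2 (hU A hA B hB.1 ?_)
    have := dist_triangle_left A B z
    linarith
  have hcov : connectedComponentIn S x ⊆ V ∪ W := by
    intro z hz
    by_cases hzU : z ∈ U
    · exact Or.inl (Set.mem_biUnion (x := z) ⟨hS hz, hzU⟩ (Metric.mem_ball_self (by linarith)))
    · exact Or.inr (Set.mem_biUnion (x := z) ⟨hS hz, hzU⟩ (Metric.mem_ball_self (by linarith)))
  have hsub := isPreconnected_connectedComponentIn.subset_left_of_subset_union hV hW hdisj hcov
    ⟨x, hxS, Set.mem_biUnion (x := x) ⟨hS hxS, hx⟩ (Metric.mem_ball_self (by linarith))⟩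
  have hyV := hsub hy
  by_contra hyU
  exact Set.disjoint_left.1 hdisj hyV
    (Set.mem_biUnion (x := y) ⟨hS hy, hyU⟩ (Metric.mem_ball_self (by linarith)))

/-- Angular data are constant on components, once they are determined by operators nearby. -/
theorem hasAngularData_of_mem_connectedComponentIn {P : Symbol → Prop} {θ α : ℝ} {Q : Finset ℕ}
    {b : ℝ → ℝ} (hb : ∀ δ, 0 < δ → 0 < b δ)
    (halt : ∀ (φ₀ φ₁ : Symbol) (T₀ T₁ : Hardy →L[ℂ] Hardy),
      IsCompositionOperator φ₀ T₀ → IsCompositionOperator φ₁ T₁ → P φ₀ →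
      HasFiniteAngularDerivative θ (φ₀.restrict Q) α →
      ∃ (v : ℂ) (δ : ℝ), 0 < δ ∧ HasAngularData θ (φ₀.restrict Q) α v δ ∧
        ((P φ₁ ∧ HasAngularData θ (φ₁.restrict Q) α v δ) ∨ b δ ≤ essentialNorm (T₀ - T₁)))
    {φ₀ φ₁ : Symbol} {T₀ T₁ : Hardy →L[ℂ] Hardy} (h₀ : IsCompositionOperator φ₀ T₀)
    (h₁ : IsCompositionOperator φ₁ T₁) (hP : P φ₀)
    (hT : T₁ ∈ connectedComponentIn compositionOperators T₀)
    (hfin : HasFiniteAngularDerivative θ (φ₀.restrict Q) α) :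
    ∃ (v : ℂ) (δ : ℝ), 0 < δ ∧ HasAngularData θ (φ₀.restrict Q) α v δ ∧
      HasAngularData θ (φ₁.restrict Q) α v δ := by
  -- Only the existence of the angular data of `φ₀` is used here; the alternative is discarded.
  obtain ⟨v, δ, hδ, hdata, -⟩ := halt φ₀ φ₀ T₀ T₀ h₀ h₀ hP hfin
  have near : ∀ (φ ψ : Symbol) (A B : Hardy →L[ℂ] Hardy), IsCompositionOperator φ A →
      IsCompositionOperator ψ B → P φ → HasAngularData θ (φ.restrict Q) α v δ →
      dist A B < b δ → P ψ ∧ HasAngularData θ (ψ.restrict Q) α v δ := by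
    intro φ ψ A B hA hB hφ hφd hAB
    obtain ⟨v', δ', -, hd', h⟩ := halt φ ψ A B hA hB hφ hφd.finite
    obtain ⟨rfl, rfl⟩ := hφd.unique hd'
    refine h.resolve_right fun hle => ?_
    rw [dist_eq_norm] at hAB
    exact absurd (hle.trans (essentialNorm_le_norm _)) (not_le.2 hAB)
  -- `U` quantifies over all symbols inducing `T`, so uniqueness of the symbol is not needed. As `δ`
  -- is fixed on `U`, the radius `b δ` is uniform.
  have hmem := connectedComponentIn_subset_of_dist_lt
    (U := {T | ∀ φ, IsCompositionOperator φ T → P φ ∧ HasAngularData θ (φ.restrict Q) α v δ})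
    (hb δ hδ) (by
      rintro A ⟨⟨φ, hφ⟩, hA⟩ B - hAB ψ hψ
      obtain ⟨hφP, hφd⟩ := hA φ hφ
      exact near φ ψ A B hφ hψ hφP hφd hAB)
    (fun φ hφ => near φ₀ φ T₀ T₀ h₀ hφ hP hdata (by rw [dist_self]; exact hb δ hδ)) hT
  exact ⟨v, δ, hδ, hdata, (hmem φ₁ h₁).2⟩

end Components

end DirichletComposition

end

open DirichletComposition in
theorem mainTheorem7 :
    -- positive characteristic: lower bound for the essential norm of the difference
    (∀ (φ₀ φ₁ : Symbol) (T₀ T₁ : Hardy →L[ℂ] Hardy),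
      IsCompositionOperator φ₀ T₀ → IsCompositionOperator φ₁ T₁ →
      1 ≤ φ₀.char → 1 ≤ φ₁.char →
      ∀ Q : Finset ℕ, (∀ p ∈ Q, p.Prime) → ∀ α : ℝ,
        HasFiniteAngularDerivative 0 (φ₀.restrict Q) α →
        ∃ (v : ℂ) (δ : ℝ), 0 < δ ∧ HasAngularData 0 (φ₀.restrict Q) α v δ ∧
          (HasAngularData 0 (φ₁.restrict Q) α v δ ∨
            1 / δ ^ ((Q.card : ℝ) / 2) ≤ essentialNorm (T₀ - T₁))) ∧
    -- positive characteristic: operators in the same component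
    (∀ (φ₀ φ₁ : Symbol) (T₀ T₁ : Hardy →L[ℂ] Hardy),
      IsCompositionOperator φ₀ T₀ → IsCompositionOperator φ₁ T₁ →
      1 ≤ φ₀.char → φ₀.char = φ₁.char →
      T₁ ∈ connectedComponentIn compositionOperators T₀ →
      ∀ Q : Finset ℕ, (∀ p ∈ Q, p.Prime) → ∀ α : ℝ,
        HasFiniteAngularDerivative 0 (φ₀.restrict Q) α →
        ∃ (v : ℂ) (δ : ℝ), 0 < δ ∧ HasAngularData 0 (φ₀.restrict Q) α v δ ∧
          HasAngularData 0 (φ₁.restrict Q) α v δ) ∧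
    -- zero characteristic: lower bound, with a constant that depends only on `Q = {p}`
    (∀ p : ℕ, p.Prime → ∃ C : ℝ, 0 < C ∧
      ∀ (φ₀ φ₁ : Symbol) (T₀ T₁ : Hardy →L[ℂ] Hardy),
        IsCompositionOperator φ₀ T₀ → IsCompositionOperator φ₁ T₁ →
        φ₀.char = 0 → φ₁.char = 0 →
        ∀ α : ℝ, HasFiniteAngularDerivative (1 / 2) (φ₀.restrict {p}) α →
        ∃ (v : ℂ) (δ : ℝ), 0 < δ ∧ HasAngularData (1 / 2) (φ₀.restrict {p}) α v δ ∧
          (HasAngularData (1 / 2) (φ₁.restrict {p}) α v δ ∨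
            C / δ ^ (1 / 2 : ℝ) ≤ essentialNorm (T₀ - T₁))) ∧
    -- zero characteristic: operators in the same component
    (∀ (φ₀ φ₁ : Symbol) (T₀ T₁ : Hardy →L[ℂ] Hardy),
      IsCompositionOperator φ₀ T₀ → IsCompositionOperator φ₁ T₁ →
      φ₀.char = 0 → φ₁.char = 0 →
      T₁ ∈ connectedComponentIn compositionOperators T₀ →
      ∀ p : ℕ, p.Prime → ∀ α : ℝ,
        HasFiniteAngularDerivative (1 / 2) (φ₀.restrict {p}) α →
        ∃ (v : ℂ) (δ : ℝ), 0 < δ ∧ HasAngularData (1 / 2) (φ₀.restrict {p}) α v δ ∧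
          HasAngularData (1 / 2) (φ₁.restrict {p}) α v δ) := by
  refine ⟨?_, ?_, ?_, ?_⟩
  · intro φ₀ φ₁ T₀ T₁ h₀ h₁ hc₀ _ Q hQ α hfin
    obtain ⟨v, δ, hδ, hd, h⟩ := angular_alternative h₀ h₁ hQ hc₀ hfin
    exact ⟨v, δ, hδ, hd, h.imp_left And.right⟩
  · intro φ₀ φ₁ T₀ T₁ h₀ h₁ hc₀ _ hT Q hQ α hfin
    exact hasAngularData_of_mem_connectedComponentIn (P := fun φ => 1 ≤ φ.char)
      (b := fun δ => 1 / δ ^ ((Q.card : ℝ) / 2)) (fun δ hδ => by positivity)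
      (fun φ ψ A B hA hB hφ hφd => angular_alternative hA hB hQ hφ hφd) h₀ h₁ hc₀ hT hfin
  · intro p hp
    have hlog : 0 < Real.log p := Real.log_pos (by exact_mod_cast hp.one_lt)
    -- The square root of the residue `1` of zeta over the residue `1/log p` of `(1 - p^{-w})⁻¹`.
    refine ⟨√(Real.log p), Real.sqrt_pos.2 hlog, fun φ₀ φ₁ T₀ T₁ h₀ h₁ hc₀ _ α hfin => ?_⟩
    obtain ⟨v, δ, hδ, hd, h⟩ := angular_alternative_of_char_zero h₀ h₁ hp hc₀ hfin
    exact ⟨v, δ, hδ, hd, h.imp_left And.right⟩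
  · intro φ₀ φ₁ T₀ T₁ h₀ h₁ hc₀ _ hT p hp α hfin
    have hlog : 0 < Real.log p := Real.log_pos (by exact_mod_cast hp.one_lt)
    exact hasAngularData_of_mem_connectedComponentIn (P := fun φ => φ.char = 0)
      (b := fun δ => √(Real.log p) / δ ^ (1 / 2 : ℝ))
      (fun δ hδ => div_pos (Real.sqrt_pos.2 hlog) (Real.rpow_pos_of_pos hδ _))
      (fun φ ψ A B hA hB hφ hφd => angular_alternative_of_char_zero hA hB hp hφ hφd)
      h₀ h₁ hc₀ hT hfin
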